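/- Let $M$ be a compact $n$-dimensional smooth Riemannian manifold without boundary and let $K\in C(M\times M)$ satisfy $K\ge C$ on $M\times M$ for some constant $C>0$. Let $\mathcal P(M)$ be the set of Borel probability measures on $M$ with the narrow topology, and put $m_\mu(x)=\int_M K(x,y)\,d\mu(y)$ for $\mu\in\mathcal P(M)$, $x\in M$. For $T>0$ let $CE(0,T)$ be the set of pairs $(\mu,v)$ where $\mu:(0,T)\to\mathcal P(M)$, $t\mapsto\mu_t$, is narrowly continuous, $v:M\times(0,T)\to TM$ is Borel with $v_t(x)\in T_xM$ and $\int_0^T\int_M|v_t|\,d\mu_t\,dt<\infty$, and the continuity equation holds in the sense of distributions: $$\int_0^T\int_M \partial_t\varphi(x,t)+\langle \mathcal D_x\varphi(x,t),v_t(x)\rangle\,d\mu_t(x)\,dt=0\qquad\forall\varphi\in C^1_c(M\times(0,T)).$$ Let $CE(0,T;\nu\to\eta)$ be the set of those $(\mu,v)\in CE(0,T)$ with $\mu_t\to\nu$ narrowly as $t\downarrow0$ and $\mu_t\to\eta$ narrowly as $t\uparrow T$. Define $W_{m,2}(\nu,\eta)\in[0,\infty]$ by $$W_{m,2}^2(\nu,\eta)=\inf\Big\{\int_0^1\int_M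 m_{\mu_t}(x)|v_t(x)|^2\,d\mu_t(x)\,dt:\ (\mu,v)\in CE(0,1;\nu\to\eta)\Big\}.$$ A curve $\mu:[0,T]\to\mathcal P(M)$ is called absolutely continuous (with respect to $W_{m,2}$) if there is $g\in L^1(0,T)$ with $W_{m,2}(\mu_s,\mu_r)\le\int_s^r g(t)\,dt$ for all $0\le s\le r\le T$, and $|\dot\mu|(t)=\lim_{h\to0}W_{m,2}(\mu_{t+h},\mu_t)/|h|$ denotes its metric derivative, wherever this limit exists. Then, for every $T>0$: (1) If $\mu:[0,T]\to\mathcal P(M)$ is absolutely continuous with respect to $W_{m,2}$, there exists a Borel velocity field $(v_t)_{t\in(0,T)}$ such that $(\mu,v)\in CE(0,T)$ and, for a.e. $t\in(0,T)$, $|\dot\mu|(t)$ exists and $$\Big(\int_M m_{\mu_t}(x)|v_t(x)|^2\,d\mu_t(x)\Big)^{1/2}=|\dot\mu|(t).$$ (2) Conversely, if $(\mu,v)\in CE(0,T)$ and $\int_0^T\big(\int_M m_{\mu_t}|v_t|^2\,d\mu_t\big)^{1/2}dt<\infty$, then $\mu$ extends to a narrowly continuous curve on $[0,T]$, this extension is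 absolutely continuous with respect to $W_{m,2}$, and for a.e. $t\in(0,T)$ the metric derivative $|\dot\mu|(t)$ exists and $$|\dot\mu|(t)\le\Big(\int_M m_{\mu_t}(x)|v_t(x)|^2\,d\mu_t(x)\Big)^{1/2}.$$ -/

import Mathlib

open MeasureTheory Set Filter Topology Manifold Bundle
open scoped ENNReal ContDiff

noncomputable section

/-! ### Absolutely continuous curves and metric derivatives

Both notions are stated for an extended distance function `d : X → X → ℝ≥0∞`. -/

/-- The curve `γ : [0,T] → X` is absolutely continuous with respect to `d`: there is
`g ∈ L¹(0,T)` with `d(γ_s, γ_r) ≤ ∫_s^r g(t) dt` for all `0 ≤ s ≤ r ≤ T`. -/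
def IsAbsContCurve {X : Type*} (d : X → X → ℝ≥0∞) (T : ℝ) (γ : ℝ → X) : Prop :=
  ∃ g : ℝ → ℝ, IntegrableOn g (Ioo 0 T) ∧
    ∀ s ∈ Icc (0 : ℝ) T, ∀ r ∈ Icc (0 : ℝ) T, s ≤ r →
      d (γ s) (γ r) ≤ ENNReal.ofReal (∫ t in s..r, g t)

/-- The metric derivative `|γ̇|(t) = lim_{h → 0} d(γ_{t+h}, γ_t) / |h|` exists and equals `L`. -/
def HasMetricDerivAt {X : Type*} (d : X → X → ℝ≥0∞) (γ : ℝ → X) (t : ℝ) (L : ℝ≥0∞) : Prop :=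
  Tendsto (fun h : ℝ => d (γ (t + h)) (γ t) / ENNReal.ofReal |h|) (𝓝[≠] 0) (𝓝 L)

/-! ### The continuity equation on a manifold -/

section

variable {n : ℕ} {M : Type*} [TopologicalSpace M] [ChartedSpace (EuclideanSpace ℝ (Fin n)) M]

/-- A time dependent vector field: `v t x` is the velocity `v_t(x) ∈ T_x M`. Only times in the
interval under consideration matter. -/
abbrev VelocityField (n : ℕ) (M : Type*) [TopologicalSpace M]
    [ChartedSpace (EuclideanSpace ℝ (Fin n)) M] : Type _ :=
  ℝ → (x : M) → TangentSpace (𝓡 n) x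

/-- `φ ∈ C¹_c(M × (0,T))`, where `φ` is extended by zero to `M × ℝ`. -/
structure IsTestFunction (n : ℕ) {M : Type*} [TopologicalSpace M]
    [ChartedSpace (EuclideanSpace ℝ (Fin n)) M] (T : ℝ) (φ : M × ℝ → ℝ) : Prop where
  contMDiff : ContMDiff ((𝓡 n).prod 𝓘(ℝ, ℝ)) 𝓘(ℝ, ℝ) 1 φ
  hasCompactSupport : HasCompactSupport φ
  tsupport_subset : tsupport φ ⊆ univ ×ˢ Ioo 0 T

/-- The pairing `⟨𝒟φ(x,t), w⟩` of the differential of `φ(·,t)` at `x` with `w ∈ T_x M`. -/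
def spatialDiff (φ : M × ℝ → ℝ) (t : ℝ) (x : M) (w : TangentSpace (𝓡 n) x) : ℝ :=
  mfderiv (𝓡 n) 𝓘(ℝ, ℝ) (fun y => φ (y, t)) x w

/-- The map `(x,t) ↦ v_t(x)` from `M × (0,T)` to the tangent bundle `TM` is Borel. -/
def IsBorelVelocityField [MeasurableSpace M] [IsManifold (𝓡 n) 1 M] (T : ℝ)
    (v : VelocityField n M) : Prop :=
  @Measurable (M × Ioo (0 : ℝ) T) (TangentBundle (𝓡 n) M) _ (borel _)
    (fun p => ⟨p.1, v p.2 p.1⟩)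

variable [MeasurableSpace M] [BorelSpace M] [IsManifold (𝓡 n) 1 M]
  [RiemannianBundle (fun x : M => TangentSpace (𝓡 n) x)]

/-- `(μ, v) ∈ CE(0,T)`: `μ` is a narrowly continuous curve of probability measures on `(0,T)`,
`v` is a Borel velocity field with `∫_0^T ∫_M |v_t(x)| dμ_t dt < ∞`, and
`∂_t μ + div (v μ) = 0` holds in the sense of distributions on `M × (0,T)`. -/
structure IsCE (T : ℝ) (μ : ℝ → ProbabilityMeasure M) (v : VelocityField n M) : Prop where
  continuousOn : ContinuousOn μ (Ioo 0 T)
  borel : IsBorelVelocityField T v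
  integrable : ∫⁻ t in Ioo 0 T, ∫⁻ x, ‖v t x‖ₑ ∂(μ t : Measure M) < ⊤
  weak : ∀ φ : M × ℝ → ℝ, IsTestFunction n T φ →
    ∫ t in Ioo 0 T, ∫ x, (deriv (fun s => φ (x, s)) t + spatialDiff φ t x (v t x))
      ∂(μ t : Measure M) = 0

/-- `(μ, v) ∈ CE(0,T; ν → η)`: the boundary values `ν` at time `0` and `η` at time `T` are
attained as narrow limits, i.e. by the narrowly continuous extension of `μ` to `[0,T]`. -/
structure IsCEBetween (T : ℝ) (ν η : ProbabilityMeasure M) (μ : ℝ → ProbabilityMeasure M)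
    (v : VelocityField n M) : Prop extends IsCE T μ v where
  tendsto_zero : Tendsto μ (𝓝[>] 0) (𝓝 ν)
  tendsto_end : Tendsto μ (𝓝[<] T) (𝓝 η)

/-! ### The mobility and the transport distance -/

/-- The mobility `m_μ(x) = ∫_M K(x,y) dμ(y)`. -/
def mobility {M : Type*} [MeasurableSpace M] (K : M × M → ℝ) (μ : ProbabilityMeasure M)
    (x : M) : ℝ :=
  ∫ y, K (x, y) ∂(μ : Measure M)

/-- The weighted action `∫_M m_μ(x) |w(x)|² dμ(x)` of a vector field `w` at a fixed time. -/
def weightedAction (K : M × M → ℝ) (μ : ProbabilityMeasure M)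
    (w : (x : M) → TangentSpace (𝓡 n) x) : ℝ≥0∞ :=
  ∫⁻ x, ENNReal.ofReal (mobility K μ x) * ‖w x‖ₑ ^ 2 ∂(μ : Measure M)

/-- The transport distance `W_{m,2}`: its square is the infimum of
`∫_0^1 ∫_M m_{μ_t}(x) |v_t(x)|² dμ_t(x) dt` over `(μ, v) ∈ CE(0,1; ν → η)`
(so it is `∞` if there is no such pair of finite action). -/
def transportDist (n : ℕ) {M : Type*} [TopologicalSpace M]
    [ChartedSpace (EuclideanSpace ℝ (Fin n)) M] [MeasurableSpace M] [BorelSpace M]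
    [IsManifold (𝓡 n) 1 M] [RiemannianBundle (fun x : M => TangentSpace (𝓡 n) x)]
    (K : M × M → ℝ) (ν η : ProbabilityMeasure M) : ℝ≥0∞ :=
  (⨅ (μ : ℝ → ProbabilityMeasure M) (v : VelocityField n M) (_ : IsCEBetween 1 ν η μ v),
    ∫⁻ t in Ioo (0 : ℝ) 1, weightedAction K (μ t) (v t)) ^ (1 / 2 : ℝ)

end

end

noncomputable section

set_option linter.unusedSectionVars false

/-! ### The tangent bundle of a compact Riemannian manifold -/

section TangentBundleTopology

variable {n : ℕ} {M : Type*} [TopologicalSpace M]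
    [ChartedSpace (EuclideanSpace ℝ (Fin n)) M]

/-! Both halves rest on two opposite estimates between the distance and solutions of the continuity
equation.

Upper estimate (`IsFlow.transportDist_le`): the distance between two points of a solution is at most
its length `∫ (∫ m_μ |v|² dμ_t)^{1/2} dt`. Reparametrizing the curve over `[0,1]` with almost
constant speed turns the squared length into the action. Reversal and concatenation of curves then
give symmetry and the triangle inequality. Part (2) follows: finite length bounds the increments,
Lebesgue differentiation bounds the metric derivative, and the endpoint limits exist because the
curve is Cauchy for the distance while the narrow topology is compact.

Lower estimate (`enorm_integral_sub_le_transportDist`, `exists_slope_estimate`): for a `C¹` function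
`φ` the increment of `∫ φ dν` is at most the distance times the slope `(∫ |∇φ|² / m_ν dν)^{1/2}`, up
to a local error. The error is small because closeness in the distance implies narrow closeness and
the slope is narrowly continuous; positivity of `m_ν` enters here.

For part (1), let `ρ` be the metric derivative. The lower estimate, summed along the curve, bounds
`Λ(φ) = -∫∫ ∂_t φ dμ_t dt` by `∫ ρ · slope dt`, hence by `(∫ρ)^{1/2} B(φ,φ)^{1/2}` with `B(φ,φ) = ∫
ρ ∫ |∇φ|² / m_μ dμ_t dt`. The weight `ρ` is needed because `ρ` is integrable but not assumed square
integrable. Riesz representation, carried out by hand with a minimizing sequence `φ_k`, gives `v =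
lim (ρ/m_μ) ∇φ_k` solving the continuity equation with `∫∫ m_μ |v|² / ρ dμ_t dt ≤ ∫ ρ`
(`exists_velocityField`).

It remains to make this sharp at almost every time. With `a(t) = ∫ m_μ |v_t|² / ρ dμ_t` the action
is `ρ a`, and the upper estimate gives `ρ ≤ (ρ a)^{1/2}`, that is `ρ ≤ a`. Since `∫ a ≤ ∫ ρ`,
equality holds almost everywhere and the action is `ρ²`.

Technically, a solution on `(0,T)` with endpoint limits is extended to all of `ℝ` (constant
measures, zero velocity) as an `IsFlow`, which is tested only against functions of space;
`IsCE.isFlow` and `IsFlow.isCE` translate between the two notions. -/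

instance finiteDimensional_tangentSpace (x : M) :
    FiniteDimensional ℝ (TangentSpace (𝓡 n) x) :=
  inferInstanceAs (FiniteDimensional ℝ (EuclideanSpace ℝ (Fin n)))

variable [IsManifold (𝓡 n) ∞ M]

instance measurableSpace_tangentBundle : MeasurableSpace (TangentBundle (𝓡 n) M) := borel _

instance borelSpace_tangentBundle : BorelSpace (TangentBundle (𝓡 n) M) := ⟨rfl⟩

instance t2Space_tangentBundle [T2Space M] : T2Space (TangentBundle (𝓡 n) M) := by
  refine ⟨fun p q hpq => ?_⟩
  by_cases hb : p.1 = q.1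
  · let e := trivializationAt (EuclideanSpace ℝ (Fin n)) (TangentSpace (𝓡 n) (M := M)) p.1
    have hp : p ∈ e.source := FiberBundle.mem_trivializationAt_proj_source
    have hq : q ∈ e.source := by
      rw [e.mem_source, ← hb]; exact e.mem_source.1 hp
    have hne : e p ≠ e q := fun h => hpq (e.injOn hp hq h)
    obtain ⟨u, v, hu, hv, hpu, hqv, huv⟩ := t2_separation hne
    refine ⟨e.source ∩ e ⁻¹' u, e.source ∩ e ⁻¹' v,
      e.toOpenPartialHomeomorph.isOpen_inter_preimage hu,
      e.toOpenPartialHomeomorph.isOpen_inter_preimage hv, ⟨hp, hpu⟩, ⟨hq, hqv⟩, ?_⟩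
    exact (huv.preimage _).mono inter_subset_right inter_subset_right
  · obtain ⟨u, v, hu, hv, hpu, hqv, huv⟩ := t2_separation hb
    have hc := FiberBundle.continuous_proj (EuclideanSpace ℝ (Fin n))
      (TangentSpace (𝓡 n) (M := M))
    exact ⟨_, _, hu.preimage hc, hv.preimage hc, hpu, hqv, huv.preimage _⟩

instance locallyCompactSpace_tangentBundle : LocallyCompactSpace (TangentBundle (𝓡 n) M) :=
  Manifold.locallyCompact_of_finiteDimensional (𝓡 n).tangent

theorem secondCountableTopology_of_compact_manifold (n : ℕ) (M : Type*) [TopologicalSpace M]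
    [ChartedSpace (EuclideanSpace ℝ (Fin n)) M] [CompactSpace M] : SecondCountableTopology M :=
  ChartedSpace.secondCountable_of_sigmaCompact (EuclideanSpace ℝ (Fin n)) M

/-- By compactness finitely many trivialization domains cover the bundle, each homeomorphic to an
open subset of a second countable product. With the Hausdorff property and local compactness this
makes the bundle metrizable, so pointwise limits of Borel vector fields are Borel. -/
instance secondCountableTopology_tangentBundle [CompactSpace M] :
    SecondCountableTopology (TangentBundle (𝓡 n) M) := by
  have := secondCountableTopology_of_compact_manifold n M
  let e := fun x : M =>
    trivializationAt (EuclideanSpace ℝ (Fin n)) (TangentSpace (𝓡 n) (M := M)) x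
  obtain ⟨s, hs⟩ := isCompact_univ.elim_finite_subcover (fun x : M => (e x).baseSet)
    (fun x => (e x).open_baseSet)
    (fun x _ => mem_iUnion.2 ⟨x, FiberBundle.mem_baseSet_trivializationAt' x⟩)
  have (x : s) : SecondCountableTopology ↥((e x).source) :=
    (e x).toOpenPartialHomeomorph.toHomeomorphSourceTarget.isEmbedding.secondCountableTopology
  refine TopologicalSpace.secondCountableTopology_of_countable_cover (ι := s)
    (U := fun x => (e x).source) (fun x => (e x).open_source) ?_
  refine eq_univ_of_forall fun p => ?_
  obtain ⟨x, hx, hp⟩ := mem_iUnion₂.1 (hs (mem_univ p.1))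
  exact mem_iUnion.2 ⟨⟨x, hx⟩, (e x).mem_source.2 hp⟩

end TangentBundleTopology

/-! ### Continuity of the differential, the time derivative and the Riemannian gradient -/

section Gradient

variable {n : ℕ} {M : Type*} [TopologicalSpace M]
    [ChartedSpace (EuclideanSpace ℝ (Fin n)) M] [IsManifold (𝓡 n) ∞ M]

/-- A `C¹` function on `M × ℝ`. -/
abbrev IsC1 (n : ℕ) {M : Type*} [TopologicalSpace M]
    [ChartedSpace (EuclideanSpace ℝ (Fin n)) M] (φ : M × ℝ → ℝ) : Prop :=
  ContMDiff ((𝓡 n).prod 𝓘(ℝ, ℝ)) 𝓘(ℝ, ℝ) 1 φ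

theorem IsC1.slice {φ : M × ℝ → ℝ} (hφ : IsC1 n φ) (t : ℝ) :
    ContMDiff (𝓡 n) 𝓘(ℝ, ℝ) 1 (fun y => φ (y, t)) :=
  hφ.comp (contMDiff_id.prodMk contMDiff_const)

/-- In this form the joint continuity in all variables follows from continuity of the tangent map of
a `C¹` function on the product. -/
theorem spatialDiff_eq_mfderiv_prod {φ : M × ℝ → ℝ} (hφ : IsC1 n φ) (t : ℝ) (x : M)
    (w : TangentSpace (𝓡 n) x) :
    spatialDiff φ t x w = mfderiv ((𝓡 n).prod 𝓘(ℝ, ℝ)) 𝓘(ℝ, ℝ) φ (x, t) (w, (0 : ℝ)) := by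
  have h1 : MDifferentiableAt ((𝓡 n).prod 𝓘(ℝ, ℝ)) 𝓘(ℝ, ℝ) φ (x, t) :=
    hφ.mdifferentiable one_ne_zero _
  have h2 : HasMFDerivAt (𝓡 n) ((𝓡 n).prod 𝓘(ℝ, ℝ)) (fun y : M => (y, t)) x
      ((ContinuousLinearMap.id ℝ (TangentSpace (𝓡 n) x)).prod
        (0 : TangentSpace (𝓡 n) x →L[ℝ] TangentSpace 𝓘(ℝ, ℝ) t)) :=
    (hasMFDerivAt_id x).prodMk (hasMFDerivAt_const t x)
  have h3 := (h1.hasMFDerivAt.comp x h2).mfderiv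
  unfold spatialDiff
  change mfderiv (𝓡 n) 𝓘(ℝ, ℝ) (φ ∘ fun y : M => (y, t)) x w = _
  rw [h3]
  rfl

theorem continuous_constant_vectorField_real (c : ℝ) :
    Continuous (fun t : ℝ => (⟨t, c⟩ : TangentBundle 𝓘(ℝ, ℝ) ℝ)) :=
  (tangentBundleModelSpaceHomeomorph 𝓘(ℝ, ℝ)).symm.continuous.comp
    (g := (tangentBundleModelSpaceHomeomorph 𝓘(ℝ, ℝ)).symm) (f := fun t : ℝ => ((t, c) : ℝ × ℝ))
    (continuous_id.prodMk continuous_const)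

theorem continuous_spatialDiff {φ : M × ℝ → ℝ} (hφ : IsC1 n φ) :
    Continuous (fun p : TangentBundle (𝓡 n) M × ℝ => spatialDiff φ p.2 p.1.1 p.1.2) := by
  have h1 : Continuous (fun p : TangentBundle (𝓡 n) M × ℝ =>
      (equivTangentBundleProd (𝓡 n) M 𝓘(ℝ, ℝ) ℝ).symm (p.1, ⟨p.2, (0 : ℝ)⟩)) := by
    exact (contMDiff_equivTangentBundleProd_symm (n := 0)).continuous.comp
      (continuous_fst.prodMk ((continuous_constant_vectorField_real 0).comp continuous_snd))
  have h2 := (ContMDiff.continuous_tangentMap hφ le_rfl).comp h1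
  have h3 := (tangentBundleModelSpaceHomeomorph 𝓘(ℝ, ℝ)).continuous.comp h2
  have h4 := continuous_snd.comp h3
  refine h4.congr fun p => ?_
  rw [spatialDiff_eq_mfderiv_prod hφ]
  rfl

theorem hasDerivAt_time {φ : M × ℝ → ℝ} (hφ : IsC1 n φ) (x : M) (t : ℝ) :
    HasDerivAt (fun s => φ (x, s)) (deriv (fun s => φ (x, s)) t) t := by
  have h : ContMDiff 𝓘(ℝ, ℝ) 𝓘(ℝ, ℝ) 1 (fun s : ℝ => φ (x, s)) :=
    hφ.comp (contMDiff_const.prodMk contMDiff_id)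
  exact ((contMDiff_iff_contDiff.1 h).differentiable one_ne_zero t).hasDerivAt

/-- The time derivative is the fibre component of the tangent map of `φ` applied to the continuous
vector field `(0, 1)`. -/
theorem continuous_deriv_time {φ : M × ℝ → ℝ} (hφ : IsC1 n φ) :
    Continuous (fun p : M × ℝ => deriv (fun s => φ (p.1, s)) p.2) := by
  have h0 : Continuous (fun x : M => (⟨x, 0⟩ : TangentBundle (𝓡 n) M)) :=
    (contMDiff_zeroSection ℝ (IB := 𝓡 n) (n := 0) (F := EuclideanSpace ℝ (Fin n))
      (TangentSpace (𝓡 n) (M := M))).continuous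
  have h1 : Continuous (fun p : M × ℝ => (equivTangentBundleProd (𝓡 n) M 𝓘(ℝ, ℝ) ℝ).symm
      ((⟨p.1, 0⟩ : TangentBundle (𝓡 n) M), ⟨p.2, (1 : ℝ)⟩)) := by
    exact (contMDiff_equivTangentBundleProd_symm (n := 0)).continuous.comp
      ((h0.comp continuous_fst).prodMk
        ((continuous_constant_vectorField_real 1).comp continuous_snd))
  have h2 := (ContMDiff.continuous_tangentMap hφ le_rfl).comp h1
  have h3 := (tangentBundleModelSpaceHomeomorph 𝓘(ℝ, ℝ)).continuous.comp h2
  have h4 := continuous_snd.comp h3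
  refine h4.congr fun p => ?_
  obtain ⟨x, t⟩ := p
  have d1 : MDifferentiableAt ((𝓡 n).prod 𝓘(ℝ, ℝ)) 𝓘(ℝ, ℝ) φ (x, t) :=
    hφ.mdifferentiable one_ne_zero _
  have d2 : HasMFDerivAt 𝓘(ℝ, ℝ) ((𝓡 n).prod 𝓘(ℝ, ℝ)) (fun s : ℝ => (x, s)) t
      ((0 : TangentSpace 𝓘(ℝ, ℝ) t →L[ℝ] TangentSpace (𝓡 n) x).prod
        (ContinuousLinearMap.id ℝ (TangentSpace 𝓘(ℝ, ℝ) t))) :=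
    (hasMFDerivAt_const x t).prodMk (hasMFDerivAt_id t)
  have d3 := (d1.hasMFDerivAt.comp t d2)
  have d4 : HasFDerivAt (fun s : ℝ => φ (x, s)) (_ : ℝ →L[ℝ] ℝ) t :=
    hasMFDerivAt_iff_hasFDerivAt.1 d3
  rw [d4.hasDerivAt.deriv]
  rfl

variable [RiemannianBundle (fun x : M => TangentSpace (𝓡 n) x)]


instance completeSpace_tangentSpace (x : M) : CompleteSpace (TangentSpace (𝓡 n) x) :=
  FiniteDimensional.complete ℝ _

/-- The spatial Riemannian gradient of a function on `M × ℝ`. -/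
def grad (φ : M × ℝ → ℝ) (t : ℝ) (x : M) : TangentSpace (𝓡 n) x :=
  (InnerProductSpace.toDual ℝ (TangentSpace (𝓡 n) x)).symm
    (show TangentSpace (𝓡 n) x →L[ℝ] ℝ from mfderiv (𝓡 n) 𝓘(ℝ, ℝ) (fun y => φ (y, t)) x)

theorem inner_grad (φ : M × ℝ → ℝ) (t : ℝ) (x : M) (w : TangentSpace (𝓡 n) x) :
    inner ℝ (grad φ t x) w = spatialDiff φ t x w :=
  InnerProductSpace.toDual_symm_apply ..

variable [IsContMDiffRiemannianBundle (𝓡 n) ∞ (EuclideanSpace ℝ (Fin n))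
      (fun x : M => TangentSpace (𝓡 n) x)]

instance isContinuousRiemannianBundle_tangent : IsContinuousRiemannianBundle
    (EuclideanSpace ℝ (Fin n)) (fun x : M => TangentSpace (𝓡 n) x) := by
  obtain ⟨g, hg, h⟩ := IsContMDiffRiemannianBundle.exists_contMDiff (IB := 𝓡 n) (n := ∞)
    (F := EuclideanSpace ℝ (Fin n)) (E := fun x : M => TangentSpace (𝓡 n) x)
  exact ⟨g, hg.continuous, h⟩

theorem continuous_norm_tangentBundle :
    Continuous (fun p : TangentBundle (𝓡 n) M => ‖p.2‖) := by
  have h := Continuous.inner_bundle (F := EuclideanSpace ℝ (Fin n))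
    (E := fun x : M => TangentSpace (𝓡 n) x) (b := fun p : TangentBundle (𝓡 n) M => p.1)
    (v := fun p => p.2) (w := fun p => p.2) continuous_id continuous_id
  refine (Real.continuous_sqrt.comp h).congr fun p => ?_
  simp only [Function.comp, real_inner_self_eq_norm_sq]
  exact Real.sqrt_sq (norm_nonneg _)

theorem continuous_smul_tangentBundle :
    Continuous (fun p : ℝ × TangentBundle (𝓡 n) M =>
      (⟨p.2.1, p.1 • p.2.2⟩ : TangentBundle (𝓡 n) M)) := by
  rw [continuous_iff_continuousAt]
  rintro ⟨c, p⟩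
  rw [FiberBundle.continuousAt_totalSpace]
  have hproj := FiberBundle.continuous_proj (EuclideanSpace ℝ (Fin n))
      (TangentSpace (𝓡 n) (M := M))
  refine ⟨(hproj.comp continuous_snd).continuousAt, ?_⟩
  let e := trivializationAt (EuclideanSpace ℝ (Fin n)) (TangentSpace (𝓡 n) (M := M)) p.1
  have h1 : ContinuousAt (fun q : ℝ × TangentBundle (𝓡 n) M => q.1 • (e q.2).2) (c, p) := by
    have : ContinuousAt (fun q : TangentBundle (𝓡 n) M => (e q).2) p :=
      ((FiberBundle.continuousAt_totalSpace _ id).1 continuousAt_id).2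
    exact continuousAt_fst.smul (this.comp (f := Prod.snd) (x := (c, p)) continuousAt_snd)
  refine h1.congr ?_
  have : ∀ᶠ q : ℝ × TangentBundle (𝓡 n) M in 𝓝 (c, p), q.2.1 ∈ e.baseSet :=
    (hproj.comp continuous_snd).continuousAt.eventually_mem
      (e.open_baseSet.mem_nhds (FiberBundle.mem_baseSet_trivializationAt' p.1))
  filter_upwards [this] with q hq
  exact ((e.linear ℝ hq).map_smul q.1 q.2.2).symm

/-- In a trivialization around the base point, the gradient is compared with the section having
constant coordinates `u₀`, those of the gradient at the base point. The difference `d` is estimated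
by pairing it with itself, which involves only the continuous quantities `dφ(b_i)` and `⟨u₀, b_i⟩`
for a frame `b_i`; the metric never has to be inverted. -/
theorem continuous_grad {φ : M × ℝ → ℝ} (hφ : IsC1 n φ) :
    Continuous (fun p : M × ℝ => (⟨p.1, grad φ p.2 p.1⟩ : TangentBundle (𝓡 n) M)) := by
  rw [continuous_iff_continuousAt]
  rintro ⟨x₀, t₀⟩
  rw [FiberBundle.continuousAt_totalSpace]
  refine ⟨continuousAt_fst, ?_⟩
  let e := trivializationAt (EuclideanSpace ℝ (Fin n)) (TangentSpace (𝓡 n) (M := M)) x₀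
  have hx₀ : x₀ ∈ e.baseSet := FiberBundle.mem_baseSet_trivializationAt' x₀
  have hb : ∀ᶠ p : M × ℝ in 𝓝 (x₀, t₀), p.1 ∈ e.baseSet :=
    continuousAt_fst.eventually_mem (e.open_baseSet.mem_nhds hx₀)
  have hsec (u : EuclideanSpace ℝ (Fin n)) : ContinuousAt
      (fun p : M × ℝ => (⟨p.1, e.symm p.1 u⟩ : TangentBundle (𝓡 n) M)) (x₀, t₀) := by
    rw [FiberBundle.continuousAt_totalSpace]
    refine ⟨continuousAt_fst, continuousAt_const (y := u) |>.congr ?_⟩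
    filter_upwards [hb] with p hp
    exact (congrArg Prod.snd (e.apply_mk_symm hp u)).symm
  let u₀ := (e ⟨x₀, grad φ t₀ x₀⟩).2
  let b := fun i => EuclideanSpace.basisFun (Fin n) ℝ i
  -- The total defect of the section `u₀` as a representative of the differential, measured on the
  -- frame. It is continuous and vanishes at the base point.
  let h := fun p : M × ℝ => ∑ i, |spatialDiff φ p.2 p.1 (e.symm p.1 (b i)) -
    inner ℝ (e.symm p.1 u₀ : TangentSpace (𝓡 n) p.1) (e.symm p.1 (b i))|
  have hz₀ : (e.symm x₀ u₀ : TangentSpace (𝓡 n) x₀) = grad φ t₀ x₀ :=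
    e.symm_apply_apply_mk hx₀ _
  have hcont : ContinuousAt h (x₀, t₀) := by
    refine tendsto_finsetSum _ fun i _ => ContinuousAt.abs (ContinuousAt.sub ?_ ?_)
    · exact (continuous_spatialDiff hφ).continuousAt.comp
        (f := fun p : M × ℝ => ((⟨p.1, e.symm p.1 (b i)⟩ : TangentBundle (𝓡 n) M), p.2))
        (x := (x₀, t₀)) ((hsec (b i)).prodMk continuousAt_snd)
    · exact ContinuousAt.inner_bundle (F := EuclideanSpace ℝ (Fin n))
        (E := fun x : M => TangentSpace (𝓡 n) x) (b := fun p : M × ℝ => p.1) (hsec u₀) (hsec (b i))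
  have hh0 : h (x₀, t₀) = 0 := by
    refine Finset.sum_eq_zero fun i _ => ?_
    simp only [hz₀, inner_grad, sub_self, abs_zero]
  obtain ⟨C, hC, hCe⟩ := eventually_norm_trivializationAt_lt (EuclideanSpace ℝ (Fin n))
    (fun x : M => TangentSpace (𝓡 n) x) x₀
  have hCe' : ∀ᶠ p : M × ℝ in 𝓝 (x₀, t₀), ‖e.continuousLinearMapAt ℝ p.1‖ < C :=
    (continuousAt_fst (p := (x₀, t₀))).tendsto.eventually hCe
  rw [ContinuousAt, tendsto_iff_norm_sub_tendsto_zero]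
  have hlim : Tendsto (fun p => C * (C * h p)) (𝓝 (x₀, t₀)) (𝓝 0) := by
    have := (hcont.tendsto.const_mul C).const_mul C
    simpa [hh0] using this
  refine squeeze_zero' (Eventually.of_forall fun _ => norm_nonneg _) ?_ hlim
  filter_upwards [hb, hCe'] with p hp hpC
  let A := e.continuousLinearEquivAt ℝ p.1 hp
  have hA (w : TangentSpace (𝓡 n) p.1) : A w = (e ⟨p.1, w⟩).2 := rfl
  have hAle (w : TangentSpace (𝓡 n) p.1) : ‖A w‖ ≤ C * ‖w‖ := by
    have h1 : A w = e.continuousLinearMapAt ℝ p.1 w :=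
       congrFun (e.coe_continuousLinearEquivAt_eq (R := ℝ) hp) w
    rw [h1]
    exact ((e.continuousLinearMapAt ℝ p.1).le_opNorm w).trans (by gcongr)
  have hAs (u : EuclideanSpace ℝ (Fin n)) : A.symm u = e.symm p.1 u := rfl
  set d : TangentSpace (𝓡 n) p.1 := grad φ p.2 p.1 - A.symm u₀ with hd
  have hAd : A d = (e ⟨p.1, grad φ p.2 p.1⟩).2 - u₀ := by
    rw [hd, map_sub, A.apply_symm_apply, hA]
  change ‖(e ⟨p.1, grad φ p.2 p.1⟩).2 - u₀‖ ≤ _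
  rw [← hAd]
  refine (hAle d).trans ?_
  gcongr
  -- Expanding one factor of `⟨d, d⟩` in the frame produces the terms of `h`, with coefficients
  -- bounded by `C ‖d‖`.
  have hsq : ‖d‖ * ‖d‖ ≤ (C * h p) * ‖d‖ := by
    have hexp : d = ∑ i, (A d) i • A.symm (b i) := by
      apply A.injective
      rw [map_sum]
      simp only [map_smul, A.apply_symm_apply]
      exact ((EuclideanSpace.basisFun (Fin n) ℝ).sum_repr (A d)).symm
    calc ‖d‖ * ‖d‖ = inner ℝ d d := (real_inner_self_eq_norm_mul_norm d).symm
      _ = inner ℝ d (∑ i, (A d) i • A.symm (b i)) := by rw [← hexp]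
      _ = ∑ i, (A d) i * (spatialDiff φ p.2 p.1 (e.symm p.1 (b i)) -
          inner ℝ (e.symm p.1 u₀ : TangentSpace (𝓡 n) p.1) (e.symm p.1 (b i))) := by
        rw [inner_sum]
        refine Finset.sum_congr rfl fun i _ => ?_
        rw [real_inner_smul_right, hd, inner_sub_left, inner_grad]
        rfl
      _ ≤ ∑ i, (C * ‖d‖) * |spatialDiff φ p.2 p.1 (e.symm p.1 (b i)) -
          inner ℝ (e.symm p.1 u₀ : TangentSpace (𝓡 n) p.1) (e.symm p.1 (b i))| := by
        refine Finset.sum_le_sum fun i _ => (le_abs_self _).trans ?_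
        rw [abs_mul]
        gcongr
        exact (PiLp.norm_apply_le (A d) i).trans (hAle d)
      _ = (C * h p) * ‖d‖ := by rw [← Finset.mul_sum]; ring
  rcases eq_or_ne ‖d‖ 0 with h0 | h0
  · rw [h0]; have : 0 ≤ h p := Finset.sum_nonneg fun _ _ => abs_nonneg _
    positivity
  · exact le_of_mul_le_mul_right hsq ((norm_nonneg d).lt_of_ne' h0)

end Gradient

/-! ### Curves of probability measures on a compact space -/

section CompactSpaceCurves

open ProbabilityTheory

variable {X : Type*} [TopologicalSpace X] [CompactSpace X] [MeasurableSpace X] [BorelSpace X]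

/-- Compactness makes `p ↦ f(p,·)` continuous in the sup norm. The change of integrand is therefore
uniformly small over all probability measures, and the change of measure at fixed integrand is
narrow convergence. -/
theorem continuous_integral_pairing {P : Type*} [TopologicalSpace P] {f : P × X → ℝ}
    (hf : Continuous f) :
    Continuous (fun q : P × ProbabilityMeasure X => ∫ x, f (q.1, x) ∂(q.2 : Measure X)) := by
  rw [continuous_iff_continuousAt]
  rintro ⟨p₀, μ₀⟩
  let F : C(P, C(X, ℝ)) := (⟨f, hf⟩ : C(P × X, ℝ)).curry
  have hF (p : P) (x : X) : F p x = f (p, x) := rfl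
  have hint (g : C(X, ℝ)) (μ : ProbabilityMeasure X) : Integrable g (μ : Measure X) :=
    (BoundedContinuousFunction.mkOfCompact g).integrable _
  have h1 : Tendsto (fun q : P × ProbabilityMeasure X => ∫ x, F p₀ x ∂(q.2 : Measure X))
      (𝓝 (p₀, μ₀)) (𝓝 (∫ x, F p₀ x ∂(μ₀ : Measure X))) :=
    ProbabilityMeasure.tendsto_iff_forall_integral_tendsto.1
      (continuousAt_snd (p := (p₀, μ₀))).tendsto (BoundedContinuousFunction.mkOfCompact (F p₀))
  have h2 : Tendsto (fun q : P × ProbabilityMeasure X => ‖F q.1 - F p₀‖)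
      (𝓝 (p₀, μ₀)) (𝓝 0) := by
    have : ContinuousAt (fun q : P × ProbabilityMeasure X => ‖F q.1 - F p₀‖) (p₀, μ₀) := by
      fun_prop
    simpa [ContinuousAt] using this
  have h3 : Tendsto (fun q : P × ProbabilityMeasure X =>
      ∫ x, f (q.1, x) ∂(q.2 : Measure X) - ∫ x, F p₀ x ∂(q.2 : Measure X)) (𝓝 (p₀, μ₀)) (𝓝 0) := by
    refine squeeze_zero_norm (fun q => ?_) h2
    have : ∫ x, f (q.1, x) ∂(q.2 : Measure X) - ∫ x, F p₀ x ∂(q.2 : Measure X) =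
        ∫ x, (F q.1 - F p₀) x ∂(q.2 : Measure X) :=
      (integral_sub (hint (F q.1) q.2) (hint (F p₀) q.2)).symm
    rw [this]
    refine (norm_integral_le_of_norm_le_const (C := ‖F q.1 - F p₀‖)
      (Eventually.of_forall fun x => (F q.1 - F p₀).norm_coe_le_norm x)).trans ?_
    simp
  have h4 := h3.add h1
  simp only [sub_add_cancel, zero_add] at h4
  exact h4

theorem integrable_of_continuous {f : X → ℝ} (hf : Continuous f) (μ : ProbabilityMeasure X) :
    Integrable f (μ : Measure X) :=
  (BoundedContinuousFunction.mkOfCompact ⟨f, hf⟩).integrable _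

theorem eventually_forall_abs_lt {f : X × ℝ → ℝ} (hf : Continuous f) {t₀ : ℝ}
    (h0 : ∀ x, f (x, t₀) = 0) {ε : ℝ} (hε : 0 < ε) :
    ∀ᶠ u in 𝓝 t₀, ∀ x, |f (x, u)| < ε := by
  have := isCompact_univ.eventually_forall_of_forall_eventually (X := ℝ) (Y := X) (x₀ := t₀)
    (P := fun u x => |f (x, u)| < ε) (fun x _ => by
      have : ContinuousAt (fun q : ℝ × X => |f (q.2, q.1)|) (t₀, x) := by fun_prop
      refine this.eventually_lt continuousAt_const ?_
      simp [h0, hε])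
  filter_upwards [this] with u hu x using hu x (mem_univ x)

/-- The portmanteau theorem makes `t ↦ μ_t(U)` lower semicontinuous for open `U`, and open sets form
a generating π-system. -/
theorem measurable_of_continuous_curve [T2Space X] [SecondCountableTopology X]
    {μ : ℝ → ProbabilityMeasure X} (hμ : Continuous μ) :
    Measurable (fun t => (μ t : Measure X)) := by
  refine Measurable.measure_of_isPiSystem_of_isProbabilityMeasure
    (S := {s | IsOpen s}) (BorelSpace.measurable_eq) isPiSystem_isOpen fun s hs => ?_
  refine LowerSemicontinuous.measurable ?_
  rw [lowerSemicontinuous_iff_le_liminf]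
  intro t
  exact ProbabilityMeasure.le_liminf_measure_open_of_tendsto hμ.continuousAt.tendsto hs

/-- A continuous curve of probability measures, seen as a Markov kernel. -/
def curveKernel [T2Space X] [SecondCountableTopology X] {μ : ℝ → ProbabilityMeasure X}
    (hμ : Continuous μ) : Kernel ℝ X :=
  ⟨fun t => (μ t : Measure X), measurable_of_continuous_curve hμ⟩

theorem curveKernel_apply [T2Space X] [SecondCountableTopology X] {μ : ℝ → ProbabilityMeasure X}
    (hμ : Continuous μ) (t : ℝ) : curveKernel hμ t = (μ t : Measure X) := rfl

instance isMarkovKernel_curveKernel [T2Space X] [SecondCountableTopology X]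
    {μ : ℝ → ProbabilityMeasure X} (hμ : Continuous μ) : IsMarkovKernel (curveKernel hμ) :=
  ⟨fun t => by rw [curveKernel_apply]; infer_instance⟩

theorem measurable_lintegral_curve [T2Space X] [SecondCountableTopology X]
    {μ : ℝ → ProbabilityMeasure X} (hμ : Continuous μ) {f : ℝ × X → ℝ≥0∞} (hf : Measurable f) :
    Measurable (fun t => ∫⁻ x, f (t, x) ∂(μ t : Measure X)) :=
  hf.lintegral_kernel_prod_right' (κ := curveKernel hμ)

theorem stronglyMeasurable_integral_curve [T2Space X] [SecondCountableTopology X]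
    {μ : ℝ → ProbabilityMeasure X} (hμ : Continuous μ) {f : ℝ × X → ℝ} (hf : Measurable f) :
    StronglyMeasurable (fun t => ∫ x, f (t, x) ∂(μ t : Measure X)) :=
  hf.stronglyMeasurable.integral_kernel_prod_right' (κ := curveKernel hμ)

end CompactSpaceCurves

/-! ### A local-to-global estimate -/

/-- Continuous induction: the set of times where the estimate from `a` holds is closed and can
always be prolonged to the right. It replaces differentiation of `D`, which is applied below to
functions only known to be continuous. -/
theorem abs_sub_le_sub_of_eventually_right {D N : ℝ → ℝ} {a b : ℝ} (hab : a ≤ b)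
    (hD : ContinuousOn D (Icc a b)) (hN : ContinuousOn N (Icc a b))
    (h : ∀ t ∈ Ico a b, ∀ᶠ u in 𝓝[>] t, |D u - D t| ≤ N u - N t) :
    |D b - D a| ≤ N b - N a := by
  have hcl : IsClosed ({t | |D t - D a| ≤ N t - N a} ∩ Icc a b) := by
    have : ({t | |D t - D a| ≤ N t - N a} ∩ Icc a b) =
        {t ∈ Icc a b | |D t - D a| ≤ N t - N a} := by ext; simp [and_comm]
    rw [this]
    exact isClosed_Icc.isClosed_le (hD.sub continuousOn_const).abs (hN.sub continuousOn_const)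
  refine hcl.mem_of_ge_of_forall_exists_gt (by simp) hab fun t ht => ?_
  have h2 : ∀ᶠ u in 𝓝[>] t, u ∈ Ioc t b := Ioc_mem_nhdsGT ht.2.2
  obtain ⟨u, hu, hub⟩ := ((h t ht.2).and h2).exists
  refine ⟨u, ?_, hub⟩
  have := abs_sub_le (D u) (D t) (D a)
  have h3 : |D t - D a| ≤ N t - N a := ht.1
  change |D u - D a| ≤ N u - N a
  linarith

/-! ### Global solutions of the continuity equation -/

section Flow

variable {n : ℕ} {M : Type*} [TopologicalSpace M] [T2Space M] [CompactSpace M]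
    [SecondCountableTopology M]
    [ChartedSpace (EuclideanSpace ℝ (Fin n)) M] [IsManifold (𝓡 n) ∞ M]
    [RiemannianBundle (fun x : M => TangentSpace (𝓡 n) x)]
    [IsContMDiffRiemannianBundle (𝓡 n) ∞ (EuclideanSpace ℝ (Fin n))
      (fun x : M => TangentSpace (𝓡 n) x)]
    [MeasurableSpace M] [BorelSpace M]

theorem abs_spatialDiff_le (φ : M × ℝ → ℝ) (t : ℝ) (x : M) (w : TangentSpace (𝓡 n) x) :
    |spatialDiff φ t x w| ≤ ‖grad (n := n) φ t x‖ * ‖w‖ := by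
  rw [← inner_grad]
  exact abs_real_inner_le_norm _ _

theorem continuous_norm_grad {φ : M × ℝ → ℝ} (hφ : IsC1 n φ) :
    Continuous (fun p : M × ℝ => ‖grad (n := n) φ p.2 p.1‖) :=
  continuous_norm_tangentBundle.comp (continuous_grad hφ)

theorem exists_forall_norm_grad_le {φ : M × ℝ → ℝ} (hφ : IsC1 n φ) (a b : ℝ) :
    ∃ C, 0 ≤ C ∧ ∀ t ∈ Icc a b, ∀ x, ‖grad (n := n) φ t x‖ ≤ C := by
  obtain ⟨C, hC⟩ := (isCompact_univ.prod
    (isCompact_Icc (a := a) (b := b))).exists_bound_of_continuousOn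
    (continuous_norm_grad hφ).continuousOn
  refine ⟨max C 0, le_max_right _ _, fun t ht x => le_max_of_le_left ?_⟩
  exact (le_abs_self _).trans (hC (x, t) ⟨mem_univ x, ht⟩)

theorem spatialDiff_sub {φ ψ : M × ℝ → ℝ} (hφ : IsC1 n φ) (hψ : IsC1 n ψ) (t : ℝ) (x : M)
    (w : TangentSpace (𝓡 n) x) :
    spatialDiff (fun p => φ p - ψ p) t x w = spatialDiff φ t x w - spatialDiff ψ t x w := by
  have h1 : MDifferentiableAt (𝓡 n) 𝓘(ℝ, ℝ) (fun y => φ (y, t)) x :=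
    (hφ.slice t).mdifferentiable one_ne_zero x
  have h2 : MDifferentiableAt (𝓡 n) 𝓘(ℝ, ℝ) (fun y => ψ (y, t)) x :=
    (hψ.slice t).mdifferentiable one_ne_zero x
  unfold spatialDiff
  have := (h1.hasMFDerivAt.sub h2.hasMFDerivAt).mfderiv
  change mfderiv (𝓡 n) 𝓘(ℝ, ℝ) ((fun y => φ (y, t)) - (fun y => ψ (y, t))) x w = _
  rw [this]
  rfl

/-- Functions of space alone are encoded as slices at a fixed time `c`, so that one set of gradient
lemmas serves both kinds of test function. -/
theorem IsC1.freeze {φ : M × ℝ → ℝ} (hφ : IsC1 n φ) (c : ℝ) : IsC1 n (fun p => φ (p.1, c)) :=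
  hφ.comp (contMDiff_fst.prodMk contMDiff_const)

/-- `(μ, v)` solves the continuity equation on all of `ℝ`, tested against functions on `M`. -/
structure IsFlow (μ : ℝ → ProbabilityMeasure M) (v : VelocityField n M) : Prop where
  continuous : Continuous μ
  measurable : Measurable (fun p : ℝ × M => (⟨p.2, v p.1 p.2⟩ : TangentBundle (𝓡 n) M))
  integrable : ∫⁻ t, ∫⁻ x, ‖v t x‖ₑ ∂(μ t : Measure M) < ⊤
  eq : ∀ φ : M × ℝ → ℝ, IsC1 n φ → ∀ c s r : ℝ,
    ∫ x, φ (x, c) ∂(μ r : Measure M) - ∫ x, φ (x, c) ∂(μ s : Measure M) =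
      ∫ t in s..r, ∫ x, spatialDiff φ c x (v t x) ∂(μ t : Measure M)

/-- The mean speed `∫ |v_t| dμ_t`. -/
def meanSpeed (μ : ℝ → ProbabilityMeasure M) (v : VelocityField n M) (t : ℝ) : ℝ :=
  (∫⁻ x, ‖v t x‖ₑ ∂(μ t : Measure M)).toReal

theorem measurable_spatialDiff_comp {v : VelocityField n M}
    (hv : Measurable (fun p : ℝ × M => (⟨p.2, v p.1 p.2⟩ : TangentBundle (𝓡 n) M)))
    {φ : M × ℝ → ℝ} (hφ : IsC1 n φ) {h : ℝ → ℝ} (hh : Measurable h) :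
    Measurable (fun p : ℝ × M => spatialDiff φ (h p.1) p.2 (v p.1 p.2)) :=
  (continuous_spatialDiff hφ).measurable.comp (hv.prodMk (hh.comp measurable_fst))

theorem measurable_norm_comp {v : VelocityField n M}
    (hv : Measurable (fun p : ℝ × M => (⟨p.2, v p.1 p.2⟩ : TangentBundle (𝓡 n) M))) :
    Measurable (fun p : ℝ × M => ‖v p.1 p.2‖) :=
  continuous_norm_tangentBundle.measurable.comp hv

theorem measurable_enorm_comp {v : VelocityField n M}
    (hv : Measurable (fun p : ℝ × M => (⟨p.2, v p.1 p.2⟩ : TangentBundle (𝓡 n) M))) :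
    Measurable (fun p : ℝ × M => ‖v p.1 p.2‖ₑ) := by
  simpa only [ofReal_norm] using (measurable_norm_comp hv).ennreal_ofReal

namespace IsFlow

variable {μ : ℝ → ProbabilityMeasure M} {v : VelocityField n M}

theorem measurable_lintegral_enorm (h : IsFlow μ v) :
    Measurable (fun t => ∫⁻ x, ‖v t x‖ₑ ∂(μ t : Measure M)) :=
  measurable_lintegral_curve h.continuous (measurable_enorm_comp h.measurable)

theorem ae_lt_top (h : IsFlow μ v) : ∀ᵐ t, ∫⁻ x, ‖v t x‖ₑ ∂(μ t : Measure M) < ⊤ :=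
  MeasureTheory.ae_lt_top h.measurable_lintegral_enorm h.integrable.ne

theorem integrable_meanSpeed (h : IsFlow μ v) : Integrable (meanSpeed μ v) :=
  integrable_toReal_of_lintegral_ne_top h.measurable_lintegral_enorm.aemeasurable h.integrable.ne

theorem integrable_norm (h : IsFlow μ v) {t : ℝ}
    (ht : ∫⁻ x, ‖v t x‖ₑ ∂(μ t : Measure M) < ⊤) :
    Integrable (fun x => ‖v t x‖) (μ t : Measure M) := by
  refine ⟨((measurable_norm_comp h.measurable).comp measurable_prodMk_left).aestronglyMeasurable,
    ?_⟩
  simpa [HasFiniteIntegral] using ht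

theorem integral_norm (h : IsFlow μ v) (t : ℝ) :
    ∫ x, ‖v t x‖ ∂(μ t : Measure M) = meanSpeed μ v t := by
  rw [integral_eq_lintegral_of_nonneg_ae (Eventually.of_forall fun x => norm_nonneg _)
    ((measurable_norm_comp h.measurable).comp measurable_prodMk_left).aestronglyMeasurable]
  simp only [meanSpeed, ofReal_norm]

theorem integrable_spatialDiff (h : IsFlow μ v) {φ : M × ℝ → ℝ} (hφ : IsC1 n φ) (c : ℝ) {t : ℝ}
    (ht : ∫⁻ x, ‖v t x‖ₑ ∂(μ t : Measure M) < ⊤) :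
    Integrable (fun x => spatialDiff φ c x (v t x)) (μ t : Measure M) := by
  obtain ⟨C, hC0, hC⟩ := exists_forall_norm_grad_le hφ c c
  refine ((h.integrable_norm ht).const_mul C).mono'
    ((measurable_spatialDiff_comp h.measurable hφ measurable_const).comp
      measurable_prodMk_left).aestronglyMeasurable (Eventually.of_forall fun x => ?_)
  exact (abs_spatialDiff_le φ c x _).trans (by gcongr; exact hC c (by simp) x)

theorem abs_integral_spatialDiff_le (h : IsFlow μ v) {φ : M × ℝ → ℝ} {c C : ℝ}
    (hC : ∀ x, ‖grad (n := n) φ c x‖ ≤ C) {t : ℝ}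
    (ht : ∫⁻ x, ‖v t x‖ₑ ∂(μ t : Measure M) < ⊤) :
    |∫ x, spatialDiff φ c x (v t x) ∂(μ t : Measure M)| ≤ C * meanSpeed μ v t := by
  rw [← h.integral_norm, ← integral_const_mul, ← Real.norm_eq_abs]
  refine norm_integral_le_of_norm_le ((h.integrable_norm ht).const_mul C)
    (Eventually.of_forall fun x => ?_)
  exact (abs_spatialDiff_le φ c x _).trans (by gcongr; exact hC x)

theorem stronglyMeasurable_integral_spatialDiff (h : IsFlow μ v) {φ : M × ℝ → ℝ} (hφ : IsC1 n φ)
    {f : ℝ → ℝ} (hf : Measurable f) :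
    StronglyMeasurable (fun t => ∫ x, spatialDiff φ (f t) x (v t x) ∂(μ t : Measure M)) :=
  stronglyMeasurable_integral_curve h.continuous (measurable_spatialDiff_comp h.measurable hφ hf)

/-- The slice time `f t` is used in two ways: constant, for the equation tested in space, and equal
to `t`, for time dependent test functions. -/
theorem integrableOn_spatialDiff (h : IsFlow μ v) {φ : M × ℝ → ℝ} (hφ : IsC1 n φ)
    {f : ℝ → ℝ} (hf : Measurable f) {a b : ℝ} {s : Set ℝ} (hs : MeasurableSet s)
    (hfs : ∀ t ∈ s, f t ∈ Icc a b) :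
    IntegrableOn (fun t => ∫ x, spatialDiff φ (f t) x (v t x) ∂(μ t : Measure M)) s := by
  obtain ⟨C, hC0, hC⟩ := exists_forall_norm_grad_le (n := n) hφ a b
  refine (h.integrable_meanSpeed.const_mul C).integrableOn.mono'
    (h.stronglyMeasurable_integral_spatialDiff hφ hf).aestronglyMeasurable ?_
  filter_upwards [ae_restrict_mem hs, ae_restrict_of_ae h.ae_lt_top] with t hts ht
  exact h.abs_integral_spatialDiff_le (hC _ (hfs t hts)) ht

theorem intervalIntegrable_const (h : IsFlow μ v) {φ : M × ℝ → ℝ} (hφ : IsC1 n φ) (c a b : ℝ) :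
    IntervalIntegrable (fun t => ∫ x, spatialDiff φ c x (v t x) ∂(μ t : Measure M)) volume a b :=
  ⟨h.integrableOn_spatialDiff hφ measurable_const measurableSet_Ioc (a := c) (b := c) (by simp),
    h.integrableOn_spatialDiff hφ measurable_const measurableSet_Ioc (a := c) (b := c) (by simp)⟩

theorem intervalIntegrable_diag (h : IsFlow μ v) {φ : M × ℝ → ℝ} (hφ : IsC1 n φ) (a b : ℝ) :
    IntervalIntegrable (fun t => ∫ x, spatialDiff φ t x (v t x) ∂(μ t : Measure M)) volume a b :=
  ⟨h.integrableOn_spatialDiff hφ measurable_id measurableSet_Ioc fun _ ht => Ioc_subset_Icc_self ht,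
    h.integrableOn_spatialDiff hφ measurable_id measurableSet_Ioc
      fun _ ht => Ioc_subset_Icc_self ht⟩

end IsFlow

theorem continuous_integral_curve {μ : ℝ → ProbabilityMeasure M} (hμ : Continuous μ)
    {f : M × ℝ → ℝ} (hf : Continuous f) :
    Continuous (fun t => ∫ x, f (x, t) ∂(μ t : Measure M)) :=
  (continuous_integral_pairing (hf.comp continuous_swap)).comp (continuous_id.prodMk hμ)

/-- First-order expansion in time of `∫ φ(x,·) dν`, uniform in the measure `ν`. -/
theorem eventually_abs_integral_sub_le {φ : M × ℝ → ℝ} (hφ : IsC1 n φ)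
    {μ : ℝ → ProbabilityMeasure M} (hμ : Continuous μ) (t : ℝ) {ε : ℝ} (hε : 0 < ε) :
    ∀ᶠ u in 𝓝[>] t, |(∫ x, φ (x, u) ∂(μ u : Measure M) - ∫ x, φ (x, t) ∂(μ u : Measure M)) -
      ∫ r in t..u, ∫ x, deriv (fun s => φ (x, s)) r ∂(μ r : Measure M)| ≤ ε * (u - t) := by
  set P : ℝ → ℝ := fun r => ∫ x, deriv (fun s => φ (x, s)) r ∂(μ r : Measure M) with hP
  have hcd := continuous_deriv_time hφ
  have hPc : Continuous P := continuous_integral_curve hμ hcd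
  have hQc : Continuous (fun r => ∫ x, deriv (fun s => φ (x, s)) t ∂(μ r : Measure M)) :=
    continuous_integral_curve hμ (f := fun p => deriv (fun s => φ (p.1, s)) t)
      (hcd.comp (continuous_fst.prodMk continuous_const))
  -- Three errors of size `ε/3`: the variation of `P` in time, the replacement of `μ t` by `μ u`
  -- with the derivative frozen at `t`, and the variation of the derivative in time, uniformly in
  -- space.
  have h1 : ∀ᶠ u in 𝓝 t, |P u - P t| < ε / 3 :=
    (hPc.sub continuous_const).abs.continuousAt.eventually_lt continuousAt_const
      (show |P t - P t| < ε / 3 by rw [sub_self, abs_zero]; positivity)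
  have h2 : ∀ᶠ u in 𝓝 t, |∫ x, deriv (fun s => φ (x, s)) t ∂(μ u : Measure M) - P t| < ε / 3 :=
    (hQc.sub continuous_const).abs.continuousAt.eventually_lt continuousAt_const
      (show |P t - P t| < ε / 3 by rw [sub_self, abs_zero]; positivity)
  have h3 : ∀ᶠ u in 𝓝 t, ∀ x, |deriv (fun s => φ (x, s)) u - deriv (fun s => φ (x, s)) t| < ε / 3 :=
    eventually_forall_abs_lt (f := fun p : M × ℝ =>
      deriv (fun s => φ (p.1, s)) p.2 - deriv (fun s => φ (p.1, s)) t)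
      (hcd.sub (hcd.comp (continuous_fst.prodMk continuous_const))) (by simp) (by positivity)
  obtain ⟨δ, hδ, hball⟩ := Metric.eventually_nhds_iff.1 (h1.and h3)
  have h4 : ∀ᶠ u in 𝓝[>] t, u ∈ Ioo t (t + δ) := Ioo_mem_nhdsGT (by linarith)
  filter_upwards [h4, nhdsWithin_le_nhds h2] with u hu h2u
  have hdist {r : ℝ} (hr : r ∈ Icc t u) : dist r t < δ := by
    rw [Real.dist_eq, abs_of_nonneg (by linarith [hr.1])]; linarith [hr.2, hu.2]
  have hφint (r : ℝ) : Integrable (fun x => φ (x, r)) (μ u : Measure M) :=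
    integrable_of_continuous (hφ.slice r).continuous _
  have hdint : Integrable (fun x => deriv (fun s => φ (x, s)) t) (μ u : Measure M) :=
    integrable_of_continuous (hcd.comp (continuous_id.prodMk continuous_const)) _
  have e1 : |∫ x, φ (x, u) ∂(μ u : Measure M) - ∫ x, φ (x, t) ∂(μ u : Measure M) -
      (u - t) * ∫ x, deriv (fun s => φ (x, s)) t ∂(μ u : Measure M)| ≤ ε / 3 * (u - t) := by
    have hlin : ∫ x, (φ (x, u) - φ (x, t) - (u - t) * deriv (fun s => φ (x, s)) t)
        ∂(μ u : Measure M) = ∫ x, φ (x, u) ∂(μ u : Measure M) - ∫ x, φ (x, t) ∂(μ u : Measure M) -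
        (u - t) * ∫ x, deriv (fun s => φ (x, s)) t ∂(μ u : Measure M) := by
      have := integral_sub ((hφint u).sub (hφint t)) (hdint.const_mul (u - t))
      simp only [Pi.sub_apply] at this
      rw [this, integral_sub (hφint u) (hφint t), integral_const_mul]
    rw [← hlin, ← Real.norm_eq_abs]
    refine (norm_integral_le_of_norm_le_const (C := ε / 3 * (u - t))
      (Eventually.of_forall fun x => ?_)).trans (by simp)
    -- Mean value inequality in time, at each fixed `x`, for `φ(x,·)` minus its linear part at `t`.
    have hder (r : ℝ) : HasDerivWithinAt
        (fun r => φ (x, r) - r * deriv (fun s => φ (x, s)) t)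
        (deriv (fun s => φ (x, s)) r - deriv (fun s => φ (x, s)) t) (Icc t u) r := by
      have := (hasDerivAt_time hφ x r).sub ((hasDerivAt_id r).mul_const
        (deriv (fun s => φ (x, s)) t))
      rw [one_mul] at this
      exact this.hasDerivWithinAt
    have := (convex_Icc t u).norm_image_sub_le_of_norm_hasDerivWithin_le (C := ε / 3)
      (fun r _ => hder r) (fun r hr => ((hball (hdist hr)).2 x).le)
      (left_mem_Icc.2 hu.1.le) (right_mem_Icc.2 hu.1.le)
    rw [Real.norm_of_nonneg (by linarith [hu.1] : 0 ≤ u - t)] at this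
    refine le_trans (le_of_eq ?_) this
    congr 1
    ring
  have e2 : |(∫ r in t..u, P r) - (u - t) * P t| ≤ ε / 3 * (u - t) := by
    have : (∫ r in t..u, P r) - (u - t) * P t = ∫ r in t..u, (P r - P t) := by
      rw [intervalIntegral.integral_sub (hPc.intervalIntegrable _ _) (by simp)]
      simp
    rw [this, ← Real.norm_eq_abs]
    refine (intervalIntegral.norm_integral_le_of_norm_le_const (C := ε / 3) fun r hr => ?_).trans
      (by rw [abs_of_nonneg (by linarith [hu.1] : 0 ≤ u - t)])
    rw [uIoc_of_le hu.1.le] at hr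
    exact (hball (hdist (Ioc_subset_Icc_self hr))).1.le
  have e3 : |(u - t) * ∫ x, deriv (fun s => φ (x, s)) t ∂(μ u : Measure M) - (u - t) * P t| ≤
      ε / 3 * (u - t) := by
    rw [← mul_sub, abs_mul, abs_of_nonneg (by linarith [hu.1] : 0 ≤ u - t), mul_comm]
    gcongr
    linarith [hu.1]
  rw [abs_le] at e1 e2 e3 ⊢
  constructor <;> linarith

/-- The defect `D` of the identity has increments to the right of each `t` bounded by `ε` times `(u
- t) + ∫ |v|`: near `t` the test function may be frozen at time `t`, where the equation for
functions of space applies. The local-to-global estimate transfers this to `[a,b]`, and `ε → 0`. -/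
theorem IsFlow.integral_sub_eq {μ : ℝ → ProbabilityMeasure M} {v : VelocityField n M}
    (h : IsFlow μ v) {φ : M × ℝ → ℝ} (hφ : IsC1 n φ) {a b : ℝ} (hab : a ≤ b) :
    ∫ x, φ (x, b) ∂(μ b : Measure M) - ∫ x, φ (x, a) ∂(μ a : Measure M) =
      (∫ t in a..b, ∫ x, deriv (fun s => φ (x, s)) t ∂(μ t : Measure M)) +
      ∫ t in a..b, ∫ x, spatialDiff φ t x (v t x) ∂(μ t : Measure M) := by
  set P : ℝ → ℝ := fun r => ∫ x, deriv (fun s => φ (x, s)) r ∂(μ r : Measure M) with hP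
  set H : ℝ → ℝ := fun r => ∫ x, spatialDiff φ r x (v r x) ∂(μ r : Measure M) with hH
  have hPc : Continuous P := continuous_integral_curve h.continuous (continuous_deriv_time hφ)
  have hPi (s r : ℝ) : IntervalIntegrable P volume s r := hPc.intervalIntegrable _ _
  have hHi (s r : ℝ) : IntervalIntegrable H volume s r := h.intervalIntegrable_diag hφ s r
  have hki (s r : ℝ) : IntervalIntegrable (meanSpeed μ v) volume s r :=
    h.integrable_meanSpeed.intervalIntegrable
  set D : ℝ → ℝ := fun t => ∫ x, φ (x, t) ∂(μ t : Measure M) - (∫ r in a..t, P r) -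
    ∫ r in a..t, H r with hD
  have hDc : Continuous D :=
    ((continuous_integral_curve h.continuous hφ.continuous).sub
      (intervalIntegral.continuous_primitive hPi a)).sub
      (intervalIntegral.continuous_primitive hHi a)
  have key (ε : ℝ) (hε : 0 < ε) : |D b - D a| ≤
      ε * (b - a + ∫ r in a..b, meanSpeed μ v r) := by
    have := abs_sub_le_sub_of_eventually_right (D := D) hab hDc.continuousOn
      (N := fun t => ε * (t + ∫ r in a..t, meanSpeed μ v r))
      (continuous_const.mul (continuous_id.add
        (intervalIntegral.continuous_primitive hki a))).continuousOn (fun t ht => ?_)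
    · refine this.trans (le_of_eq ?_)
      simp only [intervalIntegral.integral_same]
      ring
    -- The error of freezing has zero gradient at time `t`, hence uniformly small gradient at nearby
    -- times by compactness.
    · have hψ : IsC1 n (fun p : M × ℝ => φ (p.1, t) - φ p) := (hφ.freeze t).sub hφ
      have hgrad0 (x : M) : grad (n := n) (fun p : M × ℝ => φ (p.1, t) - φ p) t x = 0 := by
        refine ext_inner_right ℝ fun w => ?_
        rw [inner_grad, spatialDiff_sub (hφ.freeze t) hφ, inner_zero_left]
        exact sub_self _
      have h1 := eventually_forall_abs_lt (continuous_norm_grad hψ) (t₀ := t)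
        (by simp [hgrad0]) hε
      obtain ⟨δ, hδ, hball⟩ := Metric.eventually_nhds_iff.1 h1
      have h4 : ∀ᶠ u in 𝓝[>] t, u ∈ Ioo t (t + δ) := Ioo_mem_nhdsGT (by linarith)
      filter_upwards [h4, eventually_abs_integral_sub_le hφ h.continuous t hε] with u hu h2
      have e1 : D u - D t = ((∫ x, φ (x, u) ∂(μ u : Measure M) -
          ∫ x, φ (x, t) ∂(μ u : Measure M)) - ∫ r in t..u, P r) +
          ∫ r in t..u, ∫ x, spatialDiff (fun p : M × ℝ => φ (p.1, t) - φ p) r x (v r x)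
            ∂(μ r : Measure M) := by
        have a1 := intervalIntegral.integral_add_adjacent_intervals (hPi a t) (hPi t u)
        have a2 := intervalIntegral.integral_add_adjacent_intervals (hHi a t) (hHi t u)
        have a3 := h.eq φ hφ t t u
        have a4 : ∫ r in t..u, ∫ x, spatialDiff (fun p : M × ℝ => φ (p.1, t) - φ p) r x (v r x)
            ∂(μ r : Measure M) =
            (∫ r in t..u, ∫ x, spatialDiff φ t x (v r x) ∂(μ r : Measure M)) -
            ∫ r in t..u, H r := by
          rw [← intervalIntegral.integral_sub (h.intervalIntegrable_const hφ t t u) (hHi t u)]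
          refine intervalIntegral.integral_congr_ae ?_
          filter_upwards [h.ae_lt_top] with r hr _
          rw [hH, ← integral_sub (h.integrable_spatialDiff hφ t hr)
            (h.integrable_spatialDiff hφ r hr)]
          refine integral_congr_ae (Eventually.of_forall fun x => ?_)
          exact spatialDiff_sub (hφ.freeze t) hφ r x _
        simp only [hD]
        rw [a4]
        linarith
      have e2 : |∫ r in t..u, ∫ x, spatialDiff (fun p : M × ℝ => φ (p.1, t) - φ p) r x (v r x)
            ∂(μ r : Measure M)| ≤ ε * ∫ r in t..u, meanSpeed μ v r := by
        rw [← intervalIntegral.integral_const_mul, ← Real.norm_eq_abs]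
        refine intervalIntegral.norm_integral_le_of_norm_le hu.1.le ?_ ((hki t u).const_mul ε)
        filter_upwards [h.ae_lt_top] with r hr hrm
        refine h.abs_integral_spatialDiff_le (fun x => ?_) hr
        refine (le_abs_self _).trans (hball (y := r) ?_ x).le
        rw [Real.dist_eq, abs_of_nonneg (by linarith [hrm.1])]; linarith [hrm.2, hu.2]
      have a5 := intervalIntegral.integral_add_adjacent_intervals (hki a t) (hki t u)
      rw [e1]
      refine (abs_add_le _ _).trans ((add_le_add h2 e2).trans (le_of_eq ?_))
      rw [← a5]
      ring
  have hnn : 0 ≤ b - a + ∫ r in a..b, meanSpeed μ v r :=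
    add_nonneg (by linarith) (intervalIntegral.integral_nonneg hab
      fun _ _ => ENNReal.toReal_nonneg)
  have hlim : Tendsto (fun ε : ℝ => ε * (b - a + ∫ r in a..b, meanSpeed μ v r)) (𝓝[>] 0) (𝓝 0) := by
    have : Tendsto (fun ε : ℝ => ε * (b - a + ∫ r in a..b, meanSpeed μ v r)) (𝓝 0)
      (𝓝 (0 * (b - a + ∫ r in a..b, meanSpeed μ v r))) := tendsto_id.mul_const _
    rw [zero_mul] at this
    exact this.mono_left nhdsWithin_le_nhds
  have h0 : |D b - D a| ≤ 0 := ge_of_tendsto hlim (by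
    filter_upwards [self_mem_nhdsWithin] with ε hε using key ε hε)
  have h00 : D b - D a = 0 := abs_nonpos_iff.1 h0
  simp only [hD, intervalIntegral.integral_same] at h00
  linarith

end Flow

/-! ### A du Bois-Reymond lemma -/

/-- The test function is a primitive of `w (D - c)`, where `w` is positive exactly on `(a,b)`. It
turns the hypothesis into `∫ w (D - c)² = 0`. -/
theorem eqOn_Ioo_of_forall_integral_deriv_mul_eq_zero {D : ℝ → ℝ} {T a b : ℝ}
    (hD : Continuous D) (ha : 0 < a) (hab : a < b) (hb : b < T)
    (h : ∀ χ : ℝ → ℝ, ContDiff ℝ 1 χ → tsupport χ ⊆ Icc a b →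
      ∫ t in (0 : ℝ)..T, deriv χ t * D t = 0) :
    ∃ c, ∀ t ∈ Ioo a b, D t = c := by
  set w : ℝ → ℝ := fun t => max 0 ((t - a) * (b - t)) with hw
  have hwc : Continuous w := by fun_prop
  have hw0 (t : ℝ) : 0 ≤ w t := le_max_left _ _
  have hwpos {t : ℝ} (ht : t ∈ Ioo a b) : 0 < w t :=
    lt_max_of_lt_right (mul_pos (by linarith [ht.1]) (by linarith [ht.2]))
  have hwle {t : ℝ} (ht : t ≤ a) : w t = 0 :=
    max_eq_left (mul_nonpos_of_nonpos_of_nonneg (by linarith) (by linarith))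
  have hwge {t : ℝ} (ht : b ≤ t) : w t = 0 :=
    max_eq_left (mul_nonpos_of_nonneg_of_nonpos (by linarith) (by linarith))
  have hI : 0 < ∫ t in a..b, w t :=
    intervalIntegral.integral_pos hab hwc.continuousOn (fun t _ => hw0 t)
      ⟨(a + b) / 2, ⟨by linarith, by linarith⟩, hwpos ⟨by linarith, by linarith⟩⟩
  -- The `w`-weighted mean of `D`: this value makes `∫ w (D - c)` vanish, so the primitive returns
  -- to zero at `b`.
  set c := (∫ t in a..b, w t * D t) / ∫ t in a..b, w t with hc
  set f : ℝ → ℝ := fun t => w t * (D t - c) with hf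
  have hfc : Continuous f := hwc.mul (hD.sub continuous_const)
  have hfi (s r : ℝ) : IntervalIntegrable f volume s r := hfc.intervalIntegrable s r
  set χ : ℝ → ℝ := fun t => ∫ u in a..t, f u with hχ
  have hχd (t : ℝ) : HasDerivAt χ (f t) t :=
    intervalIntegral.integral_hasDerivAt_right (hfi a t)
      (hfc.stronglyMeasurableAtFilter _ _) hfc.continuousAt
  have hχderiv : deriv χ = f := funext fun t => (hχd t).deriv
  have hχ1 : ContDiff ℝ 1 χ := by
    rw [contDiff_one_iff_deriv, hχderiv]
    exact ⟨fun t => (hχd t).differentiableAt, hfc⟩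
  have hfab : ∫ u in a..b, f u = 0 := by
    have : ∫ u in a..b, f u = (∫ u in a..b, w u * D u) - c * ∫ u in a..b, w u := by
      rw [← intervalIntegral.integral_const_mul, ← intervalIntegral.integral_sub
        (f := fun u => w u * D u) ((hwc.mul hD).intervalIntegrable _ _) ((hwc.intervalIntegrable _ _).const_mul _)]
      refine intervalIntegral.integral_congr fun t _ => ?_
      simp only [hf]
      ring
    rw [this, hc, div_mul_cancel₀ _ hI.ne', sub_self]
  have hχle {t : ℝ} (ht : t ≤ a) : χ t = 0 := by
    refine (intervalIntegral.integral_congr (g := fun _ => 0) fun u hu => ?_).trans (by simp)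
    rw [uIcc_of_ge ht] at hu
    simp [hf, hwle hu.2]
  have hχge {t : ℝ} (ht : b ≤ t) : χ t = 0 := by
    have h1 : ∫ u in b..t, f u = 0 := by
      refine (intervalIntegral.integral_congr (g := fun _ => 0) fun u hu => ?_).trans (by simp)
      rw [uIcc_of_le ht] at hu
      simp [hf, hwge hu.1]
    have h2 := intervalIntegral.integral_add_adjacent_intervals (hfi a b) (hfi b t)
    rw [hfab, h1, add_zero] at h2
    exact h2.symm
  have hsupp : tsupport χ ⊆ Icc a b := by
    refine closure_minimal (fun t ht => ?_) isClosed_Icc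
    by_contra hn
    rw [mem_Icc, not_and_or, not_le, not_le] at hn
    exact ht (hn.elim (fun h => hχle h.le) (fun h => hχge h.le))
  have h1 := h χ hχ1 hsupp
  rw [hχderiv] at h1
  have h2 : ∫ t in (0 : ℝ)..T, f t = 0 := by
    have := intervalIntegral.integral_interval_sub_left (hfi a T) (hfi a 0)
    rw [← this]
    change χ T - χ 0 = 0
    rw [hχge hb.le, hχle ha.le, sub_zero]
  have h3 : ∫ t in (0 : ℝ)..T, w t * (D t - c) ^ 2 = 0 := by
    have : ∫ t in (0 : ℝ)..T, w t * (D t - c) ^ 2 =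
        (∫ t in (0 : ℝ)..T, f t * D t) - c * ∫ t in (0 : ℝ)..T, f t := by
      rw [← intervalIntegral.integral_const_mul, ← intervalIntegral.integral_sub
        (f := fun u => f u * D u) ((hfc.mul hD).intervalIntegrable _ _) ((hfi _ _).const_mul _)]
      refine intervalIntegral.integral_congr fun t _ => ?_
      simp only [hf]
      ring
    rw [this, h1, h2]
    simp
  refine ⟨c, fun t ht => ?_⟩
  by_contra hne
  have hpos : 0 < ∫ t in (0 : ℝ)..T, w t * (D t - c) ^ 2 :=
    intervalIntegral.integral_pos (by linarith)
      (hwc.mul ((hD.sub continuous_const).pow 2)).continuousOn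
      (fun t _ => mul_nonneg (hw0 t) (sq_nonneg _))
      ⟨t, ⟨by linarith [ht.1], by linarith [ht.2]⟩,
        mul_pos (hwpos ht) (by have := sub_ne_zero.2 hne; positivity)⟩
  exact hpos.ne' h3

/-- Integrating by parts against the primitive `H` of `G` shows that `F - H` has zero distributional
derivative. It is then constant on `(0,T)`, and on `[0,T]` by continuity. -/
theorem sub_eq_integral_of_forall_test {F G : ℝ → ℝ} {T : ℝ} (hT : 0 < T)
    (hF : Continuous F) (hG : Integrable G)
    (h : ∀ χ : ℝ → ℝ, ContDiff ℝ 1 χ → HasCompactSupport χ → tsupport χ ⊆ Ioo 0 T →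
      ∫ t in (0 : ℝ)..T, (deriv χ t * F t + χ t * G t) = 0)
    {s r : ℝ} (hs : s ∈ Icc 0 T) (hr : r ∈ Icc 0 T) :
    F r - F s = ∫ t in s..r, G t := by
  have hGi (s r : ℝ) : IntervalIntegrable G volume s r := hG.intervalIntegrable
  set H : ℝ → ℝ := fun t => ∫ u in (0 : ℝ)..t, G u with hH
  have hHc : Continuous H := intervalIntegral.continuous_primitive hGi 0
  set D : ℝ → ℝ := fun t => F t - H t with hD
  have hDc : Continuous D := hF.sub hHc
  have hconst {a b : ℝ} (ha : 0 < a) (hab : a < b) (hb : b < T) :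
      ∃ c, ∀ t ∈ Ioo a b, D t = c := by
    refine eqOn_Ioo_of_forall_integral_deriv_mul_eq_zero hDc ha hab hb fun χ hχ hsupp => ?_
    have hsub : Icc a b ⊆ Ioo 0 T := fun t ht => ⟨ha.trans_le ht.1, ht.2.trans_lt hb⟩
    have h1 := h χ hχ (isCompact_Icc.of_isClosed_subset (isClosed_tsupport _) hsupp)
      (hsupp.trans hsub)
    have hχ0 {t : ℝ} (ht : t ∉ Ioo 0 T) : χ t = 0 :=
      image_eq_zero_of_notMem_tsupport fun hm => ht (hsub (hsupp hm))
    have hχ'c : Continuous (deriv χ) := hχ.continuous_deriv_one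
    have h2 := AbsolutelyContinuousOnInterval.integral_mul_deriv_eq_deriv_mul
      (f := χ) (g := H) (a := 0) (b := T) hχ.contDiffOn.absolutelyContinuousOnInterval
      ((hGi 0 T).absolutelyContinuousOnInterval_intervalIntegral left_mem_uIcc)
    rw [hχ0 (by simp), hχ0 (by simp)] at h2
    have h3 : ∫ t in (0 : ℝ)..T, χ t * deriv H t = ∫ t in (0 : ℝ)..T, χ t * G t := by
      refine intervalIntegral.integral_congr_ae ?_
      filter_upwards [(hGi 0 T).ae_hasDerivAt_integral] with t ht htm
      rw [(ht (uIoc_subset_uIcc htm) 0 left_mem_uIcc).deriv]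
    rw [intervalIntegral.integral_add (f := fun t => deriv χ t * F t) ((hχ'c.mul hF).intervalIntegrable _ _)
      ((hGi 0 T).continuousOn_mul hχ.continuous.continuousOn)] at h1
    simp only [hD, mul_sub]
    rw [intervalIntegral.integral_sub (f := fun t => deriv χ t * F t)
      (g := fun t => deriv χ t * H t) ((hχ'c.mul hF).intervalIntegrable _ _)
      ((hχ'c.mul hHc).intervalIntegrable _ _)]
    linarith
  have hmid : T / 2 ∈ Ioo 0 T := ⟨by linarith, by linarith⟩
  have hIoo : EqOn D (fun _ => D (T / 2)) (Ioo 0 T) := by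
    intro t ht
    -- A compact subinterval of `(0,T)` whose interior contains both `t` and the reference point `T
    -- / 2`.
    obtain ⟨c, hc⟩ := hconst (a := min t (T / 2) / 2) (b := (max t (T / 2) + T) / 2)
      (half_pos (lt_min ht.1 hmid.1))
      (by
        have := min_le_left t (T / 2); have := le_max_left t (T / 2)
        have := ht.1; have := lt_min ht.1 hmid.1; linarith)
      (by have := max_lt ht.2 hmid.2; linarith)
    have a1 := lt_min ht.1 hmid.1
    have a2 := max_lt ht.2 hmid.2
    have a3 := min_le_left t (T / 2)
    have a4 := min_le_right t (T / 2)
    have a5 := le_max_left t (T / 2)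
    have a6 := le_max_right t (T / 2)
    change D t = D (T / 2)
    rw [hc t ⟨by linarith, by linarith⟩, hc (T / 2) ⟨by linarith, by linarith⟩]
  have hIcc := hIoo.closure hDc continuous_const
  rw [closure_Ioo hT.ne] at hIcc
  have e1 : D r = D s := (hIcc hr).trans (hIcc hs).symm
  have e2 := intervalIntegral.integral_interval_sub_left (hGi 0 r) (hGi 0 s)
  simp only [hD] at e1
  change F r - H r = F s - H s at e1
  rw [← e2]
  change F r - F s = H r - H s
  linarith

/-! ### Global solutions and solutions on an interval -/

section Conversion

variable {n : ℕ} {M : Type*} [TopologicalSpace M] [T2Space M] [CompactSpace M]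
    [SecondCountableTopology M]
    [ChartedSpace (EuclideanSpace ℝ (Fin n)) M] [IsManifold (𝓡 n) ∞ M]
    [RiemannianBundle (fun x : M => TangentSpace (𝓡 n) x)]
    [IsContMDiffRiemannianBundle (𝓡 n) ∞ (EuclideanSpace ℝ (Fin n))
      (fun x : M => TangentSpace (𝓡 n) x)]
    [MeasurableSpace M] [BorelSpace M]

theorem IsC1.const_mul_time {φ : M × ℝ → ℝ} (hφ : IsC1 n φ) (c : ℝ) {χ : ℝ → ℝ}
    (hχ : ContDiff ℝ 1 χ) : IsC1 n (fun p : M × ℝ => χ p.2 * φ (p.1, c)) :=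
  (hχ.contMDiff.comp contMDiff_snd).mul (hφ.freeze c)

theorem spatialDiff_mul_time {φ : M × ℝ → ℝ} (hφ : IsC1 n φ) (c : ℝ) (χ : ℝ → ℝ) (t : ℝ) (x : M)
    (w : TangentSpace (𝓡 n) x) :
    spatialDiff (fun p : M × ℝ => χ p.2 * φ (p.1, c)) t x w = χ t * spatialDiff φ c x w := by
  have h1 : MDifferentiableAt (𝓡 n) 𝓘(ℝ, ℝ) (fun y => φ (y, c)) x :=
    (hφ.slice c).mdifferentiable one_ne_zero x
  unfold spatialDiff
  have := (h1.hasMFDerivAt.const_smul (χ t)).mfderiv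
  change mfderiv (𝓡 n) 𝓘(ℝ, ℝ) (χ t • (fun y => φ (y, c))) x w = _
  rw [this]
  rfl

theorem IsTestFunction.apply_eq_zero {T : ℝ} {φ : M × ℝ → ℝ} (hφ : IsTestFunction n T φ) {t : ℝ}
    (ht : t ∉ Ioo 0 T) (x : M) : φ (x, t) = 0 :=
  image_eq_zero_of_notMem_tsupport fun hm => ht (hφ.tsupport_subset hm).2

theorem IsFlow.isCE {μ : ℝ → ProbabilityMeasure M} {v : VelocityField n M} (h : IsFlow μ v)
    {T : ℝ} (hT : 0 < T) : IsCE T μ v where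
  continuousOn := h.continuous.continuousOn
  borel := h.measurable.comp ((measurable_subtype_coe.comp measurable_snd).prodMk measurable_fst)
  integrable := (setLIntegral_le_lintegral _ _).trans_lt h.integrable
  weak φ hφ := by
    have h1 := h.integral_sub_eq hφ.contMDiff hT.le
    simp only [hφ.apply_eq_zero (t := T) (by simp), hφ.apply_eq_zero (t := 0) (by simp),
      integral_zero, sub_self] at h1
    have hPc : Continuous (fun t => ∫ x, deriv (fun s => φ (x, s)) t ∂(μ t : Measure M)) :=
      continuous_integral_curve h.continuous (continuous_deriv_time hφ.contMDiff)
    rw [← intervalIntegral.integral_add (hPc.intervalIntegrable _ _)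
      (h.intervalIntegrable_diag hφ.contMDiff 0 T), intervalIntegral.integral_of_le hT.le,
      integral_Ioc_eq_integral_Ioo] at h1
    refine Eq.trans ?_ h1.symm
    refine integral_congr_ae (ae_restrict_of_ae ?_)
    filter_upwards [h.ae_lt_top] with t ht
    exact integral_add (integrable_of_continuous
      ((continuous_deriv_time hφ.contMDiff).comp (continuous_id.prodMk continuous_const)) _)
      (h.integrable_spatialDiff hφ.contMDiff t ht)

theorem IsFlow.isCEBetween {μ : ℝ → ProbabilityMeasure M} {v : VelocityField n M}
    (h : IsFlow μ v) {T : ℝ} (hT : 0 < T) : IsCEBetween T (μ 0) (μ T) μ v where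
  toIsCE := h.isCE hT
  tendsto_zero := h.continuous.continuousAt.tendsto.mono_left nhdsWithin_le_nhds
  tendsto_end := h.continuous.continuousAt.tendsto.mono_left nhdsWithin_le_nhds

/-- The extension of a velocity field on `(0,T)` by zero. -/
def extendZero (T : ℝ) (v : VelocityField n M) : VelocityField n M :=
  fun t x => if t ∈ Ioo 0 T then v t x else 0

/-- The extension of a curve on `[0,T]` by constants. -/
def clampCurve {X : Type*} (T : ℝ) (μ : ℝ → X) : ℝ → X := fun t => μ (max 0 (min t T))

theorem clampCurve_of_mem {X : Type*} {T : ℝ} (μ : ℝ → X) {t : ℝ} (ht : t ∈ Icc 0 T) :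
    clampCurve T μ t = μ t := by
  rw [clampCurve, min_eq_left ht.2, max_eq_right ht.1]

theorem continuous_clampCurve {X : Type*} [TopologicalSpace X] {T : ℝ} (hT : 0 < T) {μ : ℝ → X}
    (hμ : ContinuousOn μ (Icc 0 T)) : Continuous (clampCurve T μ) :=
  hμ.comp_continuous (by fun_prop) fun t => ⟨le_max_left _ _, max_le hT.le (min_le_right _ _)⟩

theorem measurable_extendZero {T : ℝ} {v : VelocityField n M} (hv : IsBorelVelocityField T v) :
    Measurable (fun p : ℝ × M => (⟨p.2, extendZero T v p.1 p.2⟩ : TangentBundle (𝓡 n) M)) := by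
  have hs : MeasurableSet (Prod.fst ⁻¹' Ioo 0 T : Set (ℝ × M)) :=
    measurable_fst measurableSet_Ioo
  refine measurable_of_restrict_of_restrict_compl hs ?_ ?_
  · have h1 : Measurable (fun p : (Prod.fst ⁻¹' Ioo 0 T : Set (ℝ × M)) =>
        ((p.1.2, ⟨p.1.1, p.2⟩) : M × Ioo (0 : ℝ) T)) :=
      (measurable_snd.comp measurable_subtype_coe).prodMk
        ((measurable_fst.comp measurable_subtype_coe).subtype_mk)
    have h2 := hv.comp h1
    have e : (Prod.fst ⁻¹' Ioo 0 T : Set (ℝ × M)).domRestrict (fun p : ℝ × M =>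
        (⟨p.2, extendZero T v p.1 p.2⟩ : TangentBundle (𝓡 n) M)) =
        fun p => ⟨p.1.2, v p.1.1 p.1.2⟩ := by
      funext p
      have hp : p.1.1 ∈ Ioo 0 T := p.2
      simp only [domRestrict_apply, extendZero, if_pos hp]
    rw [e]
    exact h2
  · have h0 : Continuous (fun x : M => (⟨x, 0⟩ : TangentBundle (𝓡 n) M)) :=
      (contMDiff_zeroSection ℝ (IB := 𝓡 n) (n := 0) (F := EuclideanSpace ℝ (Fin n))
        (TangentSpace (𝓡 n) (M := M))).continuous
    have e : (Prod.fst ⁻¹' Ioo 0 T : Set (ℝ × M))ᶜ.domRestrict (fun p : ℝ × M =>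
        (⟨p.2, extendZero T v p.1 p.2⟩ : TangentBundle (𝓡 n) M)) =
        fun p => ⟨p.1.2, 0⟩ := by
      funext p
      have hp : ¬ p.1.1 ∈ Ioo 0 T := p.2
      simp only [domRestrict_apply, extendZero, if_neg hp]
    rw [e]
    exact h0.measurable.comp (measurable_snd.comp measurable_subtype_coe)

/-- Product test functions `χ(t) φ(x,c)` turn the weak formulation into `F' = G` in the sense of
distributions for `F(t) = ∫ φ dμ_t`. Continuity of `F` up to the endpoints gives the integrated form
on `[0,T]`; outside, the curve is constant and the velocity zero. -/
theorem IsCE.isFlow {T : ℝ} (hT : 0 < T) {μ μ' : ℝ → ProbabilityMeasure M}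
    {v : VelocityField n M} (h : IsCE T μ v) (hμ' : ContinuousOn μ' (Icc 0 T))
    (heq : EqOn μ' μ (Ioo 0 T)) : IsFlow (clampCurve T μ') (extendZero T v) := by
  set m : ℝ → ProbabilityMeasure M := clampCurve T μ' with hm_def
  have hμc : Continuous m := continuous_clampCurve hT hμ'
  have hμeq {t : ℝ} (ht : t ∈ Ioo 0 T) : m t = μ t :=
    (clampCurve_of_mem μ' (Ioo_subset_Icc_self ht)).trans (heq ht)
  have hmeas := measurable_extendZero h.borel
  have hint : ∫⁻ t, ∫⁻ x, ‖extendZero T v t x‖ₑ ∂(m t : Measure M) < ⊤ := by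
    refine lt_of_le_of_lt (le_of_eq ?_) h.integrable
    rw [← lintegral_indicator measurableSet_Ioo]
    refine lintegral_congr fun t => ?_
    by_cases ht : t ∈ Ioo 0 T
    · rw [indicator_of_mem ht, hμeq ht]
      simp only [extendZero, if_pos ht]
    · rw [indicator_of_notMem ht]
      simp only [extendZero, if_neg ht, enorm_zero, lintegral_zero]
  refine ⟨hμc, hmeas, hint, fun φ hφ c => ?_⟩
  have hlt : ∀ᵐ t, ∫⁻ x, ‖extendZero T v t x‖ₑ ∂(m t : Measure M) < ⊤ :=
    MeasureTheory.ae_lt_top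
      (measurable_lintegral_curve hμc (measurable_enorm_comp hmeas)) hint.ne
  set F : ℝ → ℝ := fun t => ∫ x, φ (x, c) ∂(m t : Measure M) with hF
  set G : ℝ → ℝ := fun t => ∫ x, spatialDiff φ c x (extendZero T v t x)
    ∂(m t : Measure M) with hG
  have hFc : Continuous F := continuous_integral_curve hμc (f := fun p => φ (p.1, c))
    (hφ.freeze c).continuous
  have hsdi {t : ℝ} (ht : ∫⁻ x, ‖extendZero T v t x‖ₑ ∂(m t : Measure M) < ⊤) :
      Integrable (fun x => spatialDiff φ c x (extendZero T v t x))
        (m t : Measure M) ∧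
      ‖G t‖ ≤ (exists_forall_norm_grad_le (n := n) hφ c c).choose *
        meanSpeed m (extendZero T v) t := by
    obtain ⟨hC0, hC⟩ := (exists_forall_norm_grad_le (n := n) hφ c c).choose_spec
    set C := (exists_forall_norm_grad_le (n := n) hφ c c).choose
    have hm : Integrable (fun x => ‖extendZero T v t x‖) (m t : Measure M) := by
      refine ⟨((measurable_norm_comp hmeas).comp measurable_prodMk_left).aestronglyMeasurable, ?_⟩
      simpa [HasFiniteIntegral] using ht
    have hb (x : M) : |spatialDiff φ c x (extendZero T v t x)| ≤ C * ‖extendZero T v t x‖ :=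
      (abs_spatialDiff_le φ c x _).trans (by gcongr; exact hC c (by simp) x)
    refine ⟨(hm.const_mul C).mono' ((measurable_spatialDiff_comp hmeas hφ measurable_const).comp
      measurable_prodMk_left).aestronglyMeasurable (Eventually.of_forall hb), ?_⟩
    refine (norm_integral_le_of_norm_le (hm.const_mul C) (Eventually.of_forall hb)).trans
      (le_of_eq ?_)
    rw [integral_const_mul, integral_eq_lintegral_of_nonneg_ae
      (Eventually.of_forall fun x => norm_nonneg _)
      ((measurable_norm_comp hmeas).comp measurable_prodMk_left).aestronglyMeasurable]
    simp only [meanSpeed, ofReal_norm]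
  have hGi : Integrable G := by
    refine Integrable.mono' ((integrable_toReal_of_lintegral_ne_top
      (measurable_lintegral_curve hμc (measurable_enorm_comp hmeas)).aemeasurable
      hint.ne).const_mul (exists_forall_norm_grad_le (n := n) hφ c c).choose)
      (stronglyMeasurable_integral_curve hμc
        (measurable_spatialDiff_comp hmeas hφ measurable_const)).aestronglyMeasurable ?_
    filter_upwards [hlt] with t ht using (hsdi ht).2
  have key {s r : ℝ} (hs : s ∈ Icc 0 T) (hr : r ∈ Icc 0 T) : F r - F s = ∫ t in s..r, G t := by
    refine sub_eq_integral_of_forall_test hT hFc hGi (fun χ hχ hχc hχs => ?_) hs hr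
    have hsub : tsupport (fun p : M × ℝ => χ p.2 * φ (p.1, c)) ⊆ univ ×ˢ tsupport χ := by
      refine closure_minimal (fun p hp => ⟨mem_univ _, subset_tsupport _ ?_⟩)
        (isClosed_univ.prod (isClosed_tsupport _))
      exact left_ne_zero_of_mul hp
    have htest : IsTestFunction n T (fun p : M × ℝ => χ p.2 * φ (p.1, c)) :=
      ⟨hφ.const_mul_time c hχ,
        (isCompact_univ.prod hχc).of_isClosed_subset (isClosed_tsupport _) hsub,
        hsub.trans (prod_mono_right hχs)⟩
    rw [intervalIntegral.integral_of_le hT.le, integral_Ioc_eq_integral_Ioo]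
    refine Eq.trans ?_ (h.weak _ htest)
    refine setIntegral_congr_ae measurableSet_Ioo ?_
    filter_upwards [hlt] with t ht htm
    have hsd := (hsdi ht).1
    simp only [hF, hG]
    rw [hμeq htm] at hsd ⊢
    simp only [extendZero, if_pos htm] at hsd ⊢
    rw [← integral_const_mul, ← integral_const_mul, ← integral_add
      ((integrable_of_continuous (hφ.slice c).continuous _).const_mul _) (hsd.const_mul _)]
    refine integral_congr_ae (Eventually.of_forall fun x => ?_)
    have hd : deriv (fun s => χ s * φ (x, c)) t = deriv χ t * φ (x, c) :=
      deriv_mul_const ((hχ.differentiable one_ne_zero) t) _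
    simp only [spatialDiff_mul_time hφ, hd]
  have hG0 {t : ℝ} (ht : t ∉ Ioo 0 T) : G t = 0 := by
    simp only [hG, extendZero, if_neg ht]
    have (x : M) : spatialDiff φ c x (0 : TangentSpace (𝓡 n) x) = 0 := map_zero _
    simp [this]
  have hGii (s r : ℝ) : IntervalIntegrable G volume s r := hGi.intervalIntegrable
  -- Since `G` vanishes off `(0,T)`, both sides of the identity depend only on the clamped times.
  have hclamp (t : ℝ) : ∫ u in (0 : ℝ)..t, G u = ∫ u in (0 : ℝ)..(max 0 (min t T)), G u := by
    have hz {s r : ℝ} (hsr : ∀ u ∈ uIoc s r, u ∉ Ioo 0 T) : ∫ u in s..r, G u = 0 := by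
      refine (intervalIntegral.integral_congr_ae (g := fun _ => 0)
        (Eventually.of_forall fun u hu => hG0 (hsr u hu))).trans (by simp)
    rw [← intervalIntegral.integral_add_adjacent_intervals
      (hGii 0 (max 0 (min t T))) (hGii _ t)]
    rw [hz (s := max 0 (min t T)), add_zero]
    intro u hu hu'
    rcases le_total t 0 with h0 | h0
    · rw [min_eq_left (h0.trans hT.le), max_eq_left h0, uIoc_of_ge h0] at hu
      linarith [hu'.1, hu.2]
    rcases le_total t T with h1 | h1
    · rw [min_eq_left h1, max_eq_right h0] at hu
      simp at hu
    · rw [min_eq_right h1, max_eq_right hT.le, uIoc_of_le h1] at hu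
      linarith [hu'.2, hu.1]
  have hFcl (t : ℝ) : F t = F (max 0 (min t T)) := by
    have : m t = m (max 0 (min t T)) :=
      (clampCurve_of_mem μ' ⟨le_max_left _ _, max_le hT.le (min_le_right _ _)⟩).symm
    simp only [hF]
    rw [this]
  intro s r
  change F r - F s = ∫ t in s..r, G t
  have hmem (t : ℝ) : max 0 (min t T) ∈ Icc 0 T :=
    ⟨le_max_left _ _, max_le hT.le (min_le_right _ _)⟩
  rw [hFcl r, hFcl s, key (hmem s) (hmem r),
    ← intervalIntegral.integral_interval_sub_left (hGii 0 _) (hGii 0 _),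
    ← intervalIntegral.integral_interval_sub_left (hGii 0 r) (hGii 0 s), hclamp r, hclamp s]

theorem IsCEBetween.exists_isFlow {T : ℝ} (hT : 0 < T) {ν η : ProbabilityMeasure M}
    {μ : ℝ → ProbabilityMeasure M} {v : VelocityField n M} (h : IsCEBetween T ν η μ v) :
    ∃ μ' v', IsFlow μ' v' ∧ (∀ t ≤ 0, μ' t = ν) ∧ (∀ t ≥ T, μ' t = η) ∧
      ∀ t ∈ Ioo 0 T, μ' t = μ t ∧ v' t = v t := by
  have h0 := eq_lim_at_left_extendFrom_Ioo hT h.tendsto_zero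
  have h1 := eq_lim_at_right_extendFrom_Ioo hT h.tendsto_end
  have heq : EqOn (extendFrom (Ioo 0 T) μ) μ (Ioo 0 T) := fun t ht =>
    extendFrom_extends h.continuousOn t ht
  have hc := continuousOn_Icc_extendFrom_Ioo h.continuousOn h.tendsto_zero h.tendsto_end
  refine ⟨_, _, h.toIsCE.isFlow hT hc heq, fun t ht => ?_, fun t ht => ?_, fun t ht => ⟨?_, ?_⟩⟩
  · rw [clampCurve, max_eq_left (min_le_of_left_le ht), h0]
  · rw [clampCurve, min_eq_right ht, max_eq_right hT.le, h1]
  · rw [clampCurve_of_mem _ (Ioo_subset_Icc_self ht), heq ht]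
  · ext x; simp only [extendZero, if_pos ht]

end Conversion

/-! ### Changes of time -/

/-- The lower bound `ε ≤ g` makes the primitive of `g` strictly increasing and onto, so it is an
order isomorphism. No differentiability is needed for the substitution rule: the pushforward of `g
dt` agrees with Lebesgue measure on half-open intervals. -/
theorem exists_timeChange {g : ℝ → ℝ}
    (hg : ∀ a b, IntervalIntegrable g volume a b) {ε : ℝ} (hε : 0 < ε) (hle : ∀ t, ε ≤ g t)
    (a : ℝ) :
    ∃ τ : ℝ ≃o ℝ, (∀ t, τ.symm t = ∫ u in a..t, g u) ∧
      Measure.map τ.symm (volume.withDensity fun t => ENNReal.ofReal (g t)) = volume := by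
  set S : ℝ → ℝ := fun t => ∫ u in a..t, g u with hS
  have hSc : Continuous S := intervalIntegral.continuous_primitive hg a
  have hsub (s r : ℝ) : S r - S s = ∫ u in s..r, g u :=
    intervalIntegral.integral_interval_sub_left (hg a r) (hg a s)
  have hlow {s r : ℝ} (hsr : s ≤ r) : ε * (r - s) ≤ S r - S s := by
    rw [hsub, mul_comm]
    have := intervalIntegral.integral_mono_on hsr (intervalIntegrable_const (c := ε)) (hg s r)
      fun t _ => hle t
    simpa using this
  have hmono : StrictMono S := fun s r hsr => by
    have := hlow hsr.le
    have : 0 < ε * (r - s) := mul_pos hε (by linarith)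
    linarith
  have hSa : S a = 0 := intervalIntegral.integral_same
  have htop : Tendsto S atTop atTop := by
    refine tendsto_atTop_mono' _ ?_ ((tendsto_atTop_add_const_right _ (-a)
      tendsto_id).const_mul_atTop hε)
    filter_upwards [eventually_ge_atTop a] with t ht
    have := hlow ht
    rw [hSa, sub_zero] at this
    simpa [sub_eq_add_neg] using this
  have hbot : Tendsto S atBot atBot := by
    refine tendsto_atBot_mono' _ ?_ ((tendsto_atBot_add_const_right _ (-a)
      tendsto_id).const_mul_atBot hε)
    filter_upwards [eventually_le_atBot a] with t ht
    have := hlow ht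
    rw [hSa] at this
    simp only [id]
    linarith
  have hsurj : Function.Surjective S := hSc.surjective htop hbot
  set σ : ℝ ≃o ℝ := hmono.orderIsoOfSurjective S hsurj with hσ
  have hσS (t : ℝ) : σ t = S t := rfl
  refine ⟨σ.symm, fun t => rfl, ?_⟩
  change Measure.map σ _ = volume
  have hIoc (s r : ℝ) : Measure.map σ (volume.withDensity fun t => ENNReal.ofReal (g t)) (Ioc s r)
      = volume (Ioc s r) := by
    have hpre : σ ⁻¹' Ioc s r = Ioc (σ.symm s) (σ.symm r) := by simp
    rw [Measure.map_apply σ.continuous.measurable measurableSet_Ioc, hpre,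
      withDensity_apply _ measurableSet_Ioc]
    rcases le_total s r with hsr | hsr
    · have h1 : σ.symm s ≤ σ.symm r := σ.symm.monotone hsr
      have h2 := ofReal_integral_eq_lintegral_ofReal (hg (σ.symm s) (σ.symm r)).1
        (Eventually.of_forall fun t => hε.le.trans (hle t))
      rw [← h2, ← intervalIntegral.integral_of_le h1, ← hsub, ← hσS, ← hσS,
        σ.apply_symm_apply, σ.apply_symm_apply, Real.volume_Ioc]
    · rw [Ioc_eq_empty (not_lt.2 hsr), Ioc_eq_empty (not_lt.2 (σ.symm.monotone hsr))]
      simp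
  have : IsLocallyFiniteMeasure
      (Measure.map σ (volume.withDensity fun t => ENNReal.ofReal (g t))) := by
    refine ⟨fun x => ⟨Ioc (x - 1) (x + 1), Ioc_mem_nhds (by linarith) (by linarith), ?_⟩⟩
    rw [hIoc]
    exact measure_Ioc_lt_top
  exact Measure.ext_of_Ioc _ _ fun s r _ => hIoc s r

section TimeChange

variable {g : ℝ → ℝ} {τ : ℝ ≃o ℝ}

theorem lintegral_timeChange (hgm : Measurable g) (hpos : ∀ t, 0 < g t)
    (hτ : Measure.map τ.symm (volume.withDensity fun t => ENNReal.ofReal (g t)) = volume)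
    {f : ℝ → ℝ≥0∞} (hf : Measurable f) {s : Set ℝ} (hs : MeasurableSet s) :
    ∫⁻ u in s, ENNReal.ofReal (g (τ u))⁻¹ * f (τ u) = ∫⁻ t in τ.symm ⁻¹' s, f t := by
  have hme : MeasurableEmbedding τ.symm := τ.symm.toHomeomorph.measurableEmbedding
  have hs' : MeasurableSet (τ.symm ⁻¹' s) := hme.measurable hs
  conv_lhs => rw [← hτ]
  rw [hme.restrict_map, hme.lintegral_map, restrict_withDensity hs',
    lintegral_withDensity_eq_lintegral_mul₀ hgm.ennreal_ofReal.aemeasurable]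
  · refine lintegral_congr fun t => ?_
    rw [Pi.mul_apply, τ.apply_symm_apply, ← mul_assoc, ← ENNReal.ofReal_mul (hpos t).le,
      mul_inv_cancel₀ (hpos t).ne', ENNReal.ofReal_one, one_mul]
  · simp only [τ.apply_symm_apply]
    exact (hgm.inv.ennreal_ofReal.mul hf).aemeasurable

theorem intervalIntegral_timeChange (hgm : Measurable g) (hpos : ∀ t, 0 < g t)
    (hτ : Measure.map τ.symm (volume.withDensity fun t => ENNReal.ofReal (g t)) = volume)
    (f : ℝ → ℝ) (s r : ℝ) :
    ∫ u in s..r, (g (τ u))⁻¹ * f (τ u) = ∫ t in (τ s)..(τ r), f t := by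
  have hme : MeasurableEmbedding τ.symm := τ.symm.toHomeomorph.measurableEmbedding
  have key {s r : ℝ} (hsr : s ≤ r) :
      ∫ u in s..r, (g (τ u))⁻¹ * f (τ u) = ∫ t in (τ s)..(τ r), f t := by
    rw [intervalIntegral.integral_of_le hsr, intervalIntegral.integral_of_le (τ.monotone hsr)]
    conv_lhs => rw [← hτ]
    have hpre : τ.symm ⁻¹' Ioc s r = Ioc (τ s) (τ r) := by simp
    rw [hme.setIntegral_map, hpre]
    have := setIntegral_withDensity_eq_setIntegral_smul (μ := volume) hgm.real_toNNReal
      (fun t => (g (τ (τ.symm t)))⁻¹ * f (τ (τ.symm t))) (measurableSet_Ioc (a := τ s) (b := τ r))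
    refine this.trans (setIntegral_congr_fun measurableSet_Ioc fun t _ => ?_)
    simp only [τ.apply_symm_apply, NNReal.smul_def, smul_eq_mul]
    rw [Real.coe_toNNReal _ (hpos t).le, ← mul_assoc, mul_inv_cancel₀ (hpos t).ne', one_mul]
  rcases le_total s r with h | h
  · exact key h
  · rw [intervalIntegral.integral_symm, key h, ← intervalIntegral.integral_symm]

end TimeChange

theorem lintegral_mul_le_sqrt_mul_sqrt {α : Type*} [MeasurableSpace α] (m : Measure α)
    {f g : α → ℝ≥0∞} (hf : AEMeasurable f m) (hg : AEMeasurable g m) :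
    ∫⁻ a, f a * g a ∂m ≤ (∫⁻ a, f a ^ 2 ∂m) ^ (1 / 2 : ℝ) * (∫⁻ a, g a ^ 2 ∂m) ^ (1 / 2 : ℝ) := by
  have := ENNReal.lintegral_mul_le_Lp_mul_Lq m Real.HolderConjugate.two_two hf hg
  simpa using this

theorem ENNReal.sqrt_sq (x : ℝ≥0∞) : (x ^ (1 / 2 : ℝ)) ^ 2 = x := by
  rw [← ENNReal.rpow_two, ← ENNReal.rpow_mul]; norm_num

theorem ENNReal.sq_sqrt (x : ℝ≥0∞) : (x ^ 2) ^ (1 / 2 : ℝ) = x := by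
  rw [← ENNReal.rpow_two, ← ENNReal.rpow_mul]; norm_num

theorem ENNReal.sqrt_le_iff {x y : ℝ≥0∞} : x ^ (1 / 2 : ℝ) ≤ y ↔ x ≤ y ^ 2 := by
  constructor
  · intro h
    rw [← ENNReal.sqrt_sq x]
    gcongr
  · intro h
    rw [← ENNReal.sq_sqrt y]
    gcongr

theorem ENNReal.le_sqrt_iff {x y : ℝ≥0∞} : x ≤ y ^ (1 / 2 : ℝ) ↔ x ^ 2 ≤ y := by
  constructor
  · intro h
    rw [← ENNReal.sqrt_sq y]
    gcongr
  · intro h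
    rw [← ENNReal.sq_sqrt x]
    gcongr

section Transport

variable {n : ℕ} {M : Type*} [TopologicalSpace M] [T2Space M] [CompactSpace M]
    [SecondCountableTopology M]
    [ChartedSpace (EuclideanSpace ℝ (Fin n)) M] [IsManifold (𝓡 n) ∞ M]
    [RiemannianBundle (fun x : M => TangentSpace (𝓡 n) x)]
    [IsContMDiffRiemannianBundle (𝓡 n) ∞ (EuclideanSpace ℝ (Fin n))
      (fun x : M => TangentSpace (𝓡 n) x)]
    [MeasurableSpace M] [BorelSpace M]

theorem continuous_mobility {K : M × M → ℝ} (hK : Continuous K) :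
    Continuous (fun q : M × ProbabilityMeasure M => mobility K q.2 q.1) :=
  continuous_integral_pairing hK

theorem le_mobility {K : M × M → ℝ} (hK : Continuous K) {C : ℝ} (hC : ∀ p, C ≤ K p)
    (μ : ProbabilityMeasure M) (x : M) : C ≤ mobility K μ x := by
  have h : Integrable (fun y => K (x, y)) (μ : Measure M) :=
    integrable_of_continuous (hK.comp (continuous_const.prodMk continuous_id)) μ
  have := integral_mono (integrable_const C) h fun y => hC (x, y)
  simpa [mobility] using this

theorem weightedAction_smul (K : M × M → ℝ) (μ : ProbabilityMeasure M) (c : ℝ)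
    (w : (x : M) → TangentSpace (𝓡 n) x) :
    weightedAction K μ (fun x => c • w x) = ‖c‖ₑ ^ 2 * weightedAction K μ w := by
  unfold weightedAction
  rw [← lintegral_const_mul' _ _ (by finiteness)]
  refine lintegral_congr fun x => ?_
  rw [enorm_smul]
  ring

theorem measurable_weightedAction {K : M × M → ℝ} (hK : Continuous K)
    {μ : ℝ → ProbabilityMeasure M} {v : VelocityField n M} (h : IsFlow μ v) :
    Measurable (fun t => weightedAction K (μ t) (v t)) := by
  refine measurable_lintegral_curve h.continuous
    (f := fun p : ℝ × M => ENNReal.ofReal (mobility K (μ p.1) p.2) * ‖v p.1 p.2‖ₑ ^ 2) ?_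
  refine Measurable.mul ?_ ((measurable_enorm_comp h.measurable).pow_const 2)
  exact ((continuous_mobility hK).comp
    (continuous_snd.prodMk (h.continuous.comp continuous_fst))).measurable.ennreal_ofReal

theorem measurable_sqrt_weightedAction {K : M × M → ℝ} (hK : Continuous K)
    {μ : ℝ → ProbabilityMeasure M} {v : VelocityField n M} (h : IsFlow μ v) :
    Measurable (fun t => weightedAction K (μ t) (v t) ^ (1 / 2 : ℝ)) :=
  (measurable_weightedAction hK h).pow_const _

theorem IsFlow.timeChange {μ : ℝ → ProbabilityMeasure M} {v : VelocityField n M}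
    (h : IsFlow μ v) {g : ℝ → ℝ} {τ : ℝ ≃o ℝ} (hgm : Measurable g) (hpos : ∀ t, 0 < g t)
    (hτ : Measure.map τ.symm (volume.withDensity fun t => ENNReal.ofReal (g t)) = volume) :
    IsFlow (fun u => μ (τ u)) (fun u x => (g (τ u))⁻¹ • v (τ u) x) where
  continuous := h.continuous.comp τ.continuous
  measurable := by
    have h1 : Measurable (fun p : ℝ × M => (τ p.1, p.2)) :=
      (τ.continuous.measurable.comp measurable_fst).prodMk measurable_snd
    exact continuous_smul_tangentBundle.measurable.comp
      (((hgm.comp (measurable_fst.comp h1)).inv).prodMk (h.measurable.comp h1))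
  integrable := by
    have := lintegral_timeChange hgm hpos hτ h.measurable_lintegral_enorm MeasurableSet.univ
    rw [preimage_univ, Measure.restrict_univ] at this
    refine lt_of_le_of_lt (le_of_eq ?_) h.integrable
    rw [← this]
    refine lintegral_congr fun u => ?_
    rw [← lintegral_const_mul' _ _ ENNReal.ofReal_ne_top]
    refine lintegral_congr fun x => ?_
    rw [enorm_smul, Real.enorm_of_nonneg (inv_nonneg.2 (hpos _).le)]
  eq φ hφ c s r := by
    rw [h.eq φ hφ c (τ s) (τ r), ← intervalIntegral_timeChange hgm hpos hτ]
    refine intervalIntegral.integral_congr fun u _ => ?_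
    rw [← integral_const_mul]
    refine integral_congr_ae (Eventually.of_forall fun x => ?_)
    exact (map_smul (mfderiv (𝓡 n) 𝓘(ℝ, ℝ) (fun y => φ (y, c)) x) _ _).symm

theorem isFlow_const (ν : ProbabilityMeasure M) :
    IsFlow (fun _ => ν) (fun _ _ => 0 : VelocityField n M) where
  continuous := continuous_const
  measurable := by
    have h0 : Continuous (fun x : M => (⟨x, 0⟩ : TangentBundle (𝓡 n) M)) :=
      (contMDiff_zeroSection ℝ (IB := 𝓡 n) (n := 0) (F := EuclideanSpace ℝ (Fin n))
        (TangentSpace (𝓡 n) (M := M))).continuous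
    exact h0.measurable.comp measurable_snd
  integrable := by simp only [enorm_zero, lintegral_zero, ENNReal.zero_lt_top]
  eq φ hφ c s r := by
    have (x : M) : spatialDiff φ c x (0 : TangentSpace (𝓡 n) x) = 0 := map_zero _
    simp [this]

theorem transportDist_le_sqrt {K : M × M → ℝ} {ν η : ProbabilityMeasure M}
    {μ : ℝ → ProbabilityMeasure M} {v : VelocityField n M} (h : IsCEBetween 1 ν η μ v) :
    transportDist n K ν η ≤ (∫⁻ t in Ioo (0 : ℝ) 1, weightedAction K (μ t) (v t)) ^ (1 / 2 : ℝ) := by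
  unfold transportDist
  gcongr
  exact iInf₂_le_of_le μ v (iInf_le _ h)

theorem transportDist_self (K : M × M → ℝ) (ν : ProbabilityMeasure M) :
    transportDist n K ν ν = 0 := by
  refine le_antisymm ((transportDist_le_sqrt
    ((isFlow_const (n := n) ν).isCEBetween one_pos)).trans (le_of_eq ?_)) bot_le
  simp [weightedAction]

/-- The infimum defining the distance is over actions on `(0,1)`. Moving along the same curve at
almost constant speed makes the action almost equal to the squared length. -/
theorem IsFlow.transportDist_le {K : M × M → ℝ} (hK : Continuous K)
    {μ : ℝ → ProbabilityMeasure M} {v : VelocityField n M} (h : IsFlow μ v) {s r : ℝ}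
    (hsr : s ≤ r) : transportDist n K (μ s) (μ r) ≤
      ∫⁻ t in Ioo s r, weightedAction K (μ t) (v t) ^ (1 / 2 : ℝ) := by
  rcases hsr.eq_or_lt with rfl | hsr
  · rw [transportDist_self]; exact bot_le
  set I := ∫⁻ t in Ioo s r, weightedAction K (μ t) (v t) ^ (1 / 2 : ℝ) with hI
  rcases eq_or_ne I ⊤ with hIt | hIt
  · rw [hIt]; exact le_top
  have hAm := measurable_sqrt_weightedAction hK h
  set a : ℝ → ℝ := (Ioo s r).indicator
    fun t => (weightedAction K (μ t) (v t) ^ (1 / 2 : ℝ)).toReal with ha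
  have ham : Measurable a := hAm.ennreal_toReal.indicator measurableSet_Ioo
  have ha0 (t : ℝ) : 0 ≤ a t := indicator_nonneg (fun _ _ => ENNReal.toReal_nonneg) t
  have hai : Integrable a := by
    rw [ha, integrable_indicator_iff measurableSet_Ioo]
    exact integrable_toReal_of_lintegral_ne_top hAm.aemeasurable hIt
  have haI : ∫ t in s..r, a t = I.toReal := by
    rw [intervalIntegral.integral_of_le hsr.le, integral_Ioc_eq_integral_Ioo,
      setIntegral_indicator measurableSet_Ioo, inter_self, integral_toReal hAm.aemeasurable]
    exact MeasureTheory.ae_lt_top hAm hIt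
  have key (δ : ℝ) (hδ : 0 < δ) : transportDist n K (μ s) (μ r) ≤
      ENNReal.ofReal (δ * (r - s) + I.toReal) := by
    set L := δ * (r - s) + I.toReal with hL
    have hLpos : 0 < L := add_pos_of_pos_of_nonneg (mul_pos hδ (by linarith)) ENNReal.toReal_nonneg
    -- The new time runs proportionally to arc length; `δ` keeps it running where the speed `a`
    -- vanishes, and `L` normalizes the total time to `1`.
    set g : ℝ → ℝ := fun t => (δ + a t) / L with hg
    have hgm : Measurable g := (measurable_const.add ham).div_const L
    have hgi (s r : ℝ) : IntervalIntegrable g volume s r :=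
      (_root_.intervalIntegrable_const.add hai.intervalIntegrable).div_const L
    have hgle (t : ℝ) : δ / L ≤ g t := by
      simp only [hg]; gcongr; linarith [ha0 t]
    have hgpos (t : ℝ) : 0 < g t := (div_pos hδ hLpos).trans_le (hgle t)
    obtain ⟨τ, hτS, hτ⟩ := exists_timeChange hgi (div_pos hδ hLpos) hgle s
    have hs : τ.symm s = 0 := by rw [hτS, intervalIntegral.integral_same]
    have hr : τ.symm r = 1 := by
      rw [hτS]
      simp only [hg]
      rw [intervalIntegral.integral_div, intervalIntegral.integral_add _root_.intervalIntegrable_const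
        hai.intervalIntegrable, haI, intervalIntegral.integral_const, smul_eq_mul, mul_comm, ← hL,
        div_self hLpos.ne']
    have hτ0 : τ 0 = s := by rw [← hs, τ.apply_symm_apply]
    have hτ1 : τ 1 = r := by rw [← hr, τ.apply_symm_apply]
    have h' := (h.timeChange hgm hgpos hτ).isCEBetween one_pos
    simp only [hτ0, hτ1] at h'
    refine (transportDist_le_sqrt h').trans (ENNReal.sqrt_le_iff.2 ?_)
    have hpre : τ.symm ⁻¹' Ioo 0 1 = Ioo s r := by simp [hτ0, hτ1]
    have e1 : ∫⁻ u in Ioo (0 : ℝ) 1, weightedAction K (μ (τ u)) (fun x => (g (τ u))⁻¹ • v (τ u) x) =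
        ∫⁻ t in Ioo s r, ENNReal.ofReal (g t)⁻¹ * weightedAction K (μ t) (v t) := by
      rw [← hpre, ← lintegral_timeChange hgm hgpos hτ
        (f := fun t => ENNReal.ofReal (g t)⁻¹ * weightedAction K (μ t) (v t)) (hgm.inv.ennreal_ofReal.mul (measurable_weightedAction hK h)) measurableSet_Ioo]
      refine lintegral_congr fun u => ?_
      rw [weightedAction_smul, Real.enorm_of_nonneg (inv_nonneg.2 (hgpos _).le)]
      ring
    rw [e1]
    -- The integrand is `L a² / (δ + a) ≤ L a`, so the action is at most `L · I ≤ L²`.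
    calc ∫⁻ t in Ioo s r, ENNReal.ofReal (g t)⁻¹ * weightedAction K (μ t) (v t)
        ≤ ∫⁻ t in Ioo s r, ENNReal.ofReal L * weightedAction K (μ t) (v t) ^ (1 / 2 : ℝ) := by
          refine lintegral_mono_ae ?_
          filter_upwards [ae_restrict_mem measurableSet_Ioo, MeasureTheory.ae_lt_top hAm hIt] with t ht hlt
          have hat : weightedAction K (μ t) (v t) ^ (1 / 2 : ℝ) = ENNReal.ofReal (a t) := by
            rw [ha, indicator_of_mem ht, ENNReal.ofReal_toReal hlt.ne]
          rw [← ENNReal.sqrt_sq (weightedAction K (μ t) (v t)), ENNReal.sq_sqrt, hat,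
            ← ENNReal.ofReal_pow (ha0 t), ← ENNReal.ofReal_mul (inv_nonneg.2 (hgpos t).le),
            ← ENNReal.ofReal_mul hLpos.le]
          refine ENNReal.ofReal_le_ofReal ?_
          have hpos : 0 < δ + a t := by linarith [ha0 t]
          simp only [hg, inv_div]
          rw [div_mul_eq_mul_div, div_le_iff₀ hpos]
          nlinarith [ha0 t, mul_nonneg (mul_nonneg hLpos.le (ha0 t)) hδ.le]
      _ = ENNReal.ofReal L * I := lintegral_const_mul _ hAm
      _ ≤ ENNReal.ofReal L ^ 2 := by
          rw [sq]
          gcongr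
          rw [← ENNReal.ofReal_toReal hIt]
          refine ENNReal.ofReal_le_ofReal ?_
          rw [hL]
          have : 0 < δ * (r - s) := mul_pos hδ (by linarith)
          linarith
  have hlim : Tendsto (fun δ : ℝ => ENNReal.ofReal (δ * (r - s) + I.toReal)) (𝓝[>] 0)
      (𝓝 (ENNReal.ofReal (0 * (r - s) + I.toReal))) := by
    refine (ENNReal.continuous_ofReal.tendsto _).comp ?_
    exact ((tendsto_id.mul_const _).add_const _).mono_left nhdsWithin_le_nhds
  rw [zero_mul, zero_add, ENNReal.ofReal_toReal hIt] at hlim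
  exact ge_of_tendsto hlim (by filter_upwards [self_mem_nhdsWithin] with δ hδ using key δ hδ)

/-- Near-minimizers can be taken to be globally defined, with the endpoints attained as values; this
is the form in which curves are reversed and concatenated. -/
theorem exists_isFlow_of_transportDist_lt {K : M × M → ℝ} {ν η : ProbabilityMeasure M} {E : ℝ≥0∞}
    (hE : transportDist n K ν η < E) :
    ∃ (μ : ℝ → ProbabilityMeasure M) (v : VelocityField n M), IsFlow μ v ∧ (∀ t ≤ 0, μ t = ν) ∧
      (∀ t ≥ 1, μ t = η) ∧
      (∫⁻ t in Ioo (0 : ℝ) 1, weightedAction K (μ t) (v t)) ^ (1 / 2 : ℝ) < E := by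
  by_contra! hcon
  refine not_le.2 hE (ENNReal.le_sqrt_iff.2 (le_iInf₂ fun μ v => le_iInf fun h => ?_))
  obtain ⟨μ', v', hf, h0, h1, heq⟩ := h.exists_isFlow one_pos
  refine (ENNReal.le_sqrt_iff.1 (hcon μ' v' hf h0 h1)).trans (le_of_eq ?_)
  refine setLIntegral_congr_fun measurableSet_Ioo fun t ht => ?_
  simp only [(heq t ht).1, (heq t ht).2]

theorem lintegral_sqrt_weightedAction_le {K : M × M → ℝ} (hK : Continuous K)
    {μ : ℝ → ProbabilityMeasure M} {v : VelocityField n M} (h : IsFlow μ v) {s : Set ℝ}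
    (hs : volume s ≤ 1) : ∫⁻ t in s, weightedAction K (μ t) (v t) ^ (1 / 2 : ℝ) ≤
      (∫⁻ t in s, weightedAction K (μ t) (v t)) ^ (1 / 2 : ℝ) := by
  have := lintegral_mul_le_sqrt_mul_sqrt (volume.restrict s)
    (measurable_sqrt_weightedAction hK h).aemeasurable (aemeasurable_const (b := 1))
  simp only [mul_one, ENNReal.sqrt_sq, one_pow, lintegral_const, one_mul,
    Measure.restrict_apply MeasurableSet.univ, univ_inter] at this
  refine this.trans (mul_le_of_le_one_right' ?_)
  exact (ENNReal.rpow_le_rpow hs (by norm_num)).trans (by simp)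

theorem IsFlow.reverse {μ : ℝ → ProbabilityMeasure M} {v : VelocityField n M} (h : IsFlow μ v) :
    IsFlow (fun t => μ (-t)) (fun t x => (-1 : ℝ) • v (-t) x) where
  continuous := h.continuous.comp continuous_neg
  measurable := by
    have h1 : Measurable (fun p : ℝ × M => (-p.1, p.2)) := by fun_prop
    exact continuous_smul_tangentBundle.measurable.comp
      (measurable_const.prodMk (h.measurable.comp h1))
  integrable := by
    refine lt_of_le_of_lt (le_of_eq ?_) h.integrable
    rw [← lintegral_neg_eq_self]
    simp
  eq φ hφ c s r := by
    rw [h.eq φ hφ c (-s) (-r), intervalIntegral.integral_symm, ← intervalIntegral.integral_comp_neg,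
      ← intervalIntegral.integral_neg]
    refine intervalIntegral.integral_congr fun u _ => ?_
    rw [← integral_neg]
    refine integral_congr_ae (Eventually.of_forall fun x => ?_)
    exact (neg_one_mul _).symm.trans
      (map_smul (mfderiv (𝓡 n) 𝓘(ℝ, ℝ) (fun y => φ (y, c)) x) (-1 : ℝ) _).symm

theorem transportDist_comm_le {K : M × M → ℝ} (hK : Continuous K) (ν η : ProbabilityMeasure M) :
    transportDist n K η ν ≤ transportDist n K ν η := by
  refine le_of_forall_gt fun E hE => ?_
  obtain ⟨μ, v, h, h0, h1, hlt⟩ := exists_isFlow_of_transportDist_lt hE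
  have h2 := h.reverse.transportDist_le hK (s := -1) (r := 0) (by norm_num)
  simp only [neg_neg, neg_zero, h0 0 le_rfl, h1 1 le_rfl] at h2
  refine lt_of_le_of_lt (h2.trans ?_) hlt
  refine (lintegral_sqrt_weightedAction_le hK h.reverse (by simp)).trans (le_of_eq ?_)
  congr 1
  have e := (Measure.measurePreserving_neg (volume : Measure ℝ)).setLIntegral_comp_emb
    (Homeomorph.neg ℝ).measurableEmbedding (fun t => weightedAction K (μ t) (v t)) (Ioo (-1) 0)
  have hpre : (fun t : ℝ => -t) '' Ioo (-1) 0 = Ioo 0 1 := by simp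
  change ∫⁻ t in Ioo (-1 : ℝ) 0, weightedAction K (μ (-t)) (v (-t)) =
    ∫⁻ t in (fun t : ℝ => -t) '' Ioo (-1) 0, weightedAction K (μ t) (v t) at e
  rw [hpre] at e
  rw [← e]
  refine lintegral_congr fun t => ?_
  rw [weightedAction_smul]
  simp

theorem transportDist_comm {K : M × M → ℝ} (hK : Continuous K) (ν η : ProbabilityMeasure M) :
    transportDist n K ν η = transportDist n K η ν :=
  le_antisymm (transportDist_comm_le hK η ν) (transportDist_comm_le hK ν η)

theorem IsFlow.concat {μ₁ μ₂ : ℝ → ProbabilityMeasure M} {v₁ v₂ : VelocityField n M}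
    (h₁ : IsFlow μ₁ v₁) (h₂ : IsFlow μ₂ v₂) (heq : μ₁ 1 = μ₂ 0) :
    IsFlow (fun t => if t ≤ 1 then μ₁ t else μ₂ (t - 1))
      (fun t => if t ≤ 1 then v₁ t else v₂ (t - 1)) where
  continuous := Continuous.if_le h₁.continuous (h₂.continuous.comp (by fun_prop)) continuous_id
    continuous_const (by rintro t rfl; simp [heq])
  measurable := by
    have h1 : Measurable (fun p : ℝ × M => (p.1 - 1, p.2)) := by fun_prop
    have hs : MeasurableSet {p : ℝ × M | p.1 ≤ 1} := measurableSet_le measurable_fst measurable_const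
    have : Measurable (fun p : ℝ × M => if p.1 ≤ 1 then
        (⟨p.2, v₁ p.1 p.2⟩ : TangentBundle (𝓡 n) M) else ⟨p.2, v₂ (p.1 - 1) p.2⟩) :=
      Measurable.ite hs h₁.measurable (h₂.measurable.comp h1)
    convert this using 2 with p
    split_ifs <;> rfl
  integrable := by
    have hle (t : ℝ) : ∫⁻ x, ‖(if t ≤ 1 then v₁ t else v₂ (t - 1)) x‖ₑ
        ∂((if t ≤ 1 then μ₁ t else μ₂ (t - 1) : ProbabilityMeasure M) : Measure M) ≤
        ∫⁻ x, ‖v₁ t x‖ₑ ∂(μ₁ t : Measure M) + ∫⁻ x, ‖v₂ (t - 1) x‖ₑ ∂(μ₂ (t - 1) : Measure M) := by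
      split_ifs
      · exact le_self_add
      · exact le_add_self
    refine (lintegral_mono hle).trans_lt ?_
    rw [lintegral_add_left h₁.measurable_lintegral_enorm, lintegral_sub_right_eq_self
      (fun t => ∫⁻ x, ‖v₂ t x‖ₑ ∂(μ₂ t : Measure M))]
    exact ENNReal.add_lt_top.2 ⟨h₁.integrable, h₂.integrable⟩
  eq φ hφ c := by
    set m : ℝ → ProbabilityMeasure M := fun t => if t ≤ 1 then μ₁ t else μ₂ (t - 1) with hm
    set w : VelocityField n M := fun t => if t ≤ 1 then v₁ t else v₂ (t - 1) with hw
    set G : ℝ → ℝ := fun t => ∫ x, spatialDiff φ c x (w t x) ∂(m t : Measure M) with hG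
    have hG1 {t : ℝ} (ht : t ≤ 1) :
        G t = ∫ x, spatialDiff φ c x (v₁ t x) ∂(μ₁ t : Measure M) := by
      simp only [hG, hm, hw, if_pos ht]
    have hG2 {t : ℝ} (ht : 1 < t) :
        G t = ∫ x, spatialDiff φ c x (v₂ (t - 1) x) ∂(μ₂ (t - 1) : Measure M) := by
      simp only [hG, hm, hw, if_neg ht.not_ge]
    have hi1 {t : ℝ} (ht : t ≤ 1) : IntervalIntegrable G volume 1 t := by
      refine (h₁.intervalIntegrable_const hφ c 1 t).congr fun u hu => ?_
      rw [uIoc_of_ge ht] at hu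
      exact (hG1 hu.2).symm
    have hi2 {t : ℝ} (ht : 1 ≤ t) : IntervalIntegrable G volume 1 t := by
      have := (h₂.intervalIntegrable_const hφ c 0 (t - 1)).comp_sub_right 1
      simp only [zero_add, sub_add_cancel] at this
      refine this.congr fun u hu => ?_
      rw [uIoc_of_le ht] at hu
      exact (hG2 hu.1).symm
    have hi (t : ℝ) : IntervalIntegrable G volume 1 t := (le_total t 1).elim hi1 hi2
    have hm1 : m 1 = μ₁ 1 := if_pos le_rfl
    have key (t : ℝ) : ∫ x, φ (x, c) ∂(m t : Measure M) - ∫ x, φ (x, c) ∂(m 1 : Measure M) =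
        ∫ u in (1 : ℝ)..t, G u := by
      rcases le_or_gt t 1 with ht | ht
      · have h3 : m t = μ₁ t := if_pos ht
        rw [h3, hm1, h₁.eq φ hφ c 1 t]
        refine intervalIntegral.integral_congr fun u hu => ?_
        rw [uIcc_of_ge ht] at hu
        exact (hG1 hu.2).symm
      · have h3 : m t = μ₂ (t - 1) := if_neg ht.not_ge
        have h4 := intervalIntegral.integral_comp_sub_right (a := 1) (b := t)
          (fun u => ∫ x, spatialDiff φ c x (v₂ u x) ∂(μ₂ u : Measure M)) 1
        rw [sub_self] at h4
        rw [h3, hm1, heq, h₂.eq φ hφ c 0 (t - 1), ← h4]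
        refine intervalIntegral.integral_congr_ae (Eventually.of_forall fun u hu => ?_)
        rw [uIoc_of_le ht.le] at hu
        exact (hG2 hu.1).symm
    intro s r
    change ∫ x, φ (x, c) ∂(m r : Measure M) - ∫ x, φ (x, c) ∂(m s : Measure M) =
      ∫ u in s..r, G u
    rw [← intervalIntegral.integral_interval_sub_left (hi r) (hi s), ← key r, ← key s]
    ring

/-- Near-minimizers are concatenated over `[0,2]`. The length estimate makes lengths add, so no
optimal splitting of the time interval has to be found. -/
theorem transportDist_triangle {K : M × M → ℝ} (hK : Continuous K)
    (ν η σ : ProbabilityMeasure M) :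
    transportDist n K ν σ ≤ transportDist n K ν η + transportDist n K η σ := by
  refine ENNReal.le_of_forall_pos_le_add fun ε hε hlt => ?_
  have hε2 : (ε / 2 : ℝ≥0∞) ≠ 0 := by simpa using hε.ne'
  rw [ENNReal.add_lt_top] at hlt
  obtain ⟨μ₁, v₁, h₁, h10, h11, e1⟩ :=
    exists_isFlow_of_transportDist_lt (ENNReal.lt_add_right hlt.1.ne hε2)
  obtain ⟨μ₂, v₂, h₂, h20, h21, e2⟩ :=
    exists_isFlow_of_transportDist_lt (ENNReal.lt_add_right hlt.2.ne hε2)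
  have hc := h₁.concat h₂ (by rw [h11 1 le_rfl, h20 0 le_rfl])
  have h3 := hc.transportDist_le hK (s := 0) (r := 2) (by norm_num)
  have hz : ((2 : ℝ) - 1) = 1 := by norm_num
  simp only [zero_le_one, if_true, h10 0 le_rfl, show ¬ (2 : ℝ) ≤ 1 by norm_num, if_false, hz,
    h21 1 le_rfl] at h3
  refine h3.trans ?_
  have hunion : Ioo (0 : ℝ) 2 ⊆ Ioc 0 1 ∪ Ioo 1 2 := fun t ht =>
    (le_or_gt t 1).imp (fun h => ⟨ht.1, h⟩) (fun h => ⟨h, ht.2⟩)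
  refine (lintegral_mono_set hunion).trans ((lintegral_union_le _ _ _).trans ?_)
  have i1 : ∫⁻ t in Ioc (0 : ℝ) 1, weightedAction K (if t ≤ 1 then μ₁ t else μ₂ (t - 1))
      (if t ≤ 1 then v₁ t else v₂ (t - 1)) ^ (1 / 2 : ℝ) ≤ transportDist n K ν η + ε / 2 := by
    rw [setLIntegral_congr_fun (g := fun t => weightedAction K (μ₁ t) (v₁ t) ^ (1 / 2 : ℝ))
      measurableSet_Ioc fun t ht => by simp only [if_pos ht.2],
      ← setLIntegral_congr Ioo_ae_eq_Ioc]
    exact (lintegral_sqrt_weightedAction_le hK h₁ (by simp)).trans e1.le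
  have i2 : ∫⁻ t in Ioo (1 : ℝ) 2, weightedAction K (if t ≤ 1 then μ₁ t else μ₂ (t - 1))
      (if t ≤ 1 then v₁ t else v₂ (t - 1)) ^ (1 / 2 : ℝ) ≤ transportDist n K η σ + ε / 2 := by
    rw [setLIntegral_congr_fun
      (g := fun t => weightedAction K (μ₂ (t - 1)) (v₂ (t - 1)) ^ (1 / 2 : ℝ))
      measurableSet_Ioo fun t ht => by simp only [if_neg ht.1.not_ge]]
    have e := (measurePreserving_sub_right (volume : Measure ℝ) 1).setLIntegral_comp_emb
      (Homeomorph.subRight (1 : ℝ)).measurableEmbedding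
      (fun t => weightedAction K (μ₂ t) (v₂ t) ^ (1 / 2 : ℝ)) (Ioo 1 2)
    have hpre : (fun t : ℝ => t - 1) '' Ioo 1 2 = Ioo 0 1 := by
      rw [image_sub_const_Ioo]; norm_num
    rw [hpre] at e
    rw [e]
    exact (lintegral_sqrt_weightedAction_le hK h₂ (by simp)).trans e2.le
  refine (add_le_add i1 i2).trans (le_of_eq ?_)
  rw [add_add_add_comm, ENNReal.add_halves]

end Transport

/-! ### Duality estimates for the transport distance -/

section Slope

variable {n : ℕ} {M : Type*} [TopologicalSpace M] [T2Space M] [CompactSpace M]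
    [SecondCountableTopology M]
    [ChartedSpace (EuclideanSpace ℝ (Fin n)) M] [IsManifold (𝓡 n) ∞ M]
    [RiemannianBundle (fun x : M => TangentSpace (𝓡 n) x)]
    [IsContMDiffRiemannianBundle (𝓡 n) ∞ (EuclideanSpace ℝ (Fin n))
      (fun x : M => TangentSpace (𝓡 n) x)]
    [MeasurableSpace M] [BorelSpace M]

/-- The squared slope `∫ |∇φ_t|² / m_ν dν` of `ν ↦ ∫ φ_t dν`. -/
def slopeSq (n : ℕ) {M : Type*} [TopologicalSpace M] [ChartedSpace (EuclideanSpace ℝ (Fin n)) M]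
    [MeasurableSpace M] [RiemannianBundle (fun x : M => TangentSpace (𝓡 n) x)]
    (K : M × M → ℝ) (φ : M × ℝ → ℝ) (t : ℝ) (ν : ProbabilityMeasure M) : ℝ :=
  ∫ x, ‖grad (n := n) φ t x‖ ^ 2 / mobility K ν x ∂(ν : Measure M)

variable {K : M × M → ℝ}

theorem slopeSq_nonneg (hpos : ∀ (ν : ProbabilityMeasure M) x, 0 < mobility K ν x)
    (φ : M × ℝ → ℝ) (t : ℝ) (ν : ProbabilityMeasure M) : 0 ≤ slopeSq n K φ t ν :=
  integral_nonneg fun x => div_nonneg (sq_nonneg _) (hpos ν x).le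

theorem continuous_slopeSq (hK : Continuous K)
    (hpos : ∀ (ν : ProbabilityMeasure M) x, 0 < mobility K ν x)
    {φ : M × ℝ → ℝ} (hφ : IsC1 n φ) :
    Continuous (fun q : ℝ × ProbabilityMeasure M => slopeSq n K φ q.1 q.2) := by
  have hf : Continuous (fun p : (ℝ × ProbabilityMeasure M) × M =>
      ‖grad (n := n) φ p.1.1 p.2‖ ^ 2 / mobility K p.1.2 p.2) := by
    refine Continuous.div ?_ ?_ fun p => (hpos _ _).ne'
    · exact ((continuous_norm_grad hφ).comp
        (continuous_snd.prodMk (continuous_fst.comp continuous_fst))).pow 2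
    · exact (continuous_mobility hK).comp
        (continuous_snd.prodMk (continuous_snd.comp continuous_fst))
  exact (continuous_integral_pairing hf).comp (continuous_id.prodMk continuous_snd)

/-- Cauchy–Schwarz for the product of `|∇φ| / √m_ν` and `√m_ν |w|`. -/
theorem enorm_integral_spatialDiff_le (hK : Continuous K)
    (hpos : ∀ (ν : ProbabilityMeasure M) x, 0 < mobility K ν x)
    {φ : M × ℝ → ℝ} (hφ : IsC1 n φ) (c : ℝ) (ν : ProbabilityMeasure M)
    {w : (x : M) → TangentSpace (𝓡 n) x}
    (hw : Measurable (fun x => (⟨x, w x⟩ : TangentBundle (𝓡 n) M))) :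
    ‖∫ x, spatialDiff φ c x (w x) ∂(ν : Measure M)‖ₑ ≤
      ENNReal.ofReal (√(slopeSq n K φ c ν)) * weightedAction K ν w ^ (1 / 2 : ℝ) := by
  have hmc : Continuous (fun x => mobility K ν x) :=
    (continuous_mobility hK).comp (continuous_id.prodMk continuous_const)
  have hgc : Continuous (fun x => ‖grad (n := n) φ c x‖) :=
    Continuous.comp (g := fun p : M × ℝ => ‖grad (n := n) φ p.2 p.1‖) (f := fun x => (x, c))
      (continuous_norm_grad hφ) (by fun_prop)
  have hwm : Measurable (fun x => ‖w x‖ₑ) := by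
    exact (measurable_enorm_comp (v := fun _ => w) (hw.comp measurable_snd)).comp
      (measurable_prodMk_left (x := (0 : ℝ)))
  have hsqrt {a : ℝ} (ha : 0 ≤ a) : ENNReal.ofReal √a ^ 2 = ENNReal.ofReal a := by
    rw [← ENNReal.ofReal_pow (Real.sqrt_nonneg _), Real.sq_sqrt ha]
  have h1 : ∫⁻ x, ENNReal.ofReal (‖grad (n := n) φ c x‖ / √(mobility K ν x)) ^ 2 ∂(ν : Measure M) =
      ENNReal.ofReal (√(slopeSq n K φ c ν)) ^ 2 := by
    have hcont : Continuous (fun x => ‖grad (n := n) φ c x‖ ^ 2 / mobility K ν x) :=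
      (hgc.pow 2).div hmc fun x => (hpos ν x).ne'
    rw [hsqrt (slopeSq_nonneg hpos φ c ν), slopeSq, ofReal_integral_eq_lintegral_ofReal
      (integrable_of_continuous hcont ν)
      (Eventually.of_forall fun x => div_nonneg (sq_nonneg _) (hpos ν x).le)]
    refine lintegral_congr fun x => ?_
    rw [← ENNReal.ofReal_pow (div_nonneg (norm_nonneg _) (Real.sqrt_nonneg _)), div_pow,
      Real.sq_sqrt (hpos ν x).le]
  have h2 : ∫⁻ x, (ENNReal.ofReal √(mobility K ν x) * ‖w x‖ₑ) ^ 2 ∂(ν : Measure M) =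
      weightedAction K ν w := by
    refine lintegral_congr fun x => ?_
    rw [mul_pow, hsqrt (hpos ν x).le]
  refine (enorm_integral_le_lintegral_enorm _).trans ?_
  have h3 := lintegral_mul_le_sqrt_mul_sqrt (ν : Measure M)
    (f := fun x => ENNReal.ofReal (‖grad (n := n) φ c x‖ / √(mobility K ν x)))
    (g := fun x => ENNReal.ofReal √(mobility K ν x) * ‖w x‖ₑ)
    (hgc.measurable.div (Real.continuous_sqrt.comp hmc).measurable).ennreal_ofReal.aemeasurable
    ((Real.continuous_sqrt.comp hmc).measurable.ennreal_ofReal.mul hwm).aemeasurable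
  rw [h1, h2, ENNReal.sq_sqrt] at h3
  refine le_trans (lintegral_mono fun x => ?_) h3
  have hs : 0 < √(mobility K ν x) := Real.sqrt_pos.2 (hpos ν x)
  rw [← mul_assoc, ← ENNReal.ofReal_mul (div_nonneg (norm_nonneg _) hs.le),
    div_mul_cancel₀ _ hs.ne', ← ofReal_norm (w x), ← ENNReal.ofReal_mul (norm_nonneg _),
    ← ofReal_norm, Real.norm_eq_abs]
  exact ENNReal.ofReal_le_ofReal (abs_spatialDiff_le φ c x _)

theorem IsFlow.enorm_integral_sub_le (hK : Continuous K)
    (hpos : ∀ (ν : ProbabilityMeasure M) x, 0 < mobility K ν x)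
    {μ : ℝ → ProbabilityMeasure M} {v : VelocityField n M} (h : IsFlow μ v)
    {φ : M × ℝ → ℝ} (hφ : IsC1 n φ) (c : ℝ) {s r : ℝ} (hsr : s ≤ r) {B : ℝ}
    (hB : ∀ t ∈ Ioo s r, slopeSq n K φ c (μ t) ≤ B) :
    ‖∫ x, φ (x, c) ∂(μ r : Measure M) - ∫ x, φ (x, c) ∂(μ s : Measure M)‖ₑ ≤
      ENNReal.ofReal √B * ∫⁻ t in Ioo s r, weightedAction K (μ t) (v t) ^ (1 / 2 : ℝ) := by
  rw [h.eq φ hφ c s r, intervalIntegral.integral_of_le hsr, integral_Ioc_eq_integral_Ioo,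
    ← lintegral_const_mul' _ _ ENNReal.ofReal_ne_top]
  refine (enorm_integral_le_lintegral_enorm _).trans (setLIntegral_mono' measurableSet_Ioo
    fun t ht => ?_)
  refine (enorm_integral_spatialDiff_le hK hpos hφ c (μ t)
    (h.measurable.comp measurable_prodMk_left)).trans ?_
  gcongr
  exact hB t ht

/-- The slope bound is needed only on the ball of radius `E₀` around `ν`: a curve from `ν` to `η` of
length below `E₀` never leaves it, by the length estimate applied to its initial pieces. -/
theorem enorm_integral_sub_le_transportDist (hK : Continuous K)
    (hpos : ∀ (ν : ProbabilityMeasure M) x, 0 < mobility K ν x)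
    {φ : M × ℝ → ℝ} (hφ : IsC1 n φ) (c : ℝ) {ν η : ProbabilityMeasure M} {E₀ : ℝ≥0∞} {B : ℝ}
    (hB : ∀ σ, transportDist n K ν σ < E₀ → slopeSq n K φ c σ ≤ B)
    (hη : transportDist n K ν η < E₀) :
    ‖∫ x, φ (x, c) ∂(η : Measure M) - ∫ x, φ (x, c) ∂(ν : Measure M)‖ₑ ≤
      ENNReal.ofReal √B * transportDist n K ν η := by
  have : (𝓝[>] (transportDist n K ν η)).NeBot := nhdsGT_neBot_of_exists_gt ⟨E₀, hη⟩
  have hlim : Tendsto (fun E => ENNReal.ofReal √B * E) (𝓝[>] (transportDist n K ν η))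
      (𝓝 (ENNReal.ofReal √B * transportDist n K ν η)) :=
    (ENNReal.continuous_const_mul ENNReal.ofReal_ne_top).continuousAt.tendsto.mono_left
      nhdsWithin_le_nhds
  refine ge_of_tendsto hlim ?_
  filter_upwards [Ioo_mem_nhdsGT hη] with E hE
  obtain ⟨μ, v, h, h0, h1, hlt⟩ := exists_isFlow_of_transportDist_lt hE.1
  have hle := (lintegral_sqrt_weightedAction_le hK h (s := Ioo 0 1) (by simp)).trans hlt.le
  have hmain := h.enorm_integral_sub_le hK hpos hφ c zero_le_one (B := B) fun t ht => ?_
  · rw [h0 0 le_rfl, h1 1 le_rfl] at hmain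
    exact hmain.trans (by gcongr)
  · refine hB _ (lt_of_le_of_lt ?_ hE.2)
    have := h.transportDist_le hK ht.1.le
    rw [h0 0 le_rfl] at this
    exact this.trans ((lintegral_mono_set (Ioo_subset_Ioo_right ht.2.le)).trans hle)

theorem exists_enorm_integral_sub_le (hK : Continuous K)
    (hpos : ∀ (ν : ProbabilityMeasure M) x, 0 < mobility K ν x)
    {φ : M × ℝ → ℝ} (hφ : IsC1 n φ) (a b : ℝ) :
    ∃ L : ℝ, 0 ≤ L ∧ ∀ c ∈ Icc a b, ∀ ν η : ProbabilityMeasure M,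
      ‖∫ x, φ (x, c) ∂(η : Measure M) - ∫ x, φ (x, c) ∂(ν : Measure M)‖ₑ ≤
      ENNReal.ofReal L * transportDist n K ν η := by
  obtain ⟨B, hB⟩ := ((isCompact_Icc (a := a) (b := b)).prod
    (isCompact_univ (X := ProbabilityMeasure M))).exists_bound_of_continuousOn
    (continuous_slopeSq hK hpos hφ).continuousOn
  -- The `+ 1` makes the constant nonzero, so that its product with an infinite distance is
  -- infinite.
  refine ⟨√B + 1, by positivity, fun c hc ν η => ?_⟩
  rcases eq_or_ne (transportDist n K ν η) ⊤ with h | h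
  · rw [h, ENNReal.mul_top]
    · exact le_top
    · have := Real.sqrt_nonneg B
      simp only [ne_eq, ENNReal.ofReal_eq_zero, not_le]
      linarith
  · refine (enorm_integral_sub_le_transportDist hK hpos hφ c (E₀ := ⊤) (B := B)
      (fun σ _ => ?_) h.lt_top).trans ?_
    · exact (le_abs_self _).trans (hB (c, σ) ⟨hc, mem_univ _⟩)
    · gcongr
      linarith

theorem IsC1.of_space {ψ : M → ℝ} (hψ : ContMDiff (𝓡 n) 𝓘(ℝ, ℝ) 1 ψ) :
    IsC1 n (fun p : M × ℝ => ψ p.1) :=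
  hψ.comp contMDiff_fst

/-- `C¹` functions are uniformly dense among the continuous ones. -/
theorem tendsto_of_forall_contMDiff {ι : Type*} {l : Filter ι} {η : ι → ProbabilityMeasure M}
    {ν : ProbabilityMeasure M}
    (h : ∀ ψ : M → ℝ, ContMDiff (𝓡 n) 𝓘(ℝ, ℝ) 1 ψ →
      Tendsto (fun i => ∫ x, ψ x ∂(η i : Measure M)) l (𝓝 (∫ x, ψ x ∂(ν : Measure M)))) :
    Tendsto η l (𝓝 ν) := by
  rw [ProbabilityMeasure.tendsto_iff_forall_integral_tendsto]
  intro f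
  rw [Metric.tendsto_nhds]
  intro ε hε
  obtain ⟨ψ, hψ, -⟩ := f.continuous.exists_contMDiff_approx (𝓡 n) 1
    (continuous_const (y := ε / 3)) (fun _ => by positivity)
  have hψ1 : ContMDiff (𝓡 n) 𝓘(ℝ, ℝ) 1 ψ := ψ.contMDiff
  have hclose (σ : ProbabilityMeasure M) :
      dist (∫ x, f x ∂(σ : Measure M)) (∫ x, ψ x ∂(σ : Measure M)) ≤ ε / 3 := by
    rw [dist_eq_norm, ← integral_sub (integrable_of_continuous f.continuous σ)
      (integrable_of_continuous hψ1.continuous σ)]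
    refine (norm_integral_le_of_norm_le_const (C := ε / 3)
      (Eventually.of_forall fun x => ?_)).trans (by simp)
    rw [← dist_eq_norm, dist_comm]
    exact (hψ x).le
  filter_upwards [Metric.tendsto_nhds.1 (h ψ hψ1) (ε / 3) (by positivity)] with i hi
  have h1 := hclose (η i)
  have h2 := hclose ν
  have h3 := dist_triangle4 (∫ x, f x ∂(η i : Measure M)) (∫ x, ψ x ∂(η i : Measure M))
    (∫ x, ψ x ∂(ν : Measure M)) (∫ x, f x ∂(ν : Measure M))
  rw [dist_comm (∫ x, ψ x ∂(ν : Measure M))] at h3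
  linarith

theorem tendsto_of_tendsto_transportDist (hK : Continuous K)
    (hpos : ∀ (ν : ProbabilityMeasure M) x, 0 < mobility K ν x)
    {ι : Type*} {l : Filter ι} {η : ι → ProbabilityMeasure M} {ν : ProbabilityMeasure M}
    (h : Tendsto (fun i => transportDist n K ν (η i)) l (𝓝 0)) : Tendsto η l (𝓝 ν) := by
  refine tendsto_of_forall_contMDiff (n := n) fun ψ hψ => ?_
  obtain ⟨L, -, hL⟩ := exists_enorm_integral_sub_le hK hpos (IsC1.of_space hψ) 0 0
  rw [tendsto_iff_edist_tendsto_0]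
  have hlim : Tendsto (fun i => ENNReal.ofReal L * transportDist n K ν (η i)) l (𝓝 0) := by
    have := ENNReal.Tendsto.const_mul h (Or.inr (ENNReal.ofReal_ne_top (r := L)))
    rwa [mul_zero] at this
  refine tendsto_of_tendsto_of_tendsto_of_le_of_le tendsto_const_nhds hlim (fun _ => bot_le)
    fun i => ?_
  rw [edist_eq_enorm_sub]
  exact hL 0 (by simp) ν (η i)

/-- Convergence in distance implies narrow convergence and the slope is narrowly continuous, so on a
small ball around `ν` the squared slope exceeds its value at `ν` by at most `ε`. -/
theorem exists_slope_estimate (hK : Continuous K)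
    (hpos : ∀ (ν : ProbabilityMeasure M) x, 0 < mobility K ν x)
    {φ : M × ℝ → ℝ} (hφ : IsC1 n φ) (c : ℝ) (ν : ProbabilityMeasure M) {ε : ℝ} (hε : 0 < ε) :
    ∃ δ : ℝ≥0∞, 0 < δ ∧ ∀ η, transportDist n K ν η < δ →
      ‖∫ x, φ (x, c) ∂(η : Measure M) - ∫ x, φ (x, c) ∂(ν : Measure M)‖ₑ ≤
        ENNReal.ofReal √(slopeSq n K φ c ν + ε) * transportDist n K ν η := by
  have h1 : Tendsto (id : ProbabilityMeasure M → _)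
      (comap (fun η => transportDist n K ν η) (𝓝 0)) (𝓝 ν) :=
    tendsto_of_tendsto_transportDist hK hpos tendsto_comap
  have h2 : ∀ᶠ σ in 𝓝 ν, slopeSq n K φ c σ < slopeSq n K φ c ν + ε :=
    ((continuous_slopeSq hK hpos hφ).comp
      (continuous_const.prodMk continuous_id)).continuousAt.eventually_lt continuousAt_const
      (show slopeSq n K φ c ν < slopeSq n K φ c ν + ε by linarith)
  obtain ⟨δ, hδ, hδ'⟩ := ((ENNReal.nhds_zero_basis.comap _).eventually_iff).1 (h1.eventually h2)
  exact ⟨δ, hδ, fun η hη => enorm_integral_sub_le_transportDist hK hpos hφ c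
    (fun σ hσ => (hδ' hσ).le) hη⟩

end Slope

/-! ### Metric derivatives of absolutely continuous curves -/

section MetricDerivative

theorem AbsolutelyContinuousOnInterval.of_dist_le {X Y : Type*} [PseudoMetricSpace X]
    [PseudoMetricSpace Y] {f : ℝ → X} {g : ℝ → Y} {a b : ℝ}
    (hg : AbsolutelyContinuousOnInterval g a b) (h : ∀ s r, dist (f s) (f r) ≤ dist (g s) (g r)) :
    AbsolutelyContinuousOnInterval f a b := by
  refine squeeze_zero (fun E => Finset.sum_nonneg fun i _ => dist_nonneg)
    (fun E => Finset.sum_le_sum fun i _ => ?_) hg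
  exact h _ _

theorem tendsto_abs_slope {f : ℝ → ℝ} {f' t : ℝ} (h : HasDerivAt f f' t) :
    Tendsto (fun u => |f (t + u) - f t| / |u|) (𝓝[≠] 0) (𝓝 |f'|) := by
  refine (hasDerivAt_iff_tendsto_slope_zero.1 h).abs.congr fun u => ?_
  rw [smul_eq_mul, abs_mul, abs_inv, inv_mul_eq_div]

/-- The metric derivative is the supremum of `|f_k'|`, where `f_k` is the distance to the curve at
the `k`-th of a dense sequence of times. Each `f_k` bounds the difference quotients from below; the
bound of `D` by the integral of the supremum, with Lebesgue differentiation, bounds them from above.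
-/
theorem exists_metricDeriv_of_real {D : ℝ → ℝ → ℝ} (hself : ∀ s, D s s = 0)
    (hsymm : ∀ s r, D s r = D r s) (htri : ∀ s r u, D s u ≤ D s r + D r u)
    {g : ℝ → ℝ} (hg : Integrable g) (hg0 : ∀ t, 0 ≤ g t)
    (hD : ∀ s r, s ≤ r → D s r ≤ ∫ t in s..r, g t) :
    ∃ ρ : ℝ → ℝ, Measurable ρ ∧ (∀ t, 0 ≤ ρ t) ∧ Integrable ρ ∧
      (∀ s r, s ≤ r → D s r ≤ ∫ t in s..r, ρ t) ∧
      ∀ᵐ t, Tendsto (fun h => D (t + h) t / |h|) (𝓝[≠] 0) (𝓝 (ρ t)) := by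
  have hnn : ∀ s r, 0 ≤ D s r := fun s r => by
    have h1 := htri s r s
    rw [hself, hsymm r s] at h1
    linarith
  have key : ∀ {g : ℝ → ℝ}, Integrable g → (∀ s r, s ≤ r → D s r ≤ ∫ t in s..r, g t) →
      ∀ s r, D s r ≤ |(∫ t in (0 : ℝ)..s, g t) - ∫ t in (0 : ℝ)..r, g t| := by
    intro g hg hD s r
    rcases le_total s r with h | h
    · rw [abs_sub_comm, intervalIntegral.integral_interval_sub_left hg.intervalIntegrable
        hg.intervalIntegrable]
      exact (hD s r h).trans (le_abs_self _)
    · rw [intervalIntegral.integral_interval_sub_left hg.intervalIntegrable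
        hg.intervalIntegrable, hsymm]
      exact (hD r s h).trans (le_abs_self _)
  set G : ℝ → ℝ := fun x => ∫ t in (0 : ℝ)..x, g t with hGdef
  have hDG := key hg hD
  have hGc : Continuous G := intervalIntegral.continuous_primitive
    (fun a b => hg.intervalIntegrable) 0
  let q : ℕ → ℝ := TopologicalSpace.denseSeq ℝ
  let f : ℕ → ℝ → ℝ := fun k t => D t (q k)
  have hfD : ∀ k s r, |f k s - f k r| ≤ D s r := fun k s r => by
    rw [abs_le]
    have h1 := htri s r (q k)
    have h2 := htri r s (q k)
    rw [hsymm r s] at h2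
    constructor <;> simp only [f] <;> linarith
  have hac : ∀ k a b, AbsolutelyContinuousOnInterval (f k) a b := fun k a b => by
    have hmem : ∀ x, |x| ≤ max |a| |b| → x ∈ uIcc (-max |a| |b|) (max |a| |b|) := fun x hx => by
      rw [uIcc_of_le (by linarith [(abs_nonneg x).trans hx])]
      exact abs_le.1 hx
    refine AbsolutelyContinuousOnInterval.of_dist_le
      ((hg.intervalIntegrable.absolutelyContinuousOnInterval_intervalIntegral
        (hmem 0 (by simp))).mono
        (uIcc_subset_uIcc (hmem a (le_max_left _ _)) (hmem b (le_max_right _ _))))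
      (fun s r => (hfD k s r).trans (hDG s r))
  have hdiff : ∀ᵐ t, ∀ k, DifferentiableAt ℝ (f k) t := by
    refine ae_all_iff.2 fun k => ?_
    have : ∀ᵐ t, ∀ N : ℕ, t ∈ uIcc (-(N : ℝ)) N → DifferentiableAt ℝ (f k) t :=
      ae_all_iff.2 fun N => (hac k _ _).ae_differentiableAt
    filter_upwards [this] with t ht
    obtain ⟨N, hN⟩ := exists_nat_ge |t|
    refine ht N ?_
    rw [uIcc_of_le (by linarith [(abs_nonneg t).trans hN])]
    exact abs_le.1 hN
  have hbound : ∀ᵐ t, ∀ k, |deriv (f k) t| ≤ g t := by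
    filter_upwards [hdiff, LocallyIntegrable.ae_hasDerivAt_integral hg.locallyIntegrable] with t h1 h2 k
    have h3 := tendsto_abs_slope (h2 0)
    rw [abs_of_nonneg (hg0 t)] at h3
    refine le_of_tendsto_of_tendsto (tendsto_abs_slope (h1 k).hasDerivAt) h3
      (Eventually.of_forall fun u => ?_)
    exact div_le_div_of_nonneg_right ((hfD k _ _).trans (hDG _ _)) (abs_nonneg u)
  let R : ℝ → ℝ≥0∞ := fun t => ⨆ k, ENNReal.ofReal |deriv (f k) t|
  have hRm : Measurable R := .iSup fun k => (measurable_deriv (f k)).abs.ennreal_ofReal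
  have hRg : ∀ᵐ t, R t ≤ ENNReal.ofReal (g t) := by
    filter_upwards [hbound] with t ht
    exact iSup_le fun k => ENNReal.ofReal_le_ofReal (ht k)
  have hRle : ∀ᵐ t, ∀ k, |deriv (f k) t| ≤ (R t).toReal := by
    filter_upwards [hRg] with t ht k
    refine (ENNReal.ofReal_le_iff_le_toReal (ht.trans_lt ENNReal.ofReal_lt_top).ne).1 ?_
    exact le_iSup (fun k => ENNReal.ofReal |deriv (f k) t|) k
  have hρint : Integrable (fun t => (R t).toReal) := by
    refine hg.mono' hRm.ennreal_toReal.aestronglyMeasurable ?_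
    filter_upwards [hRg] with t ht
    rw [Real.norm_of_nonneg ENNReal.toReal_nonneg]
    exact ENNReal.toReal_le_of_le_ofReal (hg0 t) ht
  -- For `q k` close to `s` the increment of `f k` over `[s,r]` is within `ε` of `D s r`, and it is
  -- the integral of `deriv (f k)`.
  have hρ : ∀ s r, s ≤ r → D s r ≤ ∫ t in s..r, (R t).toReal := fun s r hsr => by
    refine le_of_forall_pos_le_add fun ε hε => ?_
    obtain ⟨k, hk⟩ := (TopologicalSpace.denseRange_denseSeq ℝ).exists_mem_open
      (isOpen_lt (hGc.sub (continuous_const (y := G s))).abs (continuous_const (y := ε / 2)))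
      ⟨s, by simpa using hε⟩
    have h1 : f k s < ε / 2 := by
      refine lt_of_le_of_lt ((hDG _ _).trans_eq (abs_sub_comm _ _)) hk
    have h2 : f k r - f k s ≤ ∫ t in s..r, (R t).toReal := by
      rw [← (hac k s r).integral_deriv_eq_sub]
      refine intervalIntegral.integral_mono_ae hsr (hac k s r).intervalIntegrable_deriv
        hρint.intervalIntegrable ?_
      filter_upwards [hRle] with t ht using (le_abs_self _).trans (ht k)
    have h3 := htri s (q k) r
    rw [hsymm (q k) r] at h3
    simp only [f] at h1 h2
    linarith
  refine ⟨fun t => (R t).toReal, hRm.ennreal_toReal, fun t => ENNReal.toReal_nonneg, hρint, hρ, ?_⟩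
  filter_upwards [hdiff, hRg, LocallyIntegrable.ae_hasDerivAt_integral hρint.locallyIntegrable] with t h1 h2 h3
  have hRt : R t ≠ ⊤ := (h2.trans_lt ENNReal.ofReal_lt_top).ne
  refine tendsto_order.2 ⟨fun a ha => ?_, fun b hb => ?_⟩
  · rcases lt_or_ge a 0 with ha0 | ha0
    · exact Eventually.of_forall fun h => ha0.trans_le (div_nonneg (hnn _ _) (abs_nonneg _))
    · have ha' : ENNReal.ofReal a < R t := (ENNReal.ofReal_lt_iff_lt_toReal ha0 hRt).2 ha
      obtain ⟨k, hk⟩ := lt_iSup_iff.1 ha'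
      have hk' : a < |deriv (f k) t| := (ENNReal.ofReal_lt_ofReal_iff_of_nonneg ha0).1 hk
      filter_upwards [(tendsto_abs_slope (h1 k).hasDerivAt).eventually (lt_mem_nhds hk')] with h hh
      exact hh.trans_le (div_le_div_of_nonneg_right (hfD k _ _) (abs_nonneg _))
  · have h4 := tendsto_abs_slope (h3 0)
    rw [abs_of_nonneg ENNReal.toReal_nonneg] at h4
    filter_upwards [h4.eventually (gt_mem_nhds hb)] with h hh
    exact lt_of_le_of_lt (div_le_div_of_nonneg_right (key hρint hρ _ _) (abs_nonneg _)) hh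

/-- An absolutely continuous curve has a metric derivative almost everywhere, and the metric
derivative is an admissible control in the definition of absolute continuity. -/
theorem IsAbsContCurve.exists_metricDeriv {X : Type*} {d : X → X → ℝ≥0∞} (hself : ∀ x, d x x = 0)
    (hsymm : ∀ x y, d x y = d y x) (htri : ∀ x y z, d x z ≤ d x y + d y z)
    {T : ℝ} (hT : 0 < T) {γ : ℝ → X} (hγ : IsAbsContCurve d T γ) :
    ∃ ρ : ℝ → ℝ, Measurable ρ ∧ (∀ t, 0 ≤ ρ t) ∧ Integrable ρ ∧
      (∀ s ∈ Icc 0 T, ∀ r ∈ Icc 0 T, s ≤ r →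
        d (γ s) (γ r) ≤ ENNReal.ofReal (∫ t in s..r, ρ t)) ∧
      ∀ᵐ t ∂(volume.restrict (Ioo 0 T)), HasMetricDerivAt d γ t (ENNReal.ofReal (ρ t)) := by
  obtain ⟨g, hg, hd⟩ := hγ
  -- Clamping extends the curve by constants to all of `ℝ`, at the price of a control supported in
  -- `(0,T)`. All distances along the extended curve are finite, so the real-valued statement
  -- applies.
  let c : ℝ → ℝ := fun t => max 0 (min t T)
  have hc : ∀ t, c t ∈ Icc 0 T := fun t => ⟨le_max_left _ _, max_le hT.le (min_le_right _ _)⟩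
  have hcm : Monotone c := fun s t h => max_le_max le_rfl (min_le_min_right _ h)
  have hceq : ∀ t ∈ Icc 0 T, c t = t := fun t ht => by
    simp [c, min_eq_left ht.2, max_eq_right ht.1]
  let gI : ℝ → ℝ := (Ioo 0 T).indicator fun t => |g t|
  have hgI : Integrable gI := IntegrableOn.integrable_indicator (Integrable.abs hg) measurableSet_Ioo
  have hgI0 : ∀ t, 0 ≤ gI t := fun t => indicator_nonneg (fun t _ => abs_nonneg _) t
  have hcG : ∀ t, ∫ u in (0 : ℝ)..c t, gI u = ∫ u in (0 : ℝ)..t, gI u := by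
    intro t
    rw [← sub_eq_zero, intervalIntegral.integral_interval_sub_left hgI.intervalIntegrable
      hgI.intervalIntegrable]
    rw [intervalIntegral.integral_congr_ae (g := fun _ => 0), intervalIntegral.integral_zero]
    refine Eventually.of_forall fun u hu => indicator_of_notMem (fun hu' => ?_) _
    rcases le_total t 0 with h0 | h0
    · have : c t = 0 := by simp [c, h0]
      rw [this, uIoc_of_le h0] at hu
      exact absurd hu.2 (not_le.2 hu'.1)
    rcases le_total t T with h1 | h1
    · simp [hceq t ⟨h0, h1⟩] at hu
    · have : c t = T := by simp [c, h1, hT.le]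
      rw [this, uIoc_of_ge h1] at hu
      exact absurd hu.1 (not_lt.2 hu'.2.le)
  have hle : ∀ s r, s ≤ r → d (γ (c s)) (γ (c r)) ≤ ENNReal.ofReal (∫ t in s..r, gI t) := by
    intro s r hsr
    refine (hd _ (hc s) _ (hc r) (hcm hsr)).trans (ENNReal.ofReal_le_ofReal ?_)
    have h1 : ∫ t in s..r, gI t = ∫ t in c s..c r, gI t := by
      have h2 : ∀ x y, ∫ t in x..y, gI t = (∫ t in (0 : ℝ)..y, gI t) - ∫ t in (0 : ℝ)..x, gI t :=
        fun x y => (intervalIntegral.integral_interval_sub_left hgI.intervalIntegrable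
          hgI.intervalIntegrable).symm
      rw [h2 s r, h2 (c s), hcG, hcG]
    rw [h1, intervalIntegral.integral_of_le (hcm hsr), intervalIntegral.integral_of_le (hcm hsr),
      integral_Ioc_eq_integral_Ioo, integral_Ioc_eq_integral_Ioo]
    have hsub : Ioo (c s) (c r) ⊆ Ioo 0 T := Ioo_subset_Ioo (hc s).1 (hc r).2
    refine setIntegral_mono_on (hg.mono_set hsub) hgI.integrableOn measurableSet_Ioo
      fun t ht => ?_
    rw [show gI t = |g t| from indicator_of_mem (hsub ht) _]
    exact le_abs_self _
  have hfin : ∀ s r, d (γ (c s)) (γ (c r)) ≠ ⊤ := by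
    intro s r
    rcases le_total s r with h | h
    · exact ((hle s r h).trans_lt ENNReal.ofReal_lt_top).ne
    · rw [hsymm]
      exact ((hle r s h).trans_lt ENNReal.ofReal_lt_top).ne
  obtain ⟨ρ, hρm, hρ0, hρi, hρd, hρt⟩ := exists_metricDeriv_of_real
    (D := fun s r => (d (γ (c s)) (γ (c r))).toReal) (fun s => by simp [hself])
    (fun s r => by rw [hsymm])
    (fun s r u => by
      rw [← ENNReal.toReal_add (hfin _ _) (hfin _ _)]
      exact ENNReal.toReal_mono (ENNReal.add_ne_top.2 ⟨hfin _ _, hfin _ _⟩) (htri _ _ _))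
    hgI hgI0 (fun s r h => ENNReal.toReal_le_of_le_ofReal
      (intervalIntegral.integral_nonneg h fun t _ => hgI0 t) (hle s r h))
  refine ⟨ρ, hρm, hρ0, hρi, fun s hs r hr hsr => ?_, ?_⟩
  · have := hρd s r hsr
    rw [hceq s hs, hceq r hr] at this
    refine (ENNReal.le_ofReal_iff_toReal_le ?_ ?_).2 this
    · simpa [hceq s hs, hceq r hr] using hfin s r
    · exact intervalIntegral.integral_nonneg hsr fun t _ => hρ0 t
  · filter_upwards [ae_restrict_of_ae hρt, ae_restrict_mem measurableSet_Ioo] with t ht htT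
    have h1 := (ENNReal.continuous_ofReal.tendsto _).comp ht
    refine h1.congr' ?_
    have hev : ∀ᶠ h in 𝓝 (0 : ℝ), t + h ∈ Ioo 0 T := by
      have : Tendsto (fun h => t + h) (𝓝 (0 : ℝ)) (𝓝 t) := by
        simpa using ((by fun_prop : Continuous fun h : ℝ => t + h).tendsto 0)
      exact this.eventually (isOpen_Ioo.mem_nhds htT)
    filter_upwards [self_mem_nhdsWithin, nhdsWithin_le_nhds hev] with h hh hth
    rw [Function.comp_apply, ENNReal.ofReal_div_of_pos (abs_pos.2 hh),
      ENNReal.ofReal_toReal (hfin _ _), hceq t (Ioo_subset_Icc_self htT),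
      hceq _ (Ioo_subset_Icc_self hth)]

/-! ### Curves whose increments are bounded by an integral -/

section Control

variable {X : Type*} {d : X → X → ℝ≥0∞} {T : ℝ} {γ : ℝ → X} {f : ℝ → ℝ≥0∞}

theorem lintegral_Ioo_eq_ofReal_intervalIntegral (hf : Measurable f)
    (hfin : ∫⁻ t in Ioo 0 T, f t < ⊤) {s r : ℝ} (hs : 0 ≤ s) (hr : r ≤ T) (hsr : s ≤ r) :
    ∫⁻ t in Ioo s r, f t = ENNReal.ofReal (∫ t in s..r, (f t).toReal) := by
  have hlt : ∫⁻ t in Ioo s r, f t ≠ ⊤ :=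
    ((lintegral_mono_set (Ioo_subset_Ioo hs hr)).trans_lt hfin).ne
  rw [intervalIntegral.integral_of_le hsr, integral_Ioc_eq_integral_Ioo,
    ofReal_integral_eq_lintegral_ofReal
      (integrable_toReal_of_lintegral_ne_top hf.aemeasurable hlt)
      (Eventually.of_forall fun t => ENNReal.toReal_nonneg)]
  exact lintegral_congr_ae (ofReal_toReal_ae_eq (ae_lt_top hf hlt)).symm

theorem isAbsContCurve_of_le_lintegral (hf : Measurable f) (hfin : ∫⁻ t in Ioo 0 T, f t < ⊤)
    (hd : ∀ s ∈ Icc 0 T, ∀ r ∈ Icc 0 T, s ≤ r → d (γ s) (γ r) ≤ ∫⁻ t in Ioo s r, f t) :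
    IsAbsContCurve d T γ :=
  ⟨fun t => (f t).toReal, integrable_toReal_of_lintegral_ne_top hf.aemeasurable hfin.ne,
    fun s hs r hr hsr => (hd s hs r hr hsr).trans_eq
      (lintegral_Ioo_eq_ofReal_intervalIntegral hf hfin hs.1 hr.2 hsr)⟩

/-- Lebesgue differentiation of the bound; since the two-sided limit exists, difference quotients
from the right suffice. -/
theorem HasMetricDerivAt.ae_le_of_le_lintegral (hT : 0 < T)
    (hsymm : ∀ x y, d x y = d y x) (hf : Measurable f) (hfin : ∫⁻ t in Ioo 0 T, f t < ⊤)
    (hd : ∀ s ∈ Icc 0 T, ∀ r ∈ Icc 0 T, s ≤ r → d (γ s) (γ r) ≤ ∫⁻ t in Ioo s r, f t)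
    {L : ℝ → ℝ≥0∞} (hL : ∀ᵐ t ∂(volume.restrict (Ioo 0 T)), HasMetricDerivAt d γ t (L t)) :
    ∀ᵐ t ∂(volume.restrict (Ioo 0 T)), L t ≤ f t := by
  have hint : IntegrableOn (fun t => (f t).toReal) (Ioo 0 T) :=
    integrable_toReal_of_lintegral_ne_top hf.aemeasurable hfin.ne
  have hint' : IntervalIntegrable (fun t => (f t).toReal) volume 0 T := by
    rw [intervalIntegrable_iff_integrableOn_Ioo_of_le hT.le]; exact hint
  filter_upwards [hL, ae_lt_top hf hfin.ne, ae_restrict_mem measurableSet_Ioo,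
    ae_restrict_of_ae (IntervalIntegrable.ae_hasDerivAt_integral hint')] with t h1 h2 h3 h4
  have h5 := h4 (by rw [uIcc_of_le hT.le]; exact Ioo_subset_Icc_self h3) 0 left_mem_uIcc
  have h6 := (ENNReal.continuous_ofReal.tendsto _).comp
    ((tendsto_abs_slope h5).mono_left (nhdsGT_le_nhdsNE 0))
  rw [abs_of_nonneg ENNReal.toReal_nonneg, ENNReal.ofReal_toReal h2.ne] at h6
  refine le_of_tendsto_of_tendsto (h1.mono_left (nhdsGT_le_nhdsNE 0)) h6 ?_
  filter_upwards [Ioo_mem_nhdsGT (show 0 < T - t by linarith [h3.2])] with h hh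
  have hmem : t + h ∈ Icc 0 T := ⟨by linarith [h3.1, hh.1], by linarith [hh.2]⟩
  have hle : t ≤ t + h := by linarith [hh.1]
  have hsub (a b : ℝ) (ha : a ∈ Icc 0 T) (hb : b ∈ Icc 0 T) :
      IntervalIntegrable (fun t => (f t).toReal) volume a b :=
    hint'.mono_set (uIcc_subset_uIcc (by rwa [uIcc_of_le hT.le]) (by rwa [uIcc_of_le hT.le]))
  have ht : t ∈ Icc 0 T := Ioo_subset_Icc_self h3
  have h0 : (0 : ℝ) ∈ Icc 0 T := left_mem_Icc.2 hT.le
  rw [Function.comp_apply, intervalIntegral.integral_interval_sub_left (hsub _ _ h0 hmem)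
    (hsub _ _ h0 ht), ENNReal.ofReal_div_of_pos (abs_pos.2 hh.1.ne'), hsymm]
  gcongr
  rw [abs_of_nonneg (intervalIntegral.integral_nonneg hle fun _ _ => ENNReal.toReal_nonneg),
    ← lintegral_Ioo_eq_ofReal_intervalIntegral hf hfin h3.1.le hmem.2 hle]
  exact hd t ht _ hmem hle

end Control

end MetricDerivative

/-! ### The tangent velocity field of an absolutely continuous curve -/

section Minimization

variable {V : Type*} [AddCommGroup V] [Module ℝ V]

/-- Approximate Riesz representation of a functional that is bounded with respect to a positive
semidefinite form. -/
theorem exists_seq_tendsto_of_bounded (B : V →ₗ[ℝ] V →ₗ[ℝ] ℝ) (hsymm : ∀ x y, B x y = B y x)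
    (hnn : ∀ x, 0 ≤ B x x) (Λ : V →ₗ[ℝ] ℝ) {R : ℝ} (hΛ : ∀ x, |Λ x| ≤ √R * √(B x x)) :
    ∃ x : ℕ → V, (∀ k, B (x (k + 1) - x k) (x (k + 1) - x k) ≤ (1 / 4) ^ k) ∧
      (∀ k, √(B (x k) (x k)) ≤ √R + (1 / 2) ^ k) ∧
      ∀ y, Tendsto (fun k => B (x k) y) atTop (𝓝 (Λ y)) := by
  -- The sequence minimizes the energy whose Euler–Lagrange equation is `B x · = Λ`. The space need
  -- not be complete, so only approximate solutions are obtained.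
  let J : V → ℝ := fun x => B x x / 2 - Λ x
  have hbdd : BddBelow (range J) := by
    refine ⟨-(√R) ^ 2 / 2, ?_⟩
    rintro _ ⟨x, rfl⟩
    have h1 := (abs_le.1 (hΛ x)).2
    have h2 := Real.sq_sqrt (hnn x)
    simp only [J]
    nlinarith [sq_nonneg (√R - √(B x x))]
  have hinf : ∀ y, iInf J ≤ J y := fun y => ciInf_le hbdd y
  have hex : ∀ k : ℕ, ∃ x, J x < iInf J + (1 / 4) ^ k / 8 := fun k =>
    exists_lt_of_ciInf_lt (lt_add_of_pos_right _ (by positivity))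
  choose x hx using hex
  -- Near-minimality along the line `x k + s • y` says that a quadratic in `s` is nonnegative. Its
  -- discriminant gives the approximate equation, and the tolerance `(1/4)^k / 8` yields exactly
  -- this constant.
  have hvar : ∀ k y, |B (x k) y - Λ y| ≤ (1 / 2) ^ (k + 1) * √(B y y) := by
    intro k y
    have hquad : ∀ s : ℝ, 0 ≤ (B y y / 2) * (s * s) + (B (x k) y - Λ y) * s + (1 / 4) ^ k / 8 := by
      intro s
      have h1 := hinf (x k + s • y)
      have h2 := hx k
      simp only [J, map_add, map_smul, LinearMap.add_apply, LinearMap.smul_apply,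
        smul_eq_mul, hsymm y (x k)] at h1 h2
      nlinarith
    have hdisc := discrim_le_zero hquad
    rw [discrim] at hdisc
    refine abs_le_of_sq_le_sq ?_ (by positivity)
    rw [mul_pow, Real.sq_sqrt (hnn y), ← pow_mul, mul_comm (k + 1), pow_mul]
    norm_num [pow_succ] at hdisc ⊢
    nlinarith
  refine ⟨x, fun k => ?_, fun k => ?_, fun y => ?_⟩
  -- Parallelogram identity: the average energy of two points exceeds the energy of their midpoint
  -- by `B(x - y, x - y) / 8`.
  · have h1 := hinf ((1 / 2 : ℝ) • (x (k + 1) + x k))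
    have h2 := hx k
    have h3 := hx (k + 1)
    simp only [J, map_add, map_smul, LinearMap.add_apply, LinearMap.smul_apply,
      smul_eq_mul, map_sub, LinearMap.sub_apply, hsymm (x k) (x (k + 1)), pow_succ] at h1 h2 h3 ⊢
    have : (0 : ℝ) < (1 / 4) ^ k := by positivity
    nlinarith
  · rcases (Real.sqrt_nonneg (B (x k) (x k))).eq_or_lt with h0 | h0
    · rw [← h0]; positivity
    · have h1 := (abs_le.1 (hvar k (x k))).2
      have h2 := (abs_le.1 (hΛ (x k))).2
      have h3 := Real.sq_sqrt (hnn (x k))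
      have h4 : √(B (x k) (x k)) ^ 2 ≤ (√R + (1 / 2) ^ k) * √(B (x k) (x k)) := by
        have : (0 : ℝ) < (1 / 2) ^ k := by positivity
        rw [pow_succ] at h1
        nlinarith
      rw [sq] at h4
      exact le_of_mul_le_mul_right h4 h0
  · rw [tendsto_iff_dist_tendsto_zero]
    refine squeeze_zero (fun _ => dist_nonneg) (fun k => hvar k y) ?_
    have := ((tendsto_pow_atTop_nhds_zero_of_lt_one (r := (1 / 2 : ℝ)) (by norm_num)
      (by norm_num)).comp (tendsto_add_atTop_nat 1)).mul_const √(B y y)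
    simpa using this

end Minimization

/-! ### The time derivative of an absolutely continuous curve as a bounded functional -/

section TimeDerivativeBound

variable {n : ℕ} {M : Type*} [TopologicalSpace M] [T2Space M] [CompactSpace M]
    [SecondCountableTopology M]
    [ChartedSpace (EuclideanSpace ℝ (Fin n)) M] [IsManifold (𝓡 n) ∞ M]
    [RiemannianBundle (fun x : M => TangentSpace (𝓡 n) x)]
    [IsContMDiffRiemannianBundle (𝓡 n) ∞ (EuclideanSpace ℝ (Fin n))
      (fun x : M => TangentSpace (𝓡 n) x)]
    [MeasurableSpace M] [BorelSpace M]

variable {K : M × M → ℝ}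

theorem continuous_slopeSq_curve (hK : Continuous K)
    (hpos : ∀ (ν : ProbabilityMeasure M) x, 0 < mobility K ν x)
    {μ : ℝ → ProbabilityMeasure M} (hμ : Continuous μ) {φ : M × ℝ → ℝ} (hφ : IsC1 n φ) :
    Continuous (fun t => slopeSq n K φ t (μ t)) :=
  (continuous_slopeSq hK hpos hφ).comp (continuous_id.prodMk hμ)

/-- A curve whose increments are controlled by `∫ ρ` satisfies a weak form of the continuity
equation with fluxes controlled by `ρ`. -/
theorem abs_integral_deriv_time_le (hK : Continuous K)
    (hpos : ∀ (ν : ProbabilityMeasure M) x, 0 < mobility K ν x)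
    {μ : ℝ → ProbabilityMeasure M} (hμ : Continuous μ) {ρ : ℝ → ℝ} (hρ0 : ∀ t, 0 ≤ ρ t)
    (hρ : Integrable ρ) {T : ℝ} (hT : 0 < T)
    (hd : ∀ s ∈ Icc 0 T, ∀ r ∈ Icc 0 T, s ≤ r →
      transportDist n K (μ s) (μ r) ≤ ENNReal.ofReal (∫ t in s..r, ρ t))
    {φ : M × ℝ → ℝ} (hφ : IsTestFunction n T φ) :
    |∫ t in (0 : ℝ)..T, ∫ x, deriv (fun s => φ (x, s)) t ∂(μ t : Measure M)| ≤
      ∫ t in (0 : ℝ)..T, ρ t * √(slopeSq n K φ t (μ t)) := by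
  have hφ1 : IsC1 n φ := hφ.contMDiff
  set J : ℝ → ℝ := fun t => slopeSq n K φ t (μ t) with hJ
  have hJc : Continuous J := continuous_slopeSq_curve hK hpos hμ hφ1
  set P : ℝ → ℝ := fun r => ∫ x, deriv (fun s => φ (x, s)) r ∂(μ r : Measure M) with hP
  have hPc : Continuous P := continuous_integral_curve hμ (continuous_deriv_time hφ1)
  have hii : ∀ (c : ℝ → ℝ) (a b : ℝ), Continuous c →
      IntervalIntegrable (fun t => ρ t * c t) volume a b := fun c a b hc =>
    hρ.intervalIntegrable.mul_continuousOn hc.continuousOn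
  have hprim : Continuous (fun t => ∫ u in (0 : ℝ)..t, ρ u) :=
    intervalIntegral.continuous_primitive (fun a b => hρ.intervalIntegrable) 0
  have main : ∀ ε > 0, |∫ t in (0 : ℝ)..T, P t| ≤
      (∫ t in (0 : ℝ)..T, ρ t * √(J t)) + (√(2 * ε) * (∫ t in (0 : ℝ)..T, ρ t) + ε * T) := by
    intro ε hε
    have hsc : Continuous (fun t => √(J t + 2 * ε)) := (hJc.add continuous_const).sqrt
    let D : ℝ → ℝ := fun t => (∫ x, φ (x, t) ∂(μ t : Measure M)) - ∫ u in (0 : ℝ)..t, P u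
    let N : ℝ → ℝ := fun t => (∫ u in (0 : ℝ)..t, ρ u * √(J u + 2 * ε)) + ε * t
    have hDc : Continuous D := (continuous_integral_curve hμ hφ1.continuous).sub
      (intervalIntegral.continuous_primitive (fun a b => hPc.intervalIntegrable a b) 0)
    have hNc : Continuous N := (intervalIntegral.continuous_primitive
      (fun a b => hii _ a b hsc) 0).add (continuous_const.mul continuous_id)
    have hloc := abs_sub_le_sub_of_eventually_right hT.le hDc.continuousOn hNc.continuousOn
      fun t ht => by
        obtain ⟨δ, hδ, hslope⟩ := exists_slope_estimate hK hpos hφ1 t (μ t) hε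
        have e1 := eventually_abs_integral_sub_le hφ1 hμ t hε
        have e2 : ∀ᶠ u in 𝓝[>] t, ENNReal.ofReal (∫ r in t..u, ρ r) < δ := by
          have hc : Continuous (fun u => ∫ r in t..u, ρ r) :=
            intervalIntegral.continuous_primitive (fun a b => hρ.intervalIntegrable) t
          have := (ENNReal.continuous_ofReal.comp hc).tendsto t
          simp only [Function.comp_apply, intervalIntegral.integral_same,
            ENNReal.ofReal_zero] at this
          exact nhdsWithin_le_nhds (this.eventually (gt_mem_nhds hδ))
        -- Continuity of the slope along the curve lets the bound `√(J t + ε)`, frozen at `t`, be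
        -- replaced by `√(J r + 2ε)` under the integral, which is additive over intervals.
        have e3 : ∀ᶠ u in 𝓝[>] t, ∀ r ∈ Icc t u, J t - ε < J r := by
          have h1 : ∀ᶠ r in 𝓝[≥] t, J t - ε < J r :=
            nhdsWithin_le_nhds (hJc.continuousAt.eventually (lt_mem_nhds (by linarith)))
          obtain ⟨b, hb, hsub⟩ := mem_nhdsGE_iff_exists_Ico_subset.1 h1
          filter_upwards [Ioo_mem_nhdsGT hb] with u hu r hr
          exact hsub ⟨hr.1, hr.2.trans_lt hu.2⟩
        filter_upwards [e1, e2, e3, Ioo_mem_nhdsGT ht.2] with u h1 h2 h3 hu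
        have htu : t ≤ u := hu.1.le
        have hW := hd t ⟨ht.1, ht.2.le⟩ u ⟨ht.1.trans htu, hu.2.le⟩ htu
        have h4 := (hslope (μ u) (hW.trans_lt h2)).trans (mul_le_mul_right hW _)
        rw [← ENNReal.ofReal_mul (Real.sqrt_nonneg _), Real.enorm_eq_ofReal_abs,
          ENNReal.ofReal_le_ofReal_iff (mul_nonneg (Real.sqrt_nonneg _)
            (intervalIntegral.integral_nonneg htu fun _ _ => hρ0 _))] at h4
        have h5 : √(J t + ε) * ∫ r in t..u, ρ r ≤ ∫ r in t..u, ρ r * √(J r + 2 * ε) := by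
          rw [← intervalIntegral.integral_const_mul]
          refine intervalIntegral.integral_mono_on htu (hρ.intervalIntegrable.const_mul _)
            (hii _ _ _ hsc) fun r hr => ?_
          rw [mul_comm]
          exact mul_le_mul_of_nonneg_left (Real.sqrt_le_sqrt (by linarith [h3 r hr])) (hρ0 r)
        have h6 : D u - D t = ((∫ x, φ (x, u) ∂(μ u : Measure M)) -
            (∫ x, φ (x, t) ∂(μ u : Measure M)) - ∫ r in t..u, P r) +
            ((∫ x, φ (x, t) ∂(μ u : Measure M)) - ∫ x, φ (x, t) ∂(μ t : Measure M)) := by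
          simp only [D]
          rw [← intervalIntegral.integral_interval_sub_left (hPc.intervalIntegrable 0 u)
            (hPc.intervalIntegrable 0 t)]
          ring
        have h7 : N u - N t = (∫ r in t..u, ρ r * √(J r + 2 * ε)) + ε * (u - t) := by
          simp only [N]
          rw [← intervalIntegral.integral_interval_sub_left (hii _ 0 u hsc) (hii _ 0 t hsc)]
          ring
        rw [h6, h7]
        refine (abs_add_le _ _).trans ?_
        linarith
    -- The boundary terms vanish because a test function is zero at times `0` and `T`.
    have hDT : D T - D 0 = -∫ t in (0 : ℝ)..T, P t := by
      simp only [D, hφ.apply_eq_zero (t := T) (by simp), hφ.apply_eq_zero (t := 0) (by simp),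
        integral_zero, intervalIntegral.integral_same]
      ring
    rw [hDT, abs_neg] at hloc
    refine hloc.trans ?_
    have hle : ∫ t in (0 : ℝ)..T, ρ t * √(J t + 2 * ε) ≤
        ∫ t in (0 : ℝ)..T, (ρ t * √(J t) + √(2 * ε) * ρ t) := by
      refine intervalIntegral.integral_mono_on hT.le (hii _ _ _ hsc)
        ((hii _ _ _ hJc.sqrt).add (hρ.intervalIntegrable.const_mul _)) fun t _ => ?_
      have h1 : √(J t + 2 * ε) ≤ √(J t) + √(2 * ε) := by
        refine Real.sqrt_le_iff.2 ⟨by positivity, ?_⟩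
        have h2 := Real.sq_sqrt (slopeSq_nonneg (n := n) hpos φ t (μ t))
        have h3 := Real.sq_sqrt (show 0 ≤ 2 * ε by positivity)
        have h4 : 0 ≤ √(J t) * √(2 * ε) := by positivity
        simp only [J] at h4 ⊢
        nlinarith
      nlinarith [mul_le_mul_of_nonneg_left h1 (hρ0 t)]
    rw [intervalIntegral.integral_add (hii _ _ _ hJc.sqrt) (hρ.intervalIntegrable.const_mul _),
      intervalIntegral.integral_const_mul] at hle
    simp only [N, intervalIntegral.integral_same]
    linarith
  have hlim : Tendsto (fun ε : ℝ => (∫ t in (0 : ℝ)..T, ρ t * √(J t)) +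
      (√(2 * ε) * (∫ t in (0 : ℝ)..T, ρ t) + ε * T)) (𝓝[>] 0)
      (𝓝 (∫ t in (0 : ℝ)..T, ρ t * √(J t))) := by
    have hc : Continuous (fun ε : ℝ => (∫ t in (0 : ℝ)..T, ρ t * √(J t)) +
      (√(2 * ε) * (∫ t in (0 : ℝ)..T, ρ t) + ε * T)) := by fun_prop
    have := hc.tendsto 0
    simp only [mul_zero, Real.sqrt_zero, zero_mul, add_zero] at this
    exact this.mono_left nhdsWithin_le_nhds
  exact ge_of_tendsto hlim (by filter_upwards [self_mem_nhdsWithin] with ε hε using main ε hε)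

end TimeDerivativeBound

/-! ### Limits of velocity fields with summable increments -/

section GradientLimit

variable {n : ℕ} {M : Type*} [TopologicalSpace M] [T2Space M] [CompactSpace M]
    [SecondCountableTopology M]
    [ChartedSpace (EuclideanSpace ℝ (Fin n)) M] [IsManifold (𝓡 n) ∞ M]
    [RiemannianBundle (fun x : M => TangentSpace (𝓡 n) x)]
    [IsContMDiffRiemannianBundle (𝓡 n) ∞ (EuclideanSpace ℝ (Fin n))
      (fun x : M => TangentSpace (𝓡 n) x)]
    [MeasurableSpace M] [BorelSpace M]

/-- This is completeness of `L¹` for sections of the tangent bundle. The sum `S` of the increments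
is finite almost everywhere, so the series converges in the fibre there, and `‖Y 0‖ + S` dominates
every `Y k`. -/
theorem exists_limit_velocityField (ϖ : Measure (ℝ × M)) (Y : ℕ → VelocityField n M)
    (hY : ∀ k, Measurable (fun p : ℝ × M => (⟨p.2, Y k p.1 p.2⟩ : TangentBundle (𝓡 n) M)))
    (hYd : ∀ k, Measurable (fun p : ℝ × M => ‖Y (k + 1) p.1 p.2 - Y k p.1 p.2‖ₑ))
    (h0 : ∫⁻ p, ‖Y 0 p.1 p.2‖ₑ ∂ϖ < ⊤)
    (hs : ∑' k, ∫⁻ p, ‖Y (k + 1) p.1 p.2 - Y k p.1 p.2‖ₑ ∂ϖ < ⊤) :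
    ∃ Z : VelocityField n M,
      Measurable (fun p : ℝ × M => (⟨p.2, Z p.1 p.2⟩ : TangentBundle (𝓡 n) M)) ∧
      ∃ G : ℝ × M → ℝ≥0∞, Measurable G ∧ ∫⁻ p, G p ∂ϖ < ⊤ ∧
        (∀ k p, ‖Y k p.1 p.2‖ₑ ≤ G p) ∧
        ∀ᵐ p ∂ϖ, Tendsto (fun k => Y k p.1 p.2) atTop (𝓝 (Z p.1 p.2)) := by
  classical
  let S : ℝ × M → ℝ≥0∞ := fun p => ∑' k, ‖Y (k + 1) p.1 p.2 - Y k p.1 p.2‖ₑ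
  have hSm : Measurable S := Measurable.tsum hYd
  have hSint : ∫⁻ p, S p ∂ϖ < ⊤ := by
    rwa [lintegral_tsum fun k => (hYd k).aemeasurable]
  have hlim : ∀ p, S p ≠ ⊤ → ∃ z, Tendsto (fun k => Y k p.1 p.2) atTop (𝓝 z) := fun p hp => by
    refine cauchySeq_tendsto_of_complete (cauchySeq_of_edist_le_of_tsum_ne_top
      (fun k => ‖Y (k + 1) p.1 p.2 - Y k p.1 p.2‖ₑ) (fun k => ?_) hp)
    rw [edist_comm, edist_eq_enorm_sub]
  let Z : VelocityField n M := fun t x =>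
    if h : S (t, x) ≠ ⊤ then (hlim (t, x) h).choose else 0
  have hZ : ∀ p, S p ≠ ⊤ → Tendsto (fun k => Y k p.1 p.2) atTop (𝓝 (Z p.1 p.2)) := fun p hp => by
    have : Z p.1 p.2 = (hlim p hp).choose := dif_pos hp
    rw [this]
    exact (hlim p hp).choose_spec
  refine ⟨Z, ?_, fun p => ‖Y 0 p.1 p.2‖ₑ + S p, (measurable_enorm_comp (hY 0)).add hSm, ?_,
    fun k p => ?_, ?_⟩
  · have hSs : MeasurableSet {p | S p ≠ ⊤} := hSm (measurableSet_singleton ⊤).compl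
    -- Cutting off to the set where `S` is finite makes the sequence converge at every point, so its
    -- limit in the metrizable bundle is measurable.
    have happrox : ∀ k, Measurable (fun p : ℝ × M =>
        (⟨p.2, (if S p ≠ ⊤ then (1 : ℝ) else 0) • Y k p.1 p.2⟩ : TangentBundle (𝓡 n) M)) :=
      fun k => continuous_smul_tangentBundle.measurable.comp
        ((Measurable.ite hSs measurable_const measurable_const).prodMk (hY k))
    refine measurable_of_tendsto_metrizable happrox (tendsto_pi_nhds.2 fun p => ?_)
    have hc : Continuous (fun w : TangentSpace (𝓡 n) p.2 => (⟨p.2, w⟩ : TangentBundle (𝓡 n) M)) :=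
      FiberBundle.continuous_totalSpaceMk (EuclideanSpace ℝ (Fin n)) _ p.2
    refine (hc.tendsto _).comp ?_
    by_cases hp : S p ≠ ⊤
    · simp only [if_pos hp, one_smul]
      exact hZ p hp
    · have : Z p.1 p.2 = 0 := dif_neg hp
      simp only [if_neg hp, zero_smul, this]
      exact tendsto_const_nhds
  · rw [lintegral_add_right _ hSm]
    exact ENNReal.add_lt_top.2 ⟨h0, hSint⟩
  · have hk : ‖Y k p.1 p.2‖ₑ ≤ ‖Y 0 p.1 p.2‖ₑ +
        ∑ j ∈ Finset.range k, ‖Y (j + 1) p.1 p.2 - Y j p.1 p.2‖ₑ := by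
      induction k with
      | zero => simp
      | succ k ih =>
        rw [Finset.sum_range_succ, ← add_assoc]
        calc ‖Y (k + 1) p.1 p.2‖ₑ = ‖Y k p.1 p.2 + (Y (k + 1) p.1 p.2 - Y k p.1 p.2)‖ₑ := by
              rw [add_sub_cancel]
          _ ≤ _ := (enorm_add_le _ _).trans (add_le_add_left ih _)
    exact hk.trans (add_le_add_right (ENNReal.sum_le_tsum _) _)
  · filter_upwards [ae_lt_top hSm hSint.ne] with p hp using hZ p hp.ne

end GradientLimit

/-! ### The vector space of test functions and linearity of the gradient -/

theorem IsC1.const_smul {n : ℕ} {M : Type*} [TopologicalSpace M]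
    [ChartedSpace (EuclideanSpace ℝ (Fin n)) M] {φ : M × ℝ → ℝ} (hφ : IsC1 n φ) (c : ℝ) :
    IsC1 n (c • φ) :=
  ContMDiff.mul (f := fun _ => c) contMDiff_const hφ

section TestFunctions

variable {n : ℕ} {M : Type*} [TopologicalSpace M] [T2Space M] [CompactSpace M]
    [SecondCountableTopology M]
    [ChartedSpace (EuclideanSpace ℝ (Fin n)) M] [IsManifold (𝓡 n) ∞ M]
    [RiemannianBundle (fun x : M => TangentSpace (𝓡 n) x)]
    [IsContMDiffRiemannianBundle (𝓡 n) ∞ (EuclideanSpace ℝ (Fin n))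
      (fun x : M => TangentSpace (𝓡 n) x)]
    [MeasurableSpace M] [BorelSpace M]

theorem spatialDiff_add {φ ψ : M × ℝ → ℝ} (hφ : IsC1 n φ) (hψ : IsC1 n ψ) (t : ℝ) (x : M)
    (w : TangentSpace (𝓡 n) x) :
    spatialDiff (φ + ψ) t x w = spatialDiff φ t x w + spatialDiff ψ t x w := by
  have h1 : MDifferentiableAt (𝓡 n) 𝓘(ℝ, ℝ) (fun y => φ (y, t)) x :=
    (hφ.slice t).mdifferentiable one_ne_zero x
  have h2 : MDifferentiableAt (𝓡 n) 𝓘(ℝ, ℝ) (fun y => ψ (y, t)) x :=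
    (hψ.slice t).mdifferentiable one_ne_zero x
  unfold spatialDiff
  have := (h1.hasMFDerivAt.add h2.hasMFDerivAt).mfderiv
  change mfderiv (𝓡 n) 𝓘(ℝ, ℝ) ((fun y => φ (y, t)) + (fun y => ψ (y, t))) x w = _
  rw [this]
  rfl

theorem spatialDiff_smul {φ : M × ℝ → ℝ} (hφ : IsC1 n φ) (c t : ℝ) (x : M)
    (w : TangentSpace (𝓡 n) x) :
    spatialDiff (c • φ) t x w = c * spatialDiff φ t x w := by
  have h1 : MDifferentiableAt (𝓡 n) 𝓘(ℝ, ℝ) (fun y => φ (y, t)) x :=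
    (hφ.slice t).mdifferentiable one_ne_zero x
  unfold spatialDiff
  have := (h1.hasMFDerivAt.const_smul c).mfderiv
  change mfderiv (𝓡 n) 𝓘(ℝ, ℝ) (c • (fun y => φ (y, t))) x w = _
  rw [this]
  rfl

theorem grad_sub {φ ψ : M × ℝ → ℝ} (hφ : IsC1 n φ) (hψ : IsC1 n ψ) (t : ℝ) (x : M) :
    grad (n := n) (φ - ψ) t x = grad φ t x - grad ψ t x := by
  refine ext_inner_right ℝ fun w => ?_
  rw [inner_sub_left, inner_grad, inner_grad, inner_grad]
  exact spatialDiff_sub hφ hψ t x w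

/-- The space `C¹_c(M × (0,T))`. -/
def testFunctions (n : ℕ) (M : Type*) [TopologicalSpace M]
    [ChartedSpace (EuclideanSpace ℝ (Fin n)) M] (T : ℝ) : Submodule ℝ (M × ℝ → ℝ) where
  carrier := {φ | IsTestFunction n T φ}
  add_mem' {φ ψ} hφ hψ := ⟨hφ.contMDiff.add hψ.contMDiff, hφ.hasCompactSupport.add
    hψ.hasCompactSupport, (tsupport_add φ ψ).trans (union_subset hφ.tsupport_subset
      hψ.tsupport_subset)⟩
  zero_mem' := ⟨contMDiff_const, HasCompactSupport.zero, by simp⟩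
  smul_mem' c φ hφ := ⟨IsC1.const_smul hφ.contMDiff c, hφ.hasCompactSupport.smul_left (f := fun _ => c),
    (tsupport_smul_subset_right (fun _ => c) φ).trans hφ.tsupport_subset⟩

theorem isC1_coe {T : ℝ} (φ : testFunctions n M T) : IsC1 n (φ : M × ℝ → ℝ) :=
  IsTestFunction.contMDiff (T := T) φ.2

theorem continuous_spatialDiff_grad {φ ψ : M × ℝ → ℝ} (hφ : IsC1 n φ) (hψ : IsC1 n ψ) :
    Continuous (fun p : ℝ × M => spatialDiff φ p.1 p.2 (grad (n := n) ψ p.1 p.2)) :=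
  (continuous_spatialDiff hφ).comp
    (((continuous_grad hψ).comp continuous_swap).prodMk continuous_fst)

end TestFunctions

/-! ### A weighted Cauchy–Schwarz inequality -/

section WeightedCauchySchwarz

/-- The quadratic `s ↦ ∫ w (s + j)²` is nonnegative, so its discriminant is not positive. -/
theorem abs_integral_mul_le_sqrt_mul_sqrt {α : Type*} [MeasurableSpace α] {m : Measure α}
    {w j : α → ℝ} (hw0 : ∀ a, 0 ≤ w a) (hw : Integrable w m)
    (hwj : Integrable (fun a => w a * j a) m) (hwj2 : Integrable (fun a => w a * j a ^ 2) m) :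
    |∫ a, w a * j a ∂m| ≤ √(∫ a, w a ∂m) * √(∫ a, w a * j a ^ 2 ∂m) := by
  have hquad : ∀ s : ℝ, 0 ≤ (∫ a, w a ∂m) * (s * s) + (2 * ∫ a, w a * j a ∂m) * s +
      ∫ a, w a * j a ^ 2 ∂m := by
    intro s
    have h1 : 0 ≤ ∫ a, w a * (s + j a) ^ 2 ∂m :=
      integral_nonneg fun a => mul_nonneg (hw0 a) (sq_nonneg _)
    have h2 : (fun a => w a * (s + j a) ^ 2) =
        fun a => (s * s) * w a + (2 * s) * (w a * j a) + w a * j a ^ 2 := by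
      ext a; ring
    rw [h2, integral_add (f := fun a => (s * s) * w a + (2 * s) * (w a * j a))
        ((hw.const_mul _).add (hwj.const_mul _)) hwj2,
      integral_add (hw.const_mul _) (hwj.const_mul _), integral_const_mul,
      integral_const_mul] at h1
    linarith
  have hdisc := discrim_le_zero hquad
  rw [discrim] at hdisc
  have hw0' : 0 ≤ ∫ a, w a ∂m := integral_nonneg hw0
  refine abs_le_of_sq_le_sq ?_ (by positivity)
  rw [mul_pow, Real.sq_sqrt hw0', Real.sq_sqrt
    (integral_nonneg fun a => mul_nonneg (hw0 a) (sq_nonneg _))]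
  linarith

end WeightedCauchySchwarz

/-! ### The space-time measure and the energy form -/

section SpaceTime

variable {n : ℕ} {M : Type*} [TopologicalSpace M] [T2Space M] [CompactSpace M]
    [SecondCountableTopology M]
    [ChartedSpace (EuclideanSpace ℝ (Fin n)) M] [IsManifold (𝓡 n) ∞ M]
    [RiemannianBundle (fun x : M => TangentSpace (𝓡 n) x)]
    [IsContMDiffRiemannianBundle (𝓡 n) ∞ (EuclideanSpace ℝ (Fin n))
      (fun x : M => TangentSpace (𝓡 n) x)]
    [MeasurableSpace M] [BorelSpace M]

variable {K : M × M → ℝ} {μ : ℝ → ProbabilityMeasure M}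

/-- The measure `dμ_t dt` on `(0,T) × M`. -/
abbrev spaceTimeMeasure (hμ : Continuous μ) (T : ℝ) : Measure (ℝ × M) :=
  (volume.restrict (Ioo 0 T)).compProd (curveKernel hμ)

theorem ae_spaceTimeMeasure_mem (hμ : Continuous μ) (T : ℝ) :
    ∀ᵐ p ∂(spaceTimeMeasure hμ T), p.1 ∈ Ioo 0 T :=
  Measure.ae_compProd_of_ae_fst _ measurableSet_Ioo (ae_restrict_mem measurableSet_Ioo)

/-- The time marginal of the space-time measure is Lebesgue measure on `(0,T)`, and a continuous
function is bounded on `[0,T] × M`. -/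
theorem integrable_mul_of_continuous (hμ : Continuous μ) {T : ℝ} {ρ : ℝ → ℝ}
    (hρ : IntegrableOn ρ (Ioo 0 T)) {F : ℝ × M → ℝ} (hF : Continuous F) :
    Integrable (fun p => ρ p.1 * F p) (spaceTimeMeasure hμ T) := by
  obtain ⟨C, hC⟩ := ((isCompact_Icc (a := 0) (b := T)).prod
    (isCompact_univ (X := M))).exists_bound_of_continuousOn hF.continuousOn
  have h1 : Integrable (fun p : ℝ × M => ρ p.1) (spaceTimeMeasure hμ T) := by
    have h2 : Measure.map Prod.fst (spaceTimeMeasure hμ T) = volume.restrict (Ioo 0 T) :=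
      Measure.fst_compProd _ _
    have h3 : Integrable ρ (Measure.map Prod.fst (spaceTimeMeasure hμ T)) := by
      rw [h2]; exact hρ
    exact h3.comp_measurable measurable_fst
  refine h1.mul_bdd (c := C) hF.measurable.aestronglyMeasurable ?_
  filter_upwards [ae_spaceTimeMeasure_mem hμ T] with p hp
  exact hC p ⟨Ioo_subset_Icc_self hp, mem_univ _⟩

theorem integrable_of_continuous_spaceTime (hμ : Continuous μ) (T : ℝ) {F : ℝ × M → ℝ}
    (hF : Continuous F) : Integrable F (spaceTimeMeasure hμ T) := by
  simpa using integrable_mul_of_continuous hμ (T := T) (ρ := fun _ => 1) (by simp) hF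

theorem integral_spaceTimeMeasure (hμ : Continuous μ) {T : ℝ} (hT : 0 < T) {f : ℝ × M → ℝ}
    (hf : Integrable f (spaceTimeMeasure hμ T)) :
    ∫ p, f p ∂(spaceTimeMeasure hμ T) =
      ∫ t in (0 : ℝ)..T, ∫ x, f (t, x) ∂(μ t : Measure M) := by
  rw [Measure.integral_compProd hf, intervalIntegral.integral_of_le hT.le,
    integral_Ioc_eq_integral_Ioo]
  rfl

theorem lintegral_spaceTimeMeasure (hμ : Continuous μ) (T : ℝ) {f : ℝ × M → ℝ≥0∞}
    (hf : Measurable f) :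
    ∫⁻ p, f p ∂(spaceTimeMeasure hμ T) =
      ∫⁻ t in Ioo 0 T, ∫⁻ x, f (t, x) ∂(μ t : Measure M) :=
  Measure.lintegral_compProd hf

theorem integrable_deriv_time (hμ : Continuous μ) (T : ℝ) {φ : M × ℝ → ℝ} (hφ : IsC1 n φ) :
    Integrable (fun p : ℝ × M => deriv (fun s => φ (p.2, s)) p.1) (spaceTimeMeasure hμ T) :=
  integrable_of_continuous_spaceTime hμ T ((continuous_deriv_time hφ).comp continuous_swap)

variable (n) in
/-- The functional `φ ↦ -∫∫ ∂_tφ dμ_t dt`. -/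
def timeDerivFunctional (hμ : Continuous μ) (T : ℝ) : testFunctions n M T →ₗ[ℝ] ℝ where
  toFun φ := -∫ p, deriv (fun s => (φ : M × ℝ → ℝ) (p.2, s)) p.1 ∂(spaceTimeMeasure hμ T)
  map_add' φ ψ := by
    rw [← neg_add, ← integral_add (integrable_deriv_time hμ T (isC1_coe φ))
      (integrable_deriv_time hμ T (isC1_coe ψ))]
    congr 2
    ext p
    exact ((hasDerivAt_time (isC1_coe φ) p.2 p.1).add (hasDerivAt_time (isC1_coe ψ) p.2 p.1)).deriv
  map_smul' c φ := by
    simp only [RingHom.id_apply, smul_eq_mul, mul_neg, ← integral_const_mul]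
    congr 2
    ext p
    exact ((hasDerivAt_time (isC1_coe φ) p.2 p.1).const_mul c).deriv

theorem continuous_gradForm (hK : Continuous K)
    (hpos : ∀ (ν : ProbabilityMeasure M) x, 0 < mobility K ν x) (hμ : Continuous μ)
    {φ ψ : M × ℝ → ℝ} (hφ : IsC1 n φ) (hψ : IsC1 n ψ) :
    Continuous (fun p : ℝ × M => spatialDiff φ p.1 p.2 (grad (n := n) ψ p.1 p.2) /
      mobility K (μ p.1) p.2) :=
  (continuous_spatialDiff_grad hφ hψ).div ((continuous_mobility hK).comp
    (continuous_snd.prodMk (hμ.comp continuous_fst))) fun _ => (hpos _ _).ne'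

theorem spatialDiff_grad_comm (φ ψ : M × ℝ → ℝ) (t : ℝ) (x : M) :
    spatialDiff φ t x (grad (n := n) ψ t x) = spatialDiff ψ t x (grad (n := n) φ t x) := by
  rw [← inner_grad, ← inner_grad, real_inner_comm]

theorem spatialDiff_grad_self (φ : M × ℝ → ℝ) (t : ℝ) (x : M) :
    spatialDiff φ t x (grad (n := n) φ t x) = ‖grad (n := n) φ t x‖ ^ 2 := by
  rw [← inner_grad, real_inner_self_eq_norm_sq]

variable (n) in
/-- The form `(φ, ψ) ↦ ∫ ρ ∫ ⟨∇φ, ∇ψ⟩ / m_μ dμ_t dt`. -/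
def gradForm (hK : Continuous K)
    (hpos : ∀ (ν : ProbabilityMeasure M) x, 0 < mobility K ν x) (hμ : Continuous μ) (T : ℝ)
    {ρ : ℝ → ℝ} (hρ : Integrable ρ) : testFunctions n M T →ₗ[ℝ] testFunctions n M T →ₗ[ℝ] ℝ :=
  have hint (φ ψ : testFunctions n M T) := integrable_mul_of_continuous hμ (T := T)
    hρ.integrableOn (continuous_gradForm hK hpos hμ (isC1_coe φ) (isC1_coe ψ))
  have hadd (φ φ' ψ : testFunctions n M T) (p : ℝ × M) :
      spatialDiff (n := n) ((φ + φ' : testFunctions n M T) : M × ℝ → ℝ) p.1 p.2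
        (grad (ψ : M × ℝ → ℝ) p.1 p.2) = _ :=
    spatialDiff_add (isC1_coe φ) (isC1_coe φ') p.1 p.2 (grad (ψ : M × ℝ → ℝ) p.1 p.2)
  have hsmul (c : ℝ) (φ ψ : testFunctions n M T) (p : ℝ × M) :
      spatialDiff (n := n) ((c • φ : testFunctions n M T) : M × ℝ → ℝ) p.1 p.2
        (grad (ψ : M × ℝ → ℝ) p.1 p.2) = _ :=
    spatialDiff_smul (isC1_coe φ) c p.1 p.2 (grad (ψ : M × ℝ → ℝ) p.1 p.2)
  LinearMap.mk₂ ℝ (fun φ ψ => ∫ p, ρ p.1 * (spatialDiff (φ : M × ℝ → ℝ) p.1 p.2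
      (grad (n := n) (ψ : M × ℝ → ℝ) p.1 p.2) / mobility K (μ p.1) p.2) ∂(spaceTimeMeasure hμ T))
    (fun φ φ' ψ => by
      rw [← integral_add (hint φ ψ) (hint φ' ψ)]
      simp only [hadd, add_div, mul_add])
    (fun c φ ψ => by
      rw [smul_eq_mul, ← integral_const_mul]
      simp only [hsmul, mul_div_assoc, mul_left_comm])
    (fun φ ψ ψ' => by
      rw [← integral_add (hint φ ψ) (hint φ ψ')]
      simp only [spatialDiff_grad_comm (φ : M × ℝ → ℝ), hadd, add_div, mul_add])
    (fun c φ ψ => by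
      rw [smul_eq_mul, ← integral_const_mul]
      simp only [spatialDiff_grad_comm (φ : M × ℝ → ℝ), hsmul, mul_div_assoc, mul_left_comm])

end SpaceTime

/-! ### Riesz representation of the time derivative by a velocity field -/

section Flux

variable {n : ℕ} {M : Type*} [TopologicalSpace M] [T2Space M] [CompactSpace M]
    [SecondCountableTopology M]
    [ChartedSpace (EuclideanSpace ℝ (Fin n)) M] [IsManifold (𝓡 n) ∞ M]
    [RiemannianBundle (fun x : M => TangentSpace (𝓡 n) x)]
    [IsContMDiffRiemannianBundle (𝓡 n) ∞ (EuclideanSpace ℝ (Fin n))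
      (fun x : M => TangentSpace (𝓡 n) x)]
    [MeasurableSpace M] [BorelSpace M]

variable {K : M × M → ℝ} {μ : ℝ → ProbabilityMeasure M}

theorem gradForm_apply (hK : Continuous K)
    (hpos : ∀ (ν : ProbabilityMeasure M) x, 0 < mobility K ν x) (hμ : Continuous μ) (T : ℝ)
    {ρ : ℝ → ℝ} (hρ : Integrable ρ) (φ ψ : testFunctions n M T) :
    gradForm n hK hpos hμ T hρ φ ψ = ∫ p, ρ p.1 * (spatialDiff (φ : M × ℝ → ℝ) p.1 p.2
      (grad (n := n) (ψ : M × ℝ → ℝ) p.1 p.2) / mobility K (μ p.1) p.2)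
      ∂(spaceTimeMeasure hμ T) := rfl

theorem gradForm_self (hK : Continuous K)
    (hpos : ∀ (ν : ProbabilityMeasure M) x, 0 < mobility K ν x) (hμ : Continuous μ) {T : ℝ}
    {ρ : ℝ → ℝ} (hρ : Integrable ρ) (φ : testFunctions n M T) :
    gradForm n hK hpos hμ T hρ φ φ = ∫ p, ρ p.1 / mobility K (μ p.1) p.2 *
      ‖grad (n := n) (φ : M × ℝ → ℝ) p.1 p.2‖ ^ 2 ∂(spaceTimeMeasure hμ T) := by
  rw [gradForm_apply]
  refine integral_congr_ae (Eventually.of_forall fun p => ?_)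
  simp only [spatialDiff_grad_self]
  ring

theorem gradForm_self_eq_integral_slopeSq (hK : Continuous K)
    (hpos : ∀ (ν : ProbabilityMeasure M) x, 0 < mobility K ν x) (hμ : Continuous μ) {T : ℝ}
    (hT : 0 < T) {ρ : ℝ → ℝ} (hρ : Integrable ρ) (φ : testFunctions n M T) :
    gradForm n hK hpos hμ T hρ φ φ =
      ∫ t in (0 : ℝ)..T, ρ t * slopeSq n K (φ : M × ℝ → ℝ) t (μ t) := by
  rw [gradForm_apply, integral_spaceTimeMeasure hμ hT (integrable_mul_of_continuous hμ
    hρ.integrableOn (continuous_gradForm hK hpos hμ (isC1_coe φ) (isC1_coe φ)))]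
  refine intervalIntegral.integral_congr fun t _ => ?_
  simp only [spatialDiff_grad_self, integral_const_mul]
  rfl

/-- Cauchy–Schwarz for the measure `ρ dt` converts `∫ ρ · slope` into the energy norm; only
integrability of `ρ` is used. -/
theorem abs_timeDerivFunctional_le (hK : Continuous K)
    (hpos : ∀ (ν : ProbabilityMeasure M) x, 0 < mobility K ν x) (hμ : Continuous μ)
    {ρ : ℝ → ℝ} (hρ0 : ∀ t, 0 ≤ ρ t) (hρ : Integrable ρ) {T : ℝ} (hT : 0 < T)
    (hd : ∀ s ∈ Icc 0 T, ∀ r ∈ Icc 0 T, s ≤ r →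
      transportDist n K (μ s) (μ r) ≤ ENNReal.ofReal (∫ t in s..r, ρ t))
    (φ : testFunctions n M T) :
    |timeDerivFunctional n hμ T φ| ≤
      √(∫ t in (0 : ℝ)..T, ρ t) * √(gradForm n hK hpos hμ T hρ φ φ) := by
  have h1 := abs_integral_deriv_time_le hK hpos hμ hρ0 hρ hT hd φ.2
  have hJ := continuous_slopeSq_curve (n := n) hK hpos hμ (isC1_coe φ)
  have hii : ∀ c : ℝ → ℝ, Continuous c → IntervalIntegrable (fun t => ρ t * c t) volume 0 T :=
    fun c hc => hρ.intervalIntegrable.mul_continuousOn hc.continuousOn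
  have hsq : (fun t => ρ t * √(slopeSq n K (φ : M × ℝ → ℝ) t (μ t)) ^ 2) =
      fun t => ρ t * slopeSq n K (φ : M × ℝ → ℝ) t (μ t) :=
    funext fun t => by rw [Real.sq_sqrt (slopeSq_nonneg hpos _ _ _)]
  have h2 := abs_integral_mul_le_sqrt_mul_sqrt (m := volume.restrict (Ioc 0 T)) hρ0
    hρ.integrableOn
    ((intervalIntegrable_iff_integrableOn_Ioc_of_le hT.le).1 (hii _ hJ.sqrt))
    (by rw [hsq]; exact (intervalIntegrable_iff_integrableOn_Ioc_of_le hT.le).1 (hii _ hJ))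
  rw [hsq, ← intervalIntegral.integral_of_le hT.le, ← intervalIntegral.integral_of_le hT.le,
    ← intervalIntegral.integral_of_le hT.le] at h2
  rw [gradForm_self_eq_integral_slopeSq hK hpos hμ hT hρ φ]
  refine le_trans (le_of_eq_of_le ?_ h1) ((le_abs_self _).trans h2)
  change |-∫ p, deriv (fun s => (φ : M × ℝ → ℝ) (p.2, s)) p.1 ∂(spaceTimeMeasure hμ T)| = _
  rw [abs_neg, integral_spaceTimeMeasure hμ hT (integrable_deriv_time hμ T (isC1_coe φ))]

theorem continuous_norm_grad_swap {φ : M × ℝ → ℝ} (hφ : IsC1 n φ) :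
    Continuous (fun p : ℝ × M => ‖grad (n := n) φ p.1 p.2‖) :=
  Continuous.comp (g := fun p : M × ℝ => ‖grad (n := n) φ p.2 p.1‖) (f := Prod.swap)
    (continuous_norm_grad hφ) continuous_swap

theorem measurable_smul_grad {w : ℝ × M → ℝ} (hw : Measurable w) {φ : M × ℝ → ℝ}
    (hφ : IsC1 n φ) : Measurable (fun p : ℝ × M =>
      (⟨p.2, w (p.1, p.2) • grad φ p.1 p.2⟩ : TangentBundle (𝓡 n) M)) := by
  have h1 : Measurable (fun p : ℝ × M => (⟨p.2, grad φ p.1 p.2⟩ : TangentBundle (𝓡 n) M)) :=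
    ((continuous_grad hφ).comp continuous_swap).measurable
  exact continuous_smul_tangentBundle.measurable.comp (hw.prodMk h1)

/-- An absolutely continuous curve is driven by a velocity field `v` whose weighted energy
`∫∫ m_μ |v|² / ρ` is at most `∫ ρ`. -/
theorem exists_velocityField (hK : Continuous K)
    (hpos : ∀ (ν : ProbabilityMeasure M) x, 0 < mobility K ν x) (hμ : Continuous μ)
    {ρ : ℝ → ℝ} (hρm : Measurable ρ) (hρ0 : ∀ t, 0 ≤ ρ t) (hρ : Integrable ρ) {T : ℝ} (hT : 0 < T)
    (hd : ∀ s ∈ Icc 0 T, ∀ r ∈ Icc 0 T, s ≤ r →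
      transportDist n K (μ s) (μ r) ≤ ENNReal.ofReal (∫ t in s..r, ρ t)) :
    ∃ v : VelocityField n M,
      Measurable (fun p : ℝ × M => (⟨p.2, v p.1 p.2⟩ : TangentBundle (𝓡 n) M)) ∧
      ∫⁻ p, ‖v p.1 p.2‖ₑ ∂(spaceTimeMeasure hμ T) < ⊤ ∧
      (∀ ψ : M × ℝ → ℝ, IsTestFunction n T ψ →
        ∫ p, spatialDiff ψ p.1 p.2 (v p.1 p.2) ∂(spaceTimeMeasure hμ T) =
          -∫ p, deriv (fun s => ψ (p.2, s)) p.1 ∂(spaceTimeMeasure hμ T)) ∧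
      ∫⁻ p, ENNReal.ofReal (mobility K (μ p.1) p.2 / ρ p.1) * ‖v p.1 p.2‖ₑ ^ 2
        ∂(spaceTimeMeasure hμ T) ≤ ENNReal.ofReal (∫ t in (0 : ℝ)..T, ρ t) ∧
      ∀ᵐ p ∂(spaceTimeMeasure hμ T), ρ p.1 = 0 → v p.1 p.2 = 0 := by
  set Q := spaceTimeMeasure hμ T with hQ
  set R : ℝ := ∫ t in (0 : ℝ)..T, ρ t with hR
  have hR0 : 0 ≤ R := intervalIntegral.integral_nonneg hT.le fun t _ => hρ0 t
  have hmc : Continuous (fun p : ℝ × M => mobility K (μ p.1) p.2) :=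
    (continuous_mobility hK).comp (continuous_snd.prodMk (hμ.comp continuous_fst))
  set w : ℝ × M → ℝ := fun p => ρ p.1 / mobility K (μ p.1) p.2 with hw
  have hw0 : ∀ p, 0 ≤ w p := fun p => div_nonneg (hρ0 _) (hpos _ _).le
  have hwm : Measurable w := (hρm.comp measurable_fst).div hmc.measurable
  have hwint : ∀ F : ℝ × M → ℝ, Continuous F → Integrable (fun p => w p * F p) Q := fun F hF => by
    have := integrable_mul_of_continuous hμ (T := T) hρ.integrableOn
      (hF.div hmc fun p => (hpos _ _).ne')
    refine this.congr (Eventually.of_forall fun p => ?_)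
    change ρ p.1 * (F p / mobility K (μ p.1) p.2) = ρ p.1 / mobility K (μ p.1) p.2 * F p
    ring
  have hwi : Integrable w Q := by simpa using hwint (fun _ => 1) continuous_const
  obtain ⟨φ, hφ1, hφ2, hφ3⟩ := exists_seq_tendsto_of_bounded (gradForm n hK hpos hμ T hρ)
    (fun φ ψ => by simp only [gradForm_apply, spatialDiff_grad_comm (φ : M × ℝ → ℝ)])
    (fun φ => by
      rw [gradForm_self]
      exact integral_nonneg fun p => mul_nonneg (hw0 p) (sq_nonneg _))
    (timeDerivFunctional n hμ T) (abs_timeDerivFunctional_le hK hpos hμ hρ0 hρ hT hd)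
  -- With this weight, pairing `Y k` with the differential of a test function `ψ` and integrating
  -- gives the energy form of `φ k` and `ψ`, which tends to the functional at `ψ`.
  let Y : ℕ → VelocityField n M := fun k t x => w (t, x) • grad (φ k : M × ℝ → ℝ) t x
  have hgradc : ∀ ψ : testFunctions n M T,
      Continuous (fun p : ℝ × M => ‖grad (n := n) (ψ : M × ℝ → ℝ) p.1 p.2‖) := fun ψ =>
    continuous_norm_grad_swap (isC1_coe ψ)
  have hYm : ∀ k, Measurable (fun p : ℝ × M => (⟨p.2, Y k p.1 p.2⟩ : TangentBundle (𝓡 n) M)) :=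
    fun k => measurable_smul_grad hwm (isC1_coe (φ k))
  have hYenorm : ∀ (ψ : testFunctions n M T) (p : ℝ × M),
      ‖w p • grad (n := n) (ψ : M × ℝ → ℝ) p.1 p.2‖ₑ =
        ENNReal.ofReal (w p * ‖grad (n := n) (ψ : M × ℝ → ℝ) p.1 p.2‖) := fun ψ p => by
    rw [← ofReal_norm, norm_smul, Real.norm_of_nonneg (hw0 p)]
  have hYd : ∀ k (p : ℝ × M), Y (k + 1) p.1 p.2 - Y k p.1 p.2 =
      w p • grad (n := n) ((φ (k + 1) - φ k : testFunctions n M T) : M × ℝ → ℝ) p.1 p.2 :=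
    fun k p => by
      rw [Submodule.coe_sub, grad_sub (isC1_coe _) (isC1_coe _), smul_sub]
  have hmeas1 : ∀ ψ : testFunctions n M T, Measurable (fun p : ℝ × M =>
      ‖w p • grad (n := n) (ψ : M × ℝ → ℝ) p.1 p.2‖ₑ) := fun ψ => by
    simp only [hYenorm]
    exact (hwm.mul (hgradc ψ).measurable).ennreal_ofReal
  have hL1 : ∀ ψ : testFunctions n M T,
      ∫⁻ p, ‖w p • grad (n := n) (ψ : M × ℝ → ℝ) p.1 p.2‖ₑ ∂Q ≤
        ENNReal.ofReal (√(∫ p, w p ∂Q) * √(gradForm n hK hpos hμ T hρ ψ ψ)) := fun ψ => by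
    simp only [hYenorm]
    rw [← ofReal_integral_eq_lintegral_ofReal (hwint _ (hgradc ψ))
      (Eventually.of_forall fun p => mul_nonneg (hw0 p) (norm_nonneg _)), gradForm_self]
    exact ENNReal.ofReal_le_ofReal ((le_abs_self _).trans (abs_integral_mul_le_sqrt_mul_sqrt hw0
      hwi (hwint _ (hgradc ψ)) (hwint _ ((hgradc ψ).pow 2))))
  -- Successive `φ k` differ by at most `(1/2)^k` in energy norm, which controls the `L¹` norm of
  -- the fields because `w` is integrable.
  have hsum : ∑' k, ∫⁻ p, ‖Y (k + 1) p.1 p.2 - Y k p.1 p.2‖ₑ ∂Q < ⊤ := by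
    have hle : ∀ k, ∫⁻ p, ‖Y (k + 1) p.1 p.2 - Y k p.1 p.2‖ₑ ∂Q ≤
        ENNReal.ofReal (√(∫ p, w p ∂Q) * (1 / 2) ^ k) := fun k => by
      simp only [hYd]
      refine (hL1 _).trans (ENNReal.ofReal_le_ofReal ?_)
      gcongr
      refine Real.sqrt_le_iff.2 ⟨by positivity, (hφ1 k).trans_eq ?_⟩
      rw [← pow_mul, mul_comm, pow_mul]
      norm_num
    refine (ENNReal.tsum_le_tsum hle).trans_lt (Summable.tsum_ofReal_lt_top ?_)
    exact (summable_geometric_of_lt_one (by norm_num) (by norm_num)).mul_left _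
  obtain ⟨v, hvm, G, hGm, hGint, hYG, hlim⟩ := exists_limit_velocityField Q Y hYm
    (fun k => by simp only [hYd]; exact hmeas1 _)
    ((hL1 (φ 0)).trans_lt ENNReal.ofReal_lt_top) hsum
  have hlimn : ∀ᵐ p ∂Q, Tendsto (fun k => ‖Y k p.1 p.2‖ₑ) atTop (𝓝 ‖v p.1 p.2‖ₑ) := by
    filter_upwards [hlim] with p hp using
      (continuous_enorm (E := TangentSpace (𝓡 n) p.2)).continuousAt.tendsto.comp hp
  refine ⟨v, hvm, ?_, fun ψ hψ => ?_, ?_, ?_⟩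
  · refine (lintegral_mono_ae ?_).trans_lt hGint
    filter_upwards [hlimn] with p hp
    exact le_of_tendsto hp (Eventually.of_forall fun k => hYG k p)
  · have hψ1 : IsC1 n ψ := hψ.contMDiff
    obtain ⟨C, hC0, hC⟩ := exists_forall_norm_grad_le hψ1 0 T
    have hlhs : Tendsto (fun k => ∫ p, spatialDiff ψ p.1 p.2 (Y k p.1 p.2) ∂Q) atTop
        (𝓝 (∫ p, spatialDiff ψ p.1 p.2 (v p.1 p.2) ∂Q)) := by
      refine tendsto_integral_of_dominated_convergence (fun p => C * (G p).toReal)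
        (fun k => (measurable_spatialDiff_comp (hYm k) hψ1 measurable_id).aestronglyMeasurable)
        ((integrable_toReal_of_lintegral_ne_top hGm.aemeasurable hGint.ne).const_mul C)
        (fun k => ?_) ?_
      · filter_upwards [ae_spaceTimeMeasure_mem hμ T, ae_lt_top hGm hGint.ne] with p hp hG
        refine (abs_spatialDiff_le ψ p.1 p.2 _).trans (mul_le_mul
          (hC _ (Ioo_subset_Icc_self hp) _) ?_ (norm_nonneg _) hC0)
        rw [← toReal_enorm]
        exact ENNReal.toReal_mono hG.ne (hYG k p)
      · filter_upwards [hlim] with p hp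
        simp only [← inner_grad]
        exact tendsto_const_nhds.inner hp
    have hrhs := hφ3 ⟨ψ, hψ⟩
    refine tendsto_nhds_unique hlhs (hrhs.congr fun k => ?_)
    rw [gradForm_apply]
    refine integral_congr_ae (Eventually.of_forall fun p => ?_)
    simp only [Y, ← inner_grad, inner_smul_right, hw, real_inner_comm (grad (n := n) ψ p.1 p.2)]
    ring
  · have hval : ∀ k (p : ℝ × M), ENNReal.ofReal (mobility K (μ p.1) p.2 / ρ p.1) *
        ‖Y k p.1 p.2‖ₑ ^ 2 ≤
        ENNReal.ofReal (w p * ‖grad (n := n) (φ k : M × ℝ → ℝ) p.1 p.2‖ ^ 2) := fun k p => by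
      rw [show ‖Y k p.1 p.2‖ₑ = _ from hYenorm (φ k) p, ← ENNReal.ofReal_pow
        (mul_nonneg (hw0 p) (norm_nonneg _)), ← ENNReal.ofReal_mul
        (div_nonneg (hpos _ _).le (hρ0 _))]
      refine ENNReal.ofReal_le_ofReal (le_of_eq ?_)
      -- Where `ρ` vanishes, `m_μ / ρ` is `0` by the convention for division, and both sides are
      -- zero.
      rcases eq_or_ne (ρ p.1) 0 with h | h
      · simp [hw, h]
      · have := (hpos (μ p.1) p.2).ne'
        simp only [hw]
        field_simp
    have hle : ∀ k, ∫⁻ p, ENNReal.ofReal (mobility K (μ p.1) p.2 / ρ p.1) * ‖Y k p.1 p.2‖ₑ ^ 2 ∂Q ≤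
        ENNReal.ofReal ((√R + (1 / 2) ^ k) ^ 2) := fun k => by
      refine (lintegral_mono (hval k)).trans ?_
      rw [← ofReal_integral_eq_lintegral_ofReal (hwint
        (fun p => ‖grad (n := n) (φ k : M × ℝ → ℝ) p.1 p.2‖ ^ 2) ((hgradc (φ k)).pow 2))
        (Eventually.of_forall fun p => mul_nonneg (hw0 p) (sq_nonneg _))]
      refine ENNReal.ofReal_le_ofReal ?_
      rw [← gradForm_self hK hpos hμ hρ]
      exact (Real.sqrt_le_left (by positivity)).1 (hφ2 k)
    have hlimR : Tendsto (fun k : ℕ => ENNReal.ofReal ((√R + (1 / 2) ^ k) ^ 2)) atTop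
        (𝓝 (ENNReal.ofReal R)) := by
      refine ENNReal.tendsto_ofReal ?_
      have h1 := ((tendsto_pow_atTop_nhds_zero_of_lt_one (r := (1 / 2 : ℝ)) (by norm_num)
        (by norm_num)).const_add √R).pow 2
      rwa [add_zero, Real.sq_sqrt hR0] at h1
    have hcoef : Measurable (fun p : ℝ × M => ENNReal.ofReal (mobility K (μ p.1) p.2 / ρ p.1)) :=
      (hmc.measurable.div (hρm.comp measurable_fst)).ennreal_ofReal
    -- Fatou's lemma along the almost everywhere convergent sequence `Y k`.
    calc ∫⁻ p, ENNReal.ofReal (mobility K (μ p.1) p.2 / ρ p.1) * ‖v p.1 p.2‖ₑ ^ 2 ∂Q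
        = ∫⁻ p, liminf (fun k => ENNReal.ofReal (mobility K (μ p.1) p.2 / ρ p.1) *
            ‖Y k p.1 p.2‖ₑ ^ 2) atTop ∂Q := by
          refine lintegral_congr_ae ?_
          filter_upwards [hlimn] with p hp
          exact (Tendsto.liminf_eq (ENNReal.Tendsto.const_mul
            (((ENNReal.continuous_pow 2).tendsto _).comp hp)
            (Or.inr ENNReal.ofReal_ne_top))).symm
      _ ≤ liminf (fun k => ∫⁻ p, ENNReal.ofReal (mobility K (μ p.1) p.2 / ρ p.1) *
            ‖Y k p.1 p.2‖ₑ ^ 2 ∂Q) atTop :=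
          lintegral_liminf_le fun k => hcoef.mul ((measurable_enorm_comp (hYm k)).pow_const 2)
      _ ≤ liminf (fun k : ℕ => ENNReal.ofReal ((√R + (1 / 2) ^ k) ^ 2)) atTop :=
          liminf_le_liminf (Eventually.of_forall hle)
      _ = ENNReal.ofReal R := hlimR.liminf_eq
  -- Needed separately: where `ρ = 0` the coefficient `m_μ / ρ` is `0`, so the energy bound says
  -- nothing about `v` there.
  · filter_upwards [hlimn] with p hp h0
    refine enorm_eq_zero.1 (tendsto_nhds_unique hp (tendsto_const_nhds.congr fun k => ?_))
    simp only [Y, hw, h0, zero_div, zero_smul, enorm_zero]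

end Flux

/-! ### The velocity field realizes the metric derivative -/

section TangentVelocity

variable {n : ℕ} {M : Type*} [TopologicalSpace M] [T2Space M] [CompactSpace M]
    [SecondCountableTopology M]
    [ChartedSpace (EuclideanSpace ℝ (Fin n)) M] [IsManifold (𝓡 n) ∞ M]
    [RiemannianBundle (fun x : M => TangentSpace (𝓡 n) x)]
    [IsContMDiffRiemannianBundle (𝓡 n) ∞ (EuclideanSpace ℝ (Fin n))
      (fun x : M => TangentSpace (𝓡 n) x)]
    [MeasurableSpace M] [BorelSpace M]

variable {K : M × M → ℝ} {μ : ℝ → ProbabilityMeasure M}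

theorem IsAbsContCurve.continuousOn_of_transportDist (hK : Continuous K)
    (hpos : ∀ (ν : ProbabilityMeasure M) x, 0 < mobility K ν x)
    {ρ : ℝ → ℝ} (hρ : Integrable ρ) {T : ℝ}
    (hd : ∀ s ∈ Icc 0 T, ∀ r ∈ Icc 0 T, s ≤ r →
      transportDist n K (μ s) (μ r) ≤ ENNReal.ofReal (∫ t in s..r, ρ t)) :
    ContinuousOn μ (Icc 0 T) := by
  intro t ht
  refine tendsto_of_tendsto_transportDist (n := n) hK hpos ?_
  have hc : Continuous (fun u => ENNReal.ofReal |∫ r in t..u, ρ r|) :=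
    ENNReal.continuous_ofReal.comp (intervalIntegral.continuous_primitive
      (fun a b => hρ.intervalIntegrable) t).abs
  have h0 := (hc.tendsto t).mono_left (nhdsWithin_le_nhds (s := Icc 0 T))
  simp only [intervalIntegral.integral_same, abs_zero, ENNReal.ofReal_zero] at h0
  refine tendsto_of_tendsto_of_tendsto_of_le_of_le' tendsto_const_nhds h0
    (Eventually.of_forall fun _ => bot_le) ?_
  filter_upwards [self_mem_nhdsWithin] with u hu
  rcases le_total t u with h | h
  · exact (hd t ht u hu h).trans (ENNReal.ofReal_le_ofReal (le_abs_self _))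
  · rw [transportDist_comm hK, intervalIntegral.integral_symm, abs_neg]
    exact (hd u hu t ht h).trans (ENNReal.ofReal_le_ofReal (le_abs_self _))

/-- Fubini for the space-time measure. The kernel requires a curve `m` continuous on all of `ℝ`,
whereas `μ` is only relevant on `(0,T)`. -/
theorem isCE_of_spaceTimeMeasure {T : ℝ} (hT : 0 < T) {m : ℝ → ProbabilityMeasure M}
    (hm : Continuous m) (heq : EqOn m μ (Ioo 0 T)) {v : VelocityField n M}
    (hvm : Measurable (fun p : ℝ × M => (⟨p.2, v p.1 p.2⟩ : TangentBundle (𝓡 n) M)))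
    (hvint : ∫⁻ p, ‖v p.1 p.2‖ₑ ∂(spaceTimeMeasure hm T) < ⊤)
    (hweak : ∀ ψ : M × ℝ → ℝ, IsTestFunction n T ψ →
        ∫ p, spatialDiff ψ p.1 p.2 (v p.1 p.2) ∂(spaceTimeMeasure hm T) =
          -∫ p, deriv (fun s => ψ (p.2, s)) p.1 ∂(spaceTimeMeasure hm T)) :
    IsCE T μ v where
  continuousOn := hm.continuousOn.congr heq.symm
  borel := hvm.comp ((measurable_subtype_coe.comp measurable_snd).prodMk measurable_fst)
  integrable := by
    rw [lintegral_spaceTimeMeasure hm T (measurable_enorm_comp hvm)] at hvint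
    refine lt_of_eq_of_lt (setLIntegral_congr_fun measurableSet_Ioo fun t ht => ?_) hvint
    simp only [heq ht]
  weak ψ hψ := by
    have hψ1 : IsC1 n ψ := hψ.contMDiff
    obtain ⟨C, hC0, hC⟩ := exists_forall_norm_grad_le hψ1 0 T
    have hDm := measurable_spatialDiff_comp hvm hψ1 measurable_id
    have hDi : Integrable (fun p : ℝ × M => spatialDiff ψ p.1 p.2 (v p.1 p.2))
        (spaceTimeMeasure hm T) := by
      refine ((integrable_toReal_of_lintegral_ne_top
        (measurable_enorm_comp hvm).aemeasurable hvint.ne).const_mul C).mono'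
        hDm.aestronglyMeasurable ?_
      filter_upwards [ae_spaceTimeMeasure_mem hm T] with p hp
      rw [toReal_enorm]
      exact (abs_spatialDiff_le ψ p.1 p.2 _).trans (mul_le_mul_of_nonneg_right
        (hC _ (Ioo_subset_Icc_self hp) _) (norm_nonneg _))
    have hdi := integrable_deriv_time hm T hψ1
    have h1 := integral_spaceTimeMeasure hm hT (hdi.add hDi)
    simp only [Pi.add_apply] at h1
    rw [integral_add hdi hDi, hweak ψ hψ, add_neg_cancel, intervalIntegral.integral_of_le hT.le,
      integral_Ioc_eq_integral_Ioo] at h1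
    refine (setIntegral_congr_fun measurableSet_Ioo fun t ht => ?_).trans h1.symm
    simp only [heq ht]

theorem weightedAction_extendZero {T : ℝ} {v : VelocityField n M} {t : ℝ} (ht : t ∈ Ioo 0 T) :
    weightedAction K (clampCurve T μ t) (extendZero T v t) = weightedAction K (μ t) (v t) := by
  rw [clampCurve_of_mem μ (Ioo_subset_Icc_self ht),
    show extendZero T v t = v t from funext fun x => if_pos ht]

theorem IsCE.transportDist_le {T : ℝ} (hT : 0 < T) (hK : Continuous K)
    {μ' : ℝ → ProbabilityMeasure M} {v : VelocityField n M} (h : IsCE T μ v)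
    (hc : ContinuousOn μ' (Icc 0 T)) (heq : EqOn μ' μ (Ioo 0 T)) {s r : ℝ} (hs : s ∈ Icc 0 T)
    (hr : r ∈ Icc 0 T) (hsr : s ≤ r) :
    transportDist n K (μ' s) (μ' r) ≤
      ∫⁻ t in Ioo s r, weightedAction K (clampCurve T μ' t) (extendZero T v t) ^ (1 / 2 : ℝ) := by
  have h1 := (h.isFlow hT hc heq).transportDist_le hK hsr
  rwa [clampCurve_of_mem μ' hs, clampCurve_of_mem μ' hr] at h1

/-- Every absolutely continuous curve solves the continuity equation for a velocity field whose
weighted norm is the metric derivative. -/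
theorem IsAbsContCurve.exists_isCE (hK : Continuous K)
    (hpos : ∀ (ν : ProbabilityMeasure M) x, 0 < mobility K ν x) {T : ℝ} (hT : 0 < T)
    (h : IsAbsContCurve (transportDist n K) T μ) :
    ∃ v : VelocityField n M, IsCE T μ v ∧
        ∀ᵐ t ∂(volume.restrict (Ioo 0 T)),
          HasMetricDerivAt (transportDist n K) μ t
            (weightedAction K (μ t) (v t) ^ (1 / 2 : ℝ)) := by
  obtain ⟨ρ, hρm, hρ0, hρ, hd, hder⟩ := h.exists_metricDeriv (transportDist_self K)
    (transportDist_comm hK) (transportDist_triangle hK) hT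
  have hcont := IsAbsContCurve.continuousOn_of_transportDist hK hpos hρ hd
  have hm : Continuous (clampCurve T μ) := continuous_clampCurve hT hcont
  have hmeq : EqOn (clampCurve T μ) μ (Icc 0 T) := fun t ht => clampCurve_of_mem μ ht
  obtain ⟨v, hvm, hvint, hweak, hact, hzero⟩ := exists_velocityField hK hpos hm hρm hρ0 hρ hT
    (fun s hs r hr hsr => by rw [hmeq hs, hmeq hr]; exact hd s hs r hr hsr)
  have hCE : IsCE T μ v := isCE_of_spaceTimeMeasure hT hm (hmeq.mono Ioo_subset_Icc_self) hvm hvint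
    hweak
  have hflow := hCE.isFlow hT hcont fun t _ => rfl
  refine ⟨v, hCE, ?_⟩
  set A : ℝ → ℝ≥0∞ := fun t => weightedAction K (clampCurve T μ t) (extendZero T v t) with hA
  have hAm : Measurable A := measurable_weightedAction hK hflow
  set e : ℝ × M → ℝ≥0∞ := fun p =>
    ENNReal.ofReal (mobility K (clampCurve T μ p.1) p.2 / ρ p.1) * ‖v p.1 p.2‖ₑ ^ 2 with he
  have hem : Measurable e := by
    refine Measurable.mul (Measurable.ennreal_ofReal (Measurable.div ?_ (hρm.comp measurable_fst)))
      ((measurable_enorm_comp hvm).pow_const 2)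
    exact ((continuous_mobility hK).comp
      (continuous_snd.prodMk (hm.comp continuous_fst))).measurable
  set a : ℝ → ℝ≥0∞ := fun t => ∫⁻ x, e (t, x) ∂((clampCurve T μ t : ProbabilityMeasure M) : Measure M) with ha
  have ham : Measurable a := measurable_lintegral_curve hm hem
  rw [lintegral_spaceTimeMeasure hm T hem] at hact
  have hρint : ∫⁻ t in Ioo 0 T, ENNReal.ofReal (ρ t) =
      ENNReal.ofReal (∫ t in (0 : ℝ)..T, ρ t) := by
    rw [intervalIntegral.integral_of_le hT.le, integral_Ioc_eq_integral_Ioo,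
      ofReal_integral_eq_lintegral_ofReal hρ.integrableOn (Eventually.of_forall hρ0)]
  -- At times with `ρ t = 0` this uses that `v` vanishes there.
  have hAa : ∀ᵐ t ∂(volume.restrict (Ioo 0 T)), A t = ENNReal.ofReal (ρ t) * a t := by
    filter_upwards [ae_restrict_mem measurableSet_Ioo, Measure.ae_ae_of_ae_compProd hzero]
      with t ht hz
    simp only [hA, ha, he, weightedAction, extendZero, if_pos ht]
    rw [← lintegral_const_mul' _ _ ENNReal.ofReal_ne_top]
    refine lintegral_congr_ae ?_
    filter_upwards [hz] with x hx
    rcases eq_or_ne (ρ t) 0 with h0 | h0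
    · simp [hx h0]
    · rw [← mul_assoc, ← ENNReal.ofReal_mul (hρ0 t), mul_div_cancel₀ _ h0]
  -- Here `√(ρ a) ≤ ρ + a`, and both terms are integrable; finite length is what the length estimate
  -- requires for differentiation.
  have hsqrt : ∫⁻ t in Ioo 0 T, A t ^ (1 / 2 : ℝ) < ⊤ := by
    have hle : ∫⁻ t in Ioo 0 T, A t ^ (1 / 2 : ℝ) ≤
        ∫⁻ t in Ioo 0 T, (ENNReal.ofReal (ρ t) + a t) := by
      refine lintegral_mono_ae ?_
      filter_upwards [hAa] with t ht
      rw [ht, ENNReal.sqrt_le_iff, sq]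
      exact mul_le_mul' le_self_add le_add_self
    refine hle.trans_lt ?_
    rw [lintegral_add_right _ ham, hρint]
    exact ENNReal.add_lt_top.2 ⟨ENNReal.ofReal_lt_top, hact.trans_lt ENNReal.ofReal_lt_top⟩
  have hρA := HasMetricDerivAt.ae_le_of_le_lintegral hT (transportDist_comm hK)
    (hAm.pow_const (1 / 2 : ℝ)) hsqrt
    (fun s hs r hr hsr => hCE.transportDist_le hT hK hcont (fun t _ => rfl) hs hr hsr) hder
  have hρa : ∀ᵐ t ∂(volume.restrict (Ioo 0 T)), ENNReal.ofReal (ρ t) ≤ a t := by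
    filter_upwards [hAa, hρA] with t h1 h2
    rcases eq_or_ne (ENNReal.ofReal (ρ t)) 0 with h0 | h0
    · rw [h0]; exact bot_le
    · rw [h1, ENNReal.le_sqrt_iff, sq] at h2
      exact (ENNReal.mul_le_mul_iff_right h0 ENNReal.ofReal_ne_top).1 h2
  -- The pointwise bound `ρ ≤ a` and the reverse inequality of the integrals force equality.
  have hρeq : (fun t => ENNReal.ofReal (ρ t)) =ᵐ[volume.restrict (Ioo 0 T)] a :=
    ae_eq_of_ae_le_of_lintegral_le hρa (by rw [hρint]; exact ENNReal.ofReal_ne_top)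
      ham.aemeasurable (by rw [hρint]; exact hact)
  filter_upwards [hder, hAa, hρeq, ae_restrict_mem measurableSet_Ioo] with t h1 h2 h3 ht
  have h4 : weightedAction K (μ t) (v t) = ENNReal.ofReal (ρ t) ^ 2 := by
    rw [← weightedAction_extendZero ht, sq]
    nth_rewrite 2 [h3]
    exact h2
  rwa [h4, ENNReal.sq_sqrt]

end TangentVelocity

/-! ### Curves driven by a velocity field of finite length -/

section FiniteLength

variable {n : ℕ} {M : Type*} [TopologicalSpace M] [T2Space M] [CompactSpace M]
    [SecondCountableTopology M]
    [ChartedSpace (EuclideanSpace ℝ (Fin n)) M] [IsManifold (𝓡 n) ∞ M]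
    [RiemannianBundle (fun x : M => TangentSpace (𝓡 n) x)]
    [IsContMDiffRiemannianBundle (𝓡 n) ∞ (EuclideanSpace ℝ (Fin n))
      (fun x : M => TangentSpace (𝓡 n) x)]
    [MeasurableSpace M] [BorelSpace M]

variable {K : M × M → ℝ} {μ : ℝ → ProbabilityMeasure M}

theorem IsTestFunction.deriv_eq_zero {T : ℝ} {φ : M × ℝ → ℝ} (hφ : IsTestFunction n T φ) {t : ℝ}
    (ht : t ∉ Ioo 0 T) (x : M) : deriv (fun s => φ (x, s)) t = 0 := by
  have h1 : φ =ᶠ[𝓝 (x, t)] 0 :=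
    notMem_tsupport_iff_eventuallyEq.1 fun hm => ht (hφ.tsupport_subset hm).2
  have hc : Continuous (fun s : ℝ => (x, s)) := by fun_prop
  have h2 : (fun s => φ (x, s)) =ᶠ[𝓝 t] fun _ => 0 := (hc.tendsto t).eventually h1
  rw [h2.deriv_eq, deriv_const]

theorem IsTestFunction.spatialDiff_eq_zero {T : ℝ} {φ : M × ℝ → ℝ} (hφ : IsTestFunction n T φ)
    {t : ℝ} (ht : t ∉ Ioo 0 T) (x : M) (w : TangentSpace (𝓡 n) x) : spatialDiff φ t x w = 0 := by
  have h1 : (fun y => φ (y, t)) = fun _ => 0 := funext fun y => hφ.apply_eq_zero ht y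
  rw [spatialDiff, h1, mfderiv_const]
  rfl

theorem IsTestFunction.shift {S T a : ℝ} (ha : 0 ≤ a) (haS : a + S ≤ T) {φ : M × ℝ → ℝ}
    (hφ : IsTestFunction n S φ) : IsTestFunction n T (fun p : M × ℝ => φ (p.1, p.2 - a)) where
  contMDiff := by
    have h1 : ContMDiff 𝓘(ℝ, ℝ) 𝓘(ℝ, ℝ) 1 (fun t : ℝ => t - a) :=
      (contDiff_id.sub contDiff_const).contMDiff
    exact hφ.contMDiff.comp (contMDiff_fst.prodMk (h1.comp contMDiff_snd))
  hasCompactSupport :=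
    hφ.hasCompactSupport.comp_homeomorph ((Homeomorph.refl M).prodCongr (Homeomorph.subRight a))
  tsupport_subset p hp := by
    have h1 : Continuous (fun p : M × ℝ => (p.1, p.2 - a)) := by fun_prop
    have h2 : (p.1, p.2 - a) ∈ tsupport φ := by
      have := closure_mono (t := (fun p : M × ℝ => (p.1, p.2 - a)) ⁻¹' tsupport φ)
        (fun q hq => subset_tsupport φ hq) hp
      rwa [((isClosed_tsupport φ).preimage h1).closure_eq] at this
    have h3 := (hφ.tsupport_subset h2).2
    exact ⟨mem_univ _, by linarith [h3.1], by linarith [h3.2]⟩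

theorem setLIntegral_Ioo_comp_add (f : ℝ → ℝ≥0∞) (S a : ℝ) :
    ∫⁻ t in Ioo 0 S, f (t + a) = ∫⁻ t in Ioo a (S + a), f t := by
  rw [← lintegral_indicator measurableSet_Ioo, ← lintegral_indicator measurableSet_Ioo,
    ← lintegral_add_right_eq_self ((Ioo a (S + a)).indicator f) a]
  refine lintegral_congr fun t => ?_
  simp only [indicator, mem_Ioo, lt_add_iff_pos_left, add_lt_add_iff_right]

/-- Restriction to a subinterval, translated to start at `0`. On a compactly contained subinterval
the curve is continuous up to the endpoints, so the extension to a global flow becomes available. -/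
theorem IsCE.shift {S T a : ℝ} (hS : 0 < S) (ha : 0 ≤ a) (haS : a + S ≤ T) {v : VelocityField n M}
    (h : IsCE T μ v) : IsCE S (fun t => μ (t + a)) (fun t => v (t + a)) where
  continuousOn := h.continuousOn.comp (by fun_prop) fun t ht =>
    ⟨by linarith [ht.1], by linarith [ht.2]⟩
  borel := by
    have h1 : Measurable (fun p : M × Ioo (0 : ℝ) S =>
        ((p.1, ⟨p.2 + a, by linarith [p.2.2.1], by linarith [p.2.2.2]⟩) : M × Ioo (0 : ℝ) T)) :=
      measurable_fst.prodMk
        (((measurable_subtype_coe.comp measurable_snd).add_const a).subtype_mk)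
    exact h.borel.comp h1
  integrable := by
    rw [setLIntegral_Ioo_comp_add (fun t => ∫⁻ x, ‖v t x‖ₑ ∂(μ t : Measure M))]
    exact (lintegral_mono_set (Ioo_subset_Ioo ha (by linarith))).trans_lt h.integrable
  weak φ hφ := by
    have hsub : Ioo a (S + a) ⊆ Ioo 0 T := Ioo_subset_Ioo ha (by linarith)
    have hderiv (x : M) (t : ℝ) :
        deriv (fun s => φ (x, s - a)) t = deriv (fun s => φ (x, s)) (t - a) :=
      deriv_comp_sub_const (f := fun s => φ (x, s)) a t
    have h1 := h.weak _ (hφ.shift ha haS)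
    rw [setIntegral_eq_of_subset_of_forall_sdiff_eq_zero measurableSet_Ioo hsub,
      ← integral_Ioc_eq_integral_Ioo, ← intervalIntegral.integral_of_le (by linarith)] at h1
    · rw [← integral_Ioc_eq_integral_Ioo, ← intervalIntegral.integral_of_le hS.le]
      have h2 := intervalIntegral.integral_comp_add_right (a := 0) (b := S) (fun t => ∫ x,
        (deriv (fun s => φ (x, s - a)) t + spatialDiff (fun p : M × ℝ => φ (p.1, p.2 - a)) t x
          (v t x)) ∂(μ t : Measure M)) a
      rw [zero_add, h1] at h2
      refine Eq.trans (intervalIntegral.integral_congr fun t _ => ?_) h2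
      refine integral_congr_ae (Eventually.of_forall fun x => ?_)
      have hsp (w : TangentSpace (𝓡 n) x) :
          spatialDiff (fun p : M × ℝ => φ (p.1, p.2 - a)) (t + a) x w =
            spatialDiff φ (t + a - a) x w := rfl
      simp only [hderiv, hsp, add_sub_cancel_right]
    · intro t ht
      have ht' : t - a ∉ Ioo 0 S := fun h' => ht.2 ⟨by linarith [h'.1], by linarith [h'.2]⟩
      refine integral_eq_zero_of_ae (Eventually.of_forall fun x => ?_)
      have h2 := hφ.deriv_eq_zero ht' x
      have h3 := hφ.spatialDiff_eq_zero ht' x (v t x)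
      simp only [hderiv, Pi.zero_apply]
      rw [h2, zero_add]
      exact h3

theorem IsCE.transportDist_le_of_mem_Ioo {T : ℝ} (hK : Continuous K) {v : VelocityField n M}
    (h : IsCE T μ v) {s r : ℝ} (hs : 0 < s) (hr : r < T) (hsr : s ≤ r) :
    transportDist n K (μ s) (μ r) ≤
      ∫⁻ t in Ioo s r, weightedAction K (μ t) (v t) ^ (1 / 2 : ℝ) := by
  rcases hsr.eq_or_lt with rfl | hlt
  · rw [transportDist_self]; exact bot_le
  have hS : 0 < r - s := by linarith
  have hc : ContinuousOn (fun t => μ (t + s)) (Icc 0 (r - s)) :=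
    h.continuousOn.comp (by fun_prop) fun t ht => ⟨by linarith [ht.1], by linarith [ht.2]⟩
  have h1 := (h.shift hS hs.le (by linarith)).transportDist_le hS hK hc (fun t _ => rfl)
    (left_mem_Icc.2 hS.le) (right_mem_Icc.2 hS.le) hS.le
  rw [zero_add, sub_add_cancel, setLIntegral_congr_fun (g := fun t =>
    weightedAction K (μ (t + s)) (v (t + s)) ^ (1 / 2 : ℝ)) measurableSet_Ioo fun t ht => by
      dsimp only
      rw [weightedAction_extendZero (μ := fun t => μ (t + s)) (v := fun t => v (t + s)) ht],
    setLIntegral_Ioo_comp_add (fun t => weightedAction K (μ t) (v t) ^ (1 / 2 : ℝ)),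
    sub_add_cancel] at h1
  exact h1

/-- Completeness of the distance is not needed: narrow compactness provides a cluster point, and
each `C¹` observable, being Lipschitz for the distance, is Cauchy and so converges to its value at
that point. -/
theorem exists_tendsto_of_transportDist_cauchy (hK : Continuous K)
    (hpos : ∀ (ν : ProbabilityMeasure M) x, 0 < mobility K ν x) {l : Filter ℝ} [l.NeBot]
    (h : ∀ ε > 0, ∃ s ∈ l, ∀ t ∈ s, ∀ u ∈ s, transportDist n K (μ t) (μ u) < ε) :
    ∃ ν, Tendsto μ l (𝓝 ν) := by
  obtain ⟨ν, hν⟩ := exists_clusterPt_of_compactSpace (map μ l)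
  refine ⟨ν, tendsto_of_forall_contMDiff (n := n) fun ψ hψ => ?_⟩
  obtain ⟨L, -, hL⟩ := exists_enorm_integral_sub_le hK hpos (IsC1.of_space hψ) 0 0
  have hFc : Continuous (fun σ : ProbabilityMeasure M => ∫ x, ψ x ∂(σ : Measure M)) :=
    (continuous_integral_pairing (P := Unit) (f := fun p => ψ p.2)
      (hψ.continuous.comp continuous_snd)).comp ((continuous_const (y := ())).prodMk continuous_id)
  have hcl : ClusterPt (∫ x, ψ x ∂(ν : Measure M))
      (map (fun t => ∫ x, ψ x ∂(μ t : Measure M)) l) := by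
    have := hν.map hFc.continuousAt tendsto_map
    rwa [map_map] at this
  refine le_nhds_of_cauchy_adhp (EMetric.cauchy_iff.2 ⟨NeBot.ne inferInstance, fun ε hε => ?_⟩) hcl
  -- The `+ 1` keeps the divisor nonzero when `L = 0`.
  obtain ⟨s, hs, hsε⟩ := h (ε / (ENNReal.ofReal L + 1))
    (ENNReal.div_pos hε.ne' (by simp))
  refine ⟨_, image_mem_map hs, ?_⟩
  rintro _ ⟨t, ht, rfl⟩ _ ⟨u, hu, rfl⟩
  rw [edist_eq_enorm_sub]
  have h0 : ENNReal.ofReal L + 1 ≠ 0 := by simp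
  have h1 : ENNReal.ofReal L + 1 ≠ ⊤ := by simp
  calc _ ≤ ENNReal.ofReal L * transportDist n K (μ u) (μ t) := hL 0 (by simp) _ _
    _ ≤ (ENNReal.ofReal L + 1) * transportDist n K (μ u) (μ t) := by gcongr; exact le_self_add
    _ < ε := by
      rw [mul_comm]
      exact (ENNReal.lt_div_iff_mul_lt (Or.inl h0) (Or.inl h1)).1 (hsε u hu t ht)

/-- The length of the curve over a short time interval is small by absolute continuity of the
integral, so the curve is Cauchy at `c`. It is applied with `c = 0` and `c = T`. -/
theorem IsCE.exists_tendsto (hK : Continuous K)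
    (hpos : ∀ (ν : ProbabilityMeasure M) x, 0 < mobility K ν x) {T : ℝ} {v : VelocityField n M}
    (h : IsCE T μ v) (hfin : ∫⁻ t in Ioo 0 T, weightedAction K (μ t) (v t) ^ (1 / 2 : ℝ) < ⊤)
    (c : ℝ) [(𝓝[Ioo 0 T] c).NeBot] : ∃ ν, Tendsto μ (𝓝[Ioo 0 T] c) (𝓝 ν) := by
  refine exists_tendsto_of_transportDist_cauchy (n := n) hK hpos fun ε hε => ?_
  obtain ⟨δ, hδ, hsmall⟩ := exists_pos_setLIntegral_lt_of_measure_lt hfin.ne hε.ne'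
  have hev : ∀ᶠ t in 𝓝 c, ENNReal.ofReal |t - c| < δ / 2 := by
    have hc : Continuous (fun t => ENNReal.ofReal |t - c|) :=
      ENNReal.continuous_ofReal.comp (by fun_prop)
    refine (hc.tendsto c).eventually (gt_mem_nhds ?_)
    simpa using hδ.ne'
  have key : ∀ t ∈ Ioo 0 T, ∀ u ∈ Ioo 0 T, t ≤ u → ENNReal.ofReal |t - c| < δ / 2 →
      ENNReal.ofReal |u - c| < δ / 2 → transportDist n K (μ t) (μ u) < ε := by
    intro t ht u hu htu h1 h2
    refine (h.transportDist_le_of_mem_Ioo hK ht.1 hu.2 htu).trans_lt ?_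
    have hsub : Ioo t u ⊆ Ioo 0 T := Ioo_subset_Ioo ht.1.le hu.2.le
    have h3 := hsmall (Ioo t u) ?_
    · rwa [Measure.restrict_restrict measurableSet_Ioo, inter_eq_left.2 hsub] at h3
    · refine (Measure.restrict_apply_le _ _).trans_lt ?_
      rw [Real.volume_Ioo]
      calc ENNReal.ofReal (u - t) ≤ ENNReal.ofReal |t - c| + ENNReal.ofReal |u - c| := by
            rw [← ENNReal.ofReal_add (abs_nonneg _) (abs_nonneg _)]
            refine ENNReal.ofReal_le_ofReal ?_
            linarith [neg_abs_le (t - c), le_abs_self (u - c)]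
        _ < δ / 2 + δ / 2 := ENNReal.add_lt_add h1 h2
        _ = δ := ENNReal.add_halves δ
  refine ⟨_, inter_mem self_mem_nhdsWithin (nhdsWithin_le_nhds hev), fun t ht u hu => ?_⟩
  rcases le_total t u with htu | htu
  · exact key t ht.1 u hu.1 htu ht.2 hu.2
  · rw [transportDist_comm hK]
    exact key u hu.1 t ht.1 htu hu.2 ht.2

/-- A solution of the continuity equation of finite length extends to an absolutely continuous
curve whose metric derivative is bounded by the weighted norm of the velocity. -/
theorem IsCE.exists_isAbsContCurve (hK : Continuous K)
    (hpos : ∀ (ν : ProbabilityMeasure M) x, 0 < mobility K ν x) {T : ℝ} (hT : 0 < T)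
    {v : VelocityField n M} (h : IsCE T μ v)
    (hfin : ∫⁻ t in Ioo 0 T, weightedAction K (μ t) (v t) ^ (1 / 2 : ℝ) < ⊤) :
    ∃ μ' : ℝ → ProbabilityMeasure M, EqOn μ' μ (Ioo 0 T) ∧ ContinuousOn μ' (Icc 0 T) ∧
        IsAbsContCurve (transportDist n K) T μ' ∧
        ∀ᵐ t ∂(volume.restrict (Ioo 0 T)), ∃ L : ℝ≥0∞,
          HasMetricDerivAt (transportDist n K) μ' t L ∧
          L ≤ weightedAction K (μ t) (v t) ^ (1 / 2 : ℝ) := by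
  have hne0 : (𝓝[Ioo 0 T] (0 : ℝ)).NeBot := by rw [nhdsWithin_Ioo_eq_nhdsGT hT]; infer_instance
  have hneT : (𝓝[Ioo 0 T] T).NeBot := by rw [nhdsWithin_Ioo_eq_nhdsLT hT]; infer_instance
  obtain ⟨ν, hν⟩ := h.exists_tendsto hK hpos hfin 0
  obtain ⟨η, hη⟩ := h.exists_tendsto hK hpos hfin T
  rw [nhdsWithin_Ioo_eq_nhdsGT hT] at hν
  rw [nhdsWithin_Ioo_eq_nhdsLT hT] at hη
  have heq : EqOn (extendFrom (Ioo 0 T) μ) μ (Ioo 0 T) := fun t ht =>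
    extendFrom_extends h.continuousOn t ht
  have hc := continuousOn_Icc_extendFrom_Ioo h.continuousOn hν hη
  set μ' := extendFrom (Ioo 0 T) μ
  set f : ℝ → ℝ≥0∞ := fun t =>
    weightedAction K (clampCurve T μ' t) (extendZero T v t) ^ (1 / 2 : ℝ) with hf
  have hfm : Measurable f := measurable_sqrt_weightedAction hK (h.isFlow hT hc heq)
  have hfeq : ∀ t ∈ Ioo 0 T, f t = weightedAction K (μ t) (v t) ^ (1 / 2 : ℝ) := fun t ht => by
    simp only [hf]
    rw [weightedAction_extendZero ht, heq ht]
  have hffin : ∫⁻ t in Ioo 0 T, f t < ⊤ := by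
    rwa [setLIntegral_congr_fun measurableSet_Ioo hfeq]
  have hd : ∀ s ∈ Icc 0 T, ∀ r ∈ Icc 0 T, s ≤ r →
      transportDist n K (μ' s) (μ' r) ≤ ∫⁻ t in Ioo s r, f t := fun s hs r hr hsr =>
    h.transportDist_le hT hK hc heq hs hr hsr
  have hac : IsAbsContCurve (transportDist n K) T μ' := isAbsContCurve_of_le_lintegral hfm hffin hd
  obtain ⟨ρ, -, -, -, -, hder⟩ := hac.exists_metricDeriv (transportDist_self K)
    (transportDist_comm hK) (transportDist_triangle hK) hT
  refine ⟨μ', heq, hc, hac, ?_⟩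
  filter_upwards [hder, HasMetricDerivAt.ae_le_of_le_lintegral hT (transportDist_comm hK) hfm
    hffin hd hder, ae_restrict_mem measurableSet_Ioo] with t h1 h2 ht
  exact ⟨_, h1, by rwa [hfeq t ht] at h2⟩

end FiniteLength

end

/-! ### The main theorem -/

theorem mainTheorem3 (n : ℕ) (M : Type*) [TopologicalSpace M] [T2Space M] [CompactSpace M]
    [ChartedSpace (EuclideanSpace ℝ (Fin n)) M] [IsManifold (𝓡 n) ∞ M]
    [RiemannianBundle (fun x : M => TangentSpace (𝓡 n) x)]
    [IsContMDiffRiemannianBundle (𝓡 n) ∞ (EuclideanSpace ℝ (Fin n))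
      (fun x : M => TangentSpace (𝓡 n) x)]
    [MeasurableSpace M] [BorelSpace M]
    (K : M × M → ℝ) (hK : Continuous K) (hK_lower : ∃ C : ℝ, 0 < C ∧ ∀ p, C ≤ K p)
    (T : ℝ) (hT : 0 < T) :
    (∀ μ : ℝ → ProbabilityMeasure M, IsAbsContCurve (transportDist n K) T μ →
      ∃ v : VelocityField n M, IsCE T μ v ∧
        ∀ᵐ t ∂(volume.restrict (Ioo 0 T)),
          HasMetricDerivAt (transportDist n K) μ t
            (weightedAction K (μ t) (v t) ^ (1 / 2 : ℝ))) ∧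
    (∀ (μ : ℝ → ProbabilityMeasure M) (v : VelocityField n M), IsCE T μ v →
      ∫⁻ t in Ioo 0 T, weightedAction K (μ t) (v t) ^ (1 / 2 : ℝ) < ⊤ →
      ∃ μ' : ℝ → ProbabilityMeasure M, EqOn μ' μ (Ioo 0 T) ∧ ContinuousOn μ' (Icc 0 T) ∧
        IsAbsContCurve (transportDist n K) T μ' ∧
        ∀ᵐ t ∂(volume.restrict (Ioo 0 T)), ∃ L : ℝ≥0∞,
          HasMetricDerivAt (transportDist n K) μ' t L ∧
          L ≤ weightedAction K (μ t) (v t) ^ (1 / 2 : ℝ)) := by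
  have : SecondCountableTopology M := secondCountableTopology_of_compact_manifold n M
  obtain ⟨C, hC0, hC⟩ := hK_lower
  have hpos : ∀ (ν : ProbabilityMeasure M) x, 0 < mobility K ν x := fun ν x =>
    hC0.trans_le (le_mobility hK hC ν x)
  exact ⟨fun μ h => h.exists_isCE hK hpos hT, fun μ v h hfin =>
    h.exists_isAbsContCurve hK hpos hT hfin⟩
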